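/- **Setting.** Let $\mathcal X\subseteq\mathbb R^n$ be a connected $q$-dimensional Lie group, embedded as a closed set $\mathcal X=\{x\in U: h(x)=0\}$, where $U\subseteq\mathbb R^n$ is open, $h:U\to\mathbb R^{n-q}$ is smooth and $Dh(x)$ is onto for $x\in\mathcal X$. Let $S:U\to\mathbb R^{n\times q}$ be smooth such that for each $x\in\mathcal X$ the columns of $S(x)$ form a basis of $T_x\mathcal X=\ker Dh(x)$, and let $S^\top S$ be bounded above on $\mathcal X$. Put $P_S=S(S^\top S)^{-1}$. Consider $$\dot x=f(x)+B(x)u+B_w(x)w,\qquad z=g(x,u),$$ with $u\in\mathbb R^m$, $w\in\mathbb R^p$, $z\in\mathbb R^l$, where $f,B=[b_i],B_w=[b_{w,j}],g$ are $C^1$ (for $x\in U$) and $f,b_i,b_{w,j}$ are tangent to $\mathcal X$ on $\mathcal X$. Write $B=SE$ and $B_w=SE_w$ on $\mathcal X$. Solutions evolve on $\mathcal X$, are locally absolutely continuous on $[0,\infty)$ and satisfy the differential equation for almost every $t$. Let $u=k(x,x^*)+u^*$ be a feedback, where $k(x,x)=0$ and $k$ is $C^1$ in $x$; put $K=\partial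 k/\partial x$. With $A=\frac{\partial f}{\partial x}+\sum_i u_i\frac{\partial b_i}{\partial x}+\sum_j w_j\frac{\partial b_{w,j}}{\partial x}$, $C=\partial g/\partial x$, $D=\partial g/\partial u$, put $$\mathcal A=(\dot P_S^\top+P_S^\top A+EK)S,\qquad \mathcal C=(C+DK)S,$$ where a dot denotes the derivative along $\dot x=f+Bu+B_ww$ and everything is evaluated at $u=k(x,x^*)+u^*$. Let $\mathcal M:U\to\mathbb R^{q\times q}$ be $C^1$, symmetric on $\mathcal X$, with $\underline{\mathfrak m}I\preceq\mathcal M\preceq\overline{\mathfrak m}I$ on $\mathcal X$ for some constants $\underline{\mathfrak m},\overline{\mathfrak m}>0$. Let $\alpha,\lambda,\mu>0$ and suppose that for all $x,x^*\in\mathcal X$, $u^*\in\mathbb R^m$, $w\in\mathbb R^p$ $$R_1=\begin{bmatrix}\dot{\mathcal M}+\mathcal M\mathcal A+(\mathcal M\mathcal A)^\top+2\lambda\mathcal M&\mathcal ME_w\\E_w^\top\mathcal M&-\mu I_p\end{bmatrix}\preceq0 .$$ Below, $(x^*,u^*,w^*)$ with output $z^*=g(x^*,u^*)$ is any nominal solution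 on $[0,\infty)$, $(x,\,k(x,x^*)+u^*,\,w)$ with output $z$ is any closed-loop solution on $[0,\infty)$ with $\|w\|_{L_\infty}=\sup_{t\ge0}\|w(t)\|<\infty$, and $\overline w=\|w-w^*\|_{L_\infty}=\sup_{t\ge 0}\|w(t)-w^*(t)\|\in[0,\infty]$. For a distance $d$ on the output space consider the following two properties. *(Gain)* There is $\beta:\mathcal X\times\mathcal X\to[0,\infty)$ with $\beta(x,x)=0$ such that for all such solutions and all $T>0$ $$\sup_{0\le t\le T}d(z(t),z^*(t))^2\le\alpha^2\sup_{0\le t\le T}\|w(t)-w^*(t)\|^2+\beta(x(0),x^*(0)).$$ *(Tube)* There is $\beta:\mathcal X\times\mathcal X\to[0,\infty)$ with $\beta(x,x)=0$ such that for all such solutions: (i) $d(z(t),z^*(t))^2\le\alpha^2\overline w^2+e^{-2\lambda t}\beta(x(0),x^*(0))$ for all $t\ge0$; (ii) for every $\varepsilon>0$, $d(z(t),z^*(t))\le\alpha\overline w+\varepsilon$ for all sufficiently large $t$; (iii) if $\beta(x(t_0),x^*(t_0))\le\alpha\mu\overline w^2$ for some $t_0\ge0$ (in particular if $x(t_0)=x^*(t_0)$),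 then for all $t\ge t_0$ one has $\beta(x(t),x^*(t))\le\alpha\mu\overline w^2$ and $d(z(t),z^*(t))\le\alpha\overline w$. **Statement.** 1. Suppose that for all $x,x^*\in\mathcal X$, $u^*\in\mathbb R^m$ $$R_2=\begin{bmatrix}2\lambda\mathcal M-\alpha^{-1}\mathcal C^\top\mathcal C&0\\0&(\alpha-\mu)I_p\end{bmatrix}\succeq0 .$$ Then (Gain) and (Tube) hold for the Euclidean distance $d(z,z^*)=\|z-z^*\|$; so after transients $z$ stays in $\{y\in\mathbb R^l:\|y-z^*\|\le\alpha\overline w\}$ in the sense of (i)–(iii). 2. Suppose that $g$ takes $\mathcal X\times\mathbb R^m$ into a Lie group $\mathcal Z\subseteq\mathbb R^l$, embedded in the same way as $\mathcal X$ (not necessarily connected), that the columns of the smooth matrix function $S_z$ form a basis of $T_z\mathcal Z$ at every $z\in\mathcal Z$ (for instance a left-invariant frame, so that $v_z$ in $\delta z=S_zv_z$ are the left-trivialized coordinates), and that $Q$ is symmetric positive definite. Equip $\mathcal Z$ with the Riemannian metric $\mathsf g(v_{z,1},v_{z,2})=v_{z,1}^\top Qv_{z,2}=\delta z_1^\top P_{S_z}QP_{S_z}^\top\delta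 z_2$, where $P_{S_z}=S_z(S_z^\top S_z)^{-1}$, and let $d_{\mathsf g}$ be its Riemannian distance. If for all $x,x^*\in\mathcal X$, $u^*\in\mathbb R^m$ $$R_2'=\begin{bmatrix}2\lambda\mathcal M-\alpha^{-1}\mathcal C^\top P_{S_z}QP_{S_z}^\top\mathcal C&0\\0&(\alpha-\mu)I_p\end{bmatrix}\succeq0$$ (with $P_{S_z}$ evaluated at $z=g(x,k(x,x^*)+u^*)$), then (Gain) and (Tube) hold for $d=d_{\mathsf g}$; so after transients $z$ stays in the geodesic ball $\{y\in\mathcal Z: d_{\mathsf g}(y,z^*)\le\alpha\overline w\}$ in the sense of (i)–(iii). -/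

import Mathlib

open scoped ContDiff ENNReal Matrix

noncomputable section

namespace LieRCCM

/-- Real coordinate space. Its Euclidean norm is written out below (`eucl`); the norm of the
function space only enters through topology, derivatives and absolute continuity. -/
abbrev Vec (n : ℕ) : Type := Fin n → ℝ

/-- The Euclidean 2-norm of a coordinate vector. -/
def eucl {n : ℕ} (v : Vec n) : ℝ≥0∞ := ‖WithLp.toLp 2 v‖ₑ

/-- The Jacobian matrix of `F` at `x`. -/
def jac {n k : ℕ} (F : Vec n → Vec k) (x : Vec n) : Matrix (Fin k) (Fin n) ℝ :=
  LinearMap.toMatrix' (fderiv ℝ F x : Vec n →ₗ[ℝ] Vec k)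

/-- The directional derivative `∂_v Q (x)` of a matrix-valued function. -/
def matDeriv {n a b : ℕ} (Q : Vec n → Matrix (Fin a) (Fin b) ℝ) (x v : Vec n) :
    Matrix (Fin a) (Fin b) ℝ :=
  Matrix.of fun i j => fderiv ℝ (fun y => Q y i j) x v

/-- A matrix-valued function is of class `C^r` on `U`. -/
def MatContDiffOn {n a b : ℕ} (r : WithTop ℕ∞) (Q : Vec n → Matrix (Fin a) (Fin b) ℝ)
    (U : Set (Vec n)) : Prop :=
  ∀ i j, ContDiffOn ℝ r (fun y => Q y i j) U

/-- A `q`-dimensional Lie group `𝒳 ⊆ ℝⁿ`: a closed set that is the regular zero set of a smooth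
constraint function `h` with values in `ℝ^(n-q)` (defined on an open neighbourhood `dom` of `𝒳`,
possibly all of `ℝⁿ`), with a group law whose multiplication and inversion are smooth. -/
structure EmbeddedLieGroup (n q : ℕ) where
  carrier : Set (Vec n)
  dom : Set (Vec n)
  h : Vec n → Vec (n - q)
  le_dim : q ≤ n
  isOpen_dom : IsOpen dom
  isClosed_carrier : IsClosed carrier
  smooth_h : ContDiffOn ℝ ∞ h dom
  carrier_eq : carrier = {x | x ∈ dom ∧ h x = 0}
  regular : ∀ x ∈ carrier, Function.Surjective (fderiv ℝ h x)
  group : Group carrier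
  smooth_mul : ∃ F : Vec n × Vec n → Vec n, ContDiffOn ℝ ∞ F (carrier ×ˢ carrier) ∧
    ∀ a b : carrier, F (a, b) = ((a * b : carrier) : Vec n)
  smooth_inv : ∃ F : Vec n → Vec n, ContDiffOn ℝ ∞ F carrier ∧
    ∀ a : carrier, F a = ((a⁻¹ : carrier) : Vec n)

/-- The tangent space `T_x 𝒳`, as a subspace of the ambient space. -/
def EmbeddedLieGroup.tangent {n q : ℕ} (X : EmbeddedLieGroup n q) (x : Vec n) :
    Submodule ℝ (Vec n) :=
  LinearMap.ker (fderiv ℝ X.h x : Vec n →ₗ[ℝ] Vec (n - q))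

/-- `S = [s₁, …, s_q]` is a smooth global frame: at every `x ∈ 𝒳` its columns form a basis of
`T_x 𝒳`. For left-invariant `sᵢ` the coordinates `v` of `δx = S(x) v` are the left-trivialized
ones. -/
structure EmbeddedLieGroup.IsFrame {n q : ℕ} (X : EmbeddedLieGroup n q)
    (S : Vec n → Matrix (Fin n) (Fin q) ℝ) : Prop where
  smooth : MatContDiffOn ∞ S X.dom
  injective : ∀ x ∈ X.carrier, Function.Injective (S x).mulVec
  range_eq : ∀ x ∈ X.carrier, Set.range (S x).mulVec = X.tangent x

/-- `P_S = S (Sᵀ S)⁻¹`. -/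
def proj {n q : ℕ} (S : Vec n → Matrix (Fin n) (Fin q) ℝ) (x : Vec n) :
    Matrix (Fin n) (Fin q) ℝ :=
  S x * ((S x)ᵀ * S x)⁻¹

/-- The control-affine system `ẋ = f(x) + B(x) u + B_w(x) w`, `z = g(x, u)` on `𝒳`, with `C¹` data
satisfying the transversality conditions. -/
structure ControlSystem {n q : ℕ} (X : EmbeddedLieGroup n q) (m p l : ℕ) where
  f : Vec n → Vec n
  B : Vec n → Matrix (Fin n) (Fin m) ℝ
  Bw : Vec n → Matrix (Fin n) (Fin p) ℝ
  g : Vec n → Vec m → Vec l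
  contDiff_f : ContDiffOn ℝ 1 f X.dom
  contDiff_B : MatContDiffOn 1 B X.dom
  contDiff_Bw : MatContDiffOn 1 Bw X.dom
  contDiff_g : ContDiffOn ℝ 1 (fun a : Vec n × Vec m => g a.1 a.2) (X.dom ×ˢ Set.univ)
  transversal_f : ∀ x ∈ X.carrier, jac X.h x *ᵥ f x = 0
  transversal_B : ∀ x ∈ X.carrier, jac X.h x * B x = 0
  transversal_Bw : ∀ x ∈ X.carrier, jac X.h x * Bw x = 0

/-- An admissible feedback term: `u = k(x, x*) + u*` with `k(x, x) = 0` and `k` of class `C¹` in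
the state. -/
structure IsFeedback {n q m : ℕ} (X : EmbeddedLieGroup n q) (k : Vec n → Vec n → Vec m) :
    Prop where
  contDiff : ∀ xs ∈ X.carrier, ContDiffOn ℝ 1 (fun x => k x xs) X.dom
  diag : ∀ x ∈ X.carrier, k x x = 0

/-- A `C¹`, symmetric, uniformly bounded metric `ℳ`. -/
structure IsUniformMetric {n q : ℕ} (X : EmbeddedLieGroup n q)
    (M : Vec n → Matrix (Fin q) (Fin q) ℝ) : Prop where
  contDiff : MatContDiffOn 1 M X.dom
  symm : ∀ x ∈ X.carrier, (M x).IsSymm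
  bounds : ∃ a b : ℝ, 0 < a ∧ 0 < b ∧ ∀ x ∈ X.carrier,
    (M x - a • (1 : Matrix (Fin q) (Fin q) ℝ)).PosSemidef ∧
    (b • (1 : Matrix (Fin q) (Fin q) ℝ) - M x).PosSemidef

namespace ControlSystem

variable {n q m p l : ℕ} {X : EmbeddedLieGroup n q}

/-- The right-hand side `f(x) + B(x) u + B_w(x) w`. -/
def rhs (sys : ControlSystem X m p l) (x : Vec n) (u : Vec m) (w : Vec p) : Vec n :=
  sys.f x + sys.B x *ᵥ u + sys.Bw x *ᵥ w

/-- `A(x,u,w) = ∂f/∂x + ∑ uᵢ ∂bᵢ/∂x + ∑ wⱼ ∂b_{w,j}/∂x`. -/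
def A (sys : ControlSystem X m p l) (x : Vec n) (u : Vec m) (w : Vec p) :
    Matrix (Fin n) (Fin n) ℝ :=
  jac sys.f x + ∑ i, u i • jac (fun y a => sys.B y a i) x
    + ∑ j, w j • jac (fun y a => sys.Bw y a j) x

/-- `C(x,u) = ∂g/∂x`. -/
def C (sys : ControlSystem X m p l) (x : Vec n) (u : Vec m) : Matrix (Fin l) (Fin n) ℝ :=
  jac (fun y => sys.g y u) x

/-- `D(x,u) = ∂g/∂u`. -/
def D (sys : ControlSystem X m p l) (x : Vec n) (u : Vec m) : Matrix (Fin l) (Fin m) ℝ :=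
  jac (fun v => sys.g x v) u

/-- The matrix `E` with `B = S E`, see `S_mul_E`. -/
def E (sys : ControlSystem X m p l) (S : Vec n → Matrix (Fin n) (Fin q) ℝ) (x : Vec n) :
    Matrix (Fin q) (Fin m) ℝ :=
  (proj S x)ᵀ * sys.B x

/-- The matrix `E_w` with `B_w = S E_w`, see `S_mul_Ew`. -/
def Ew (sys : ControlSystem X m p l) (S : Vec n → Matrix (Fin n) (Fin q) ℝ) (x : Vec n) :
    Matrix (Fin q) (Fin p) ℝ :=
  (proj S x)ᵀ * sys.Bw x

/-- `𝒜 = (Ṗ_Sᵀ + P_Sᵀ A + E K) S` in closed loop, `u = k(x, x*) + u*`, `K = ∂k/∂x`, where the dot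
is the derivative along the closed-loop vector field. -/
def calA (sys : ControlSystem X m p l) (S : Vec n → Matrix (Fin n) (Fin q) ℝ)
    (k : Vec n → Vec n → Vec m) (x xs : Vec n) (us : Vec m) (w : Vec p) :
    Matrix (Fin q) (Fin q) ℝ :=
  (matDeriv (fun y => (proj S y)ᵀ) x (sys.rhs x (k x xs + us) w)
    + (proj S x)ᵀ * sys.A x (k x xs + us) w
    + sys.E S x * jac (fun y => k y xs) x) * S x

/-- `𝒞 = (C + D K) S` in closed loop. -/
def calC (sys : ControlSystem X m p l) (S : Vec n → Matrix (Fin n) (Fin q) ℝ)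
    (k : Vec n → Vec n → Vec m) (x xs : Vec n) (us : Vec m) : Matrix (Fin l) (Fin q) ℝ :=
  (sys.C x (k x xs + us) + sys.D x (k x xs + us) * jac (fun y => k y xs) x) * S x

/-- The matrix `R₁`. -/
def R1 (sys : ControlSystem X m p l) (S : Vec n → Matrix (Fin n) (Fin q) ℝ)
    (k : Vec n → Vec n → Vec m) (M : Vec n → Matrix (Fin q) (Fin q) ℝ) (lam mu : ℝ)
    (x xs : Vec n) (us : Vec m) (w : Vec p) : Matrix (Fin q ⊕ Fin p) (Fin q ⊕ Fin p) ℝ :=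
  Matrix.fromBlocks
    (matDeriv M x (sys.rhs x (k x xs + us) w)
      + (M x * sys.calA S k x xs us w + (M x * sys.calA S k x xs us w)ᵀ) + (2 * lam) • M x)
    (M x * sys.Ew S x)
    ((sys.Ew S x)ᵀ * M x)
    (-(mu • (1 : Matrix (Fin p) (Fin p) ℝ)))

/-- The matrix `R₂`. -/
def R2 (sys : ControlSystem X m p l) (S : Vec n → Matrix (Fin n) (Fin q) ℝ)
    (k : Vec n → Vec n → Vec m) (M : Vec n → Matrix (Fin q) (Fin q) ℝ) (α lam mu : ℝ)
    (x xs : Vec n) (us : Vec m) : Matrix (Fin q ⊕ Fin p) (Fin q ⊕ Fin p) ℝ :=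
  Matrix.fromBlocks
    ((2 * lam) • M x - α⁻¹ • ((sys.calC S k x xs us)ᵀ * sys.calC S k x xs us))
    0 0 ((α - mu) • (1 : Matrix (Fin p) (Fin p) ℝ))

/-- The matrix `R₂'`, in which `𝒞ᵀ 𝒞` is replaced by `𝒞ᵀ G 𝒞` for the matrix `G = P_{S_z} Q P_{S_z}ᵀ`
of the output metric at `z = g(x, u)`. -/
def R2' (sys : ControlSystem X m p l) (S : Vec n → Matrix (Fin n) (Fin q) ℝ)
    (k : Vec n → Vec n → Vec m) (M : Vec n → Matrix (Fin q) (Fin q) ℝ)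
    (G : Vec l → Matrix (Fin l) (Fin l) ℝ) (α lam mu : ℝ)
    (x xs : Vec n) (us : Vec m) : Matrix (Fin q ⊕ Fin p) (Fin q ⊕ Fin p) ℝ :=
  Matrix.fromBlocks
    ((2 * lam) • M x - α⁻¹ • ((sys.calC S k x xs us)ᵀ * G (sys.g x (k x xs + us))
      * sys.calC S k x xs us))
    0 0 ((α - mu) • (1 : Matrix (Fin p) (Fin p) ℝ))

/-- `(x, u, w)` is a (Carathéodory) solution of the system on `[0, ∞)`, evolving on `𝒳`. -/
structure IsTrajectory (sys : ControlSystem X m p l) (x : ℝ → Vec n) (u : ℝ → Vec m)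
    (w : ℝ → Vec p) : Prop where
  mem : ∀ t : ℝ, 0 ≤ t → x t ∈ X.carrier
  absCont : ∀ T : ℝ, 0 < T → AbsolutelyContinuousOnInterval x 0 T
  ode : ∀ᵐ t : ℝ, 0 < t → HasDerivAt x (sys.rhs (x t) (u t) (w t)) t

end ControlSystem

/-- `‖v‖_{L∞} = sup_{t ≥ 0} ‖v(t)‖`, possibly infinite. -/
def linfNorm {k : ℕ} (v : ℝ → Vec k) : ℝ≥0∞ := ⨆ t ∈ Set.Ici (0 : ℝ), eucl (v t)

/-- `‖v‖_{L∞^{[0,T]}} = sup_{0 ≤ t ≤ T} ‖v(t)‖`, possibly infinite. -/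
def linfNormOn {k : ℕ} (T : ℝ) (v : ℝ → Vec k) : ℝ≥0∞ := ⨆ t ∈ Set.Icc (0 : ℝ) T, eucl (v t)

/-- A nominal solution `(x*, u*, w*)` together with a closed-loop solution `(x, u, w)` under the
feedback `u = k(x, x*) + u*`, where `‖w‖_{L∞} < ∞`. -/
structure ClosedLoopPair {n q m p l : ℕ} {X : EmbeddedLieGroup n q} (sys : ControlSystem X m p l)
    (k : Vec n → Vec n → Vec m) where
  xs : ℝ → Vec n
  us : ℝ → Vec m
  ws : ℝ → Vec p
  x : ℝ → Vec n
  w : ℝ → Vec p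
  nominal : sys.IsTrajectory xs us ws
  closedLoop : sys.IsTrajectory x (fun t => k (x t) (xs t) + us t) w
  bounded : linfNorm w < ⊤

namespace ClosedLoopPair

variable {n q m p l : ℕ} {X : EmbeddedLieGroup n q} {sys : ControlSystem X m p l}
  {k : Vec n → Vec n → Vec m}

/-- The output `z = g(x, u)`. -/
def z (c : ClosedLoopPair sys k) (t : ℝ) : Vec l := sys.g (c.x t) (k (c.x t) (c.xs t) + c.us t)

/-- The nominal output `z* = g(x*, u*)`. -/
def zs (c : ClosedLoopPair sys k) (t : ℝ) : Vec l := sys.g (c.xs t) (c.us t)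

/-- `w̄ = ‖w - w*‖_{L∞}`. -/
def wbar (c : ClosedLoopPair sys k) : ℝ≥0∞ := linfNorm fun t => c.w t - c.ws t

end ClosedLoopPair

/-- The closed loop achieves the universal `L∞` gain bound `α`, output deviations being measured by
the distance function `d`. -/
def HasGainBound {n q m p l : ℕ} {X : EmbeddedLieGroup n q} (sys : ControlSystem X m p l)
    (k : Vec n → Vec n → Vec m) (d : Vec l → Vec l → ℝ≥0∞) (α : ℝ) : Prop :=
  ∃ β : Vec n → Vec n → ℝ,
    (∀ x ∈ X.carrier, ∀ y ∈ X.carrier, 0 ≤ β x y) ∧ (∀ x ∈ X.carrier, β x x = 0) ∧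
    ∀ (c : ClosedLoopPair sys k) (T : ℝ), 0 < T →
      (⨆ t ∈ Set.Icc (0 : ℝ) T, d (c.z t) (c.zs t)) ^ 2
        ≤ ENNReal.ofReal (α ^ 2) * linfNormOn T (fun t => c.w t - c.ws t) ^ 2
          + ENNReal.ofReal (β (c.x 0) (c.xs 0))

/-- The set `{y ∈ 𝒵 | d(y, z*) ≤ r}`. -/
def tube {l : ℕ} (Z : Set (Vec l)) (d : Vec l → Vec l → ℝ≥0∞) (zs : Vec l) (r : ℝ≥0∞) :
    Set (Vec l) :=
  {y | y ∈ Z ∧ d y zs ≤ r}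

/-- After transient effects `z` stays in the tube of radius `α w̄` around `z*`. With a function
`β ≥ 0` on pairs of states that vanishes on the diagonal:
* the transient excess over the radius decays exponentially, uniformly in the signals;
* `z` eventually stays in every tube of radius larger than `α w̄`;
* the set `β ≤ α μ w̄²` is forward invariant, contains all `(x, x)`, and as long as the pair of
  states lies in it, `z` lies in the tube of radius exactly `α w̄`. -/
def StaysInTube {n q m p l : ℕ} {X : EmbeddedLieGroup n q} (sys : ControlSystem X m p l)
    (k : Vec n → Vec n → Vec m) (Z : Set (Vec l)) (d : Vec l → Vec l → ℝ≥0∞) (α lam mu : ℝ) :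
    Prop :=
  ∃ β : Vec n → Vec n → ℝ,
    (∀ x ∈ X.carrier, ∀ y ∈ X.carrier, 0 ≤ β x y) ∧ (∀ x ∈ X.carrier, β x x = 0) ∧
    ∀ c : ClosedLoopPair sys k,
      (∀ t : ℝ, 0 ≤ t → d (c.z t) (c.zs t) ^ 2 ≤ ENNReal.ofReal (α ^ 2) * c.wbar ^ 2
        + ENNReal.ofReal (Real.exp (-2 * lam * t) * β (c.x 0) (c.xs 0))) ∧
      (∀ ε : ℝ≥0∞, 0 < ε → ∀ᶠ t in Filter.atTop,
        c.z t ∈ tube Z d (c.zs t) (ENNReal.ofReal α * c.wbar + ε)) ∧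
      (∀ t₀ : ℝ, 0 ≤ t₀ →
        ENNReal.ofReal (β (c.x t₀) (c.xs t₀)) ≤ ENNReal.ofReal (α * mu) * c.wbar ^ 2 →
        ∀ t : ℝ, t₀ ≤ t →
          ENNReal.ofReal (β (c.x t) (c.xs t)) ≤ ENNReal.ofReal (α * mu) * c.wbar ^ 2 ∧
          c.z t ∈ tube Z d (c.zs t) (ENNReal.ofReal α * c.wbar))

/-- The Euclidean distance. -/
def euclDist {l : ℕ} (a b : Vec l) : ℝ≥0∞ := eucl (a - b)

/-- The matrix `P_{S_z} Q P_{S_z}ᵀ` of the metric `g(v₁, v₂) = v₁ᵀ Q v₂`, `δz = S_z v`, in ambient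
coordinates. -/
def weightedMetric {l r : ℕ} (Sz : Vec l → Matrix (Fin l) (Fin r) ℝ) (Q : Matrix (Fin r) (Fin r) ℝ)
    (z : Vec l) : Matrix (Fin l) (Fin l) ℝ :=
  proj Sz z * Q * (proj Sz z)ᵀ

/-- The length of a curve `[0,1] → ℝˡ` for the metric `G`. -/
def curveLength {l : ℕ} (G : Vec l → Matrix (Fin l) (Fin l) ℝ) (γ : ℝ → Vec l) : ℝ≥0∞ :=
  ∫⁻ s in Set.Icc (0 : ℝ) 1, ENNReal.ofReal (Real.sqrt
    (derivWithin γ (Set.Icc 0 1) s ⬝ᵥ (G (γ s) *ᵥ derivWithin γ (Set.Icc 0 1) s)))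

/-- The Riemannian distance on `𝒵` for the metric `G`: the infimum of the lengths of the `C¹` curves
in `𝒵` from `a` to `b` (infinite if there are none). -/
def riemDist {l : ℕ} (Z : Set (Vec l)) (G : Vec l → Matrix (Fin l) (Fin l) ℝ) (a b : Vec l) :
    ℝ≥0∞ :=
  ⨅ γ ∈ {γ : ℝ → Vec l | ContDiffOn ℝ 1 γ (Set.Icc 0 1) ∧ (∀ s ∈ Set.Icc (0 : ℝ) 1, γ s ∈ Z) ∧
    γ 0 = a ∧ γ 1 = b}, curveLength G γ

/-! Sanity facts: `P_Sᵀ` is a left inverse of `S`, and `E`, `E_w` solve `B = S E`, `B_w = S E_w`. -/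

theorem proj_transpose_mul {n q : ℕ} (S : Vec n → Matrix (Fin n) (Fin q) ℝ) (x : Vec n)
    (hS : Function.Injective (S x).mulVec) : (proj S x)ᵀ * S x = 1 := by
  have hpd : ((S x)ᵀ * S x).PosDef := by
    have h := Matrix.PosDef.conjTranspose_mul_self (S x) hS
    simpa [Matrix.conjTranspose_eq_transpose_of_trivial] using h
  have hu : IsUnit ((S x)ᵀ * S x).det := (Matrix.isUnit_iff_isUnit_det _).1 hpd.isUnit
  rw [proj, Matrix.transpose_mul, Matrix.transpose_nonsing_inv, Matrix.transpose_mul,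
    Matrix.transpose_transpose, Matrix.mul_assoc, Matrix.nonsing_inv_mul _ hu]

theorem mul_proj_transpose_mul {n q a : ℕ} (X : EmbeddedLieGroup n q)
    (S : Vec n → Matrix (Fin n) (Fin q) ℝ) (hS : X.IsFrame S) (x : Vec n) (hx : x ∈ X.carrier)
    (N : Matrix (Fin n) (Fin a) ℝ) (hN : jac X.h x * N = 0) :
    S x * ((proj S x)ᵀ * N) = N := by
  have key : ∀ v ∈ X.tangent x, S x *ᵥ ((proj S x)ᵀ *ᵥ v) = v := by
    intro v hv
    have hv' : v ∈ Set.range (S x).mulVec := by rw [hS.range_eq x hx]; exact hv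
    obtain ⟨y, rfl⟩ := hv'
    rw [Matrix.mulVec_mulVec y, proj_transpose_mul S x (hS.injective x hx), Matrix.one_mulVec]
  refine Matrix.ext_of_mulVec_single fun i => ?_
  rw [← Matrix.mulVec_mulVec, ← Matrix.mulVec_mulVec]
  refine key _ ?_
  have h0 : jac X.h x *ᵥ (N *ᵥ Pi.single i 1) = 0 := by
    rw [Matrix.mulVec_mulVec, hN, Matrix.zero_mulVec]
  rw [jac, LinearMap.toMatrix'_mulVec] at h0
  exact h0

theorem ControlSystem.S_mul_E {n q m p l : ℕ} {X : EmbeddedLieGroup n q}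
    (sys : ControlSystem X m p l) (S : Vec n → Matrix (Fin n) (Fin q) ℝ) (hS : X.IsFrame S)
    (x : Vec n) (hx : x ∈ X.carrier) : S x * sys.E S x = sys.B x :=
  mul_proj_transpose_mul X S hS x hx _ (sys.transversal_B x hx)

theorem ControlSystem.S_mul_Ew {n q m p l : ℕ} {X : EmbeddedLieGroup n q}
    (sys : ControlSystem X m p l) (S : Vec n → Matrix (Fin n) (Fin q) ℝ) (hS : X.IsFrame S)
    (x : Vec n) (hx : x ∈ X.carrier) : S x * sys.Ew S x = sys.Bw x :=
  mul_proj_transpose_mul X S hS x hx _ (sys.transversal_Bw x hx)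

end LieRCCM

end

open scoped ContDiff ENNReal Matrix

noncomputable section

namespace LieRCCM

open Set Filter Topology MeasureTheory

/-! The Lyapunov function is the squared Riemannian distance of the metric `ℳ` on `𝒳`, taken as the
infimum `minEnergy` of the energies `∫ vᵀℳv` of `C¹` curves from `x` to `x*`, where the velocity is
`γ' = S v`. Testing `R₁ ⪯ 0` on `(v, e)` gives the infinitesimal inequality `(vᵀℳv)˙ ≤ -2λ vᵀℳv +
μ|e|²`. Integrated over a curve whose point at parameter `s` is driven by `w + s(w* - w)`, it should
give `φ˙ ≤ -2λ φ + μ|w - w*|²` for `φ = minEnergy (x(t), x*(t))`. The feedback vanishes on the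
diagonal, so the endpoint `s = 1` follows the nominal field.

Neither minimising geodesics nor flows of whole curves are used. At a time where both solutions are
differentiable, a nearly minimising curve is moved by a single Euler step, corrected linearly so
that it ends exactly at `x(t+h)` and `x*(t+h)`, and pushed back to `𝒳` by a `C²` retraction. The
energy of the result bounds `φ(t+h)`, which yields the differential inequality up to `o(h)`
(`minEnergy_euler_step`). The error has to be uniform over curves, because the curve is chosen after
`h`: bounded energy confines curves to a compact set, and degree-two homogeneity of the metric form
handles unbounded velocities. For the retraction to leave no trace in the first-order term, its
second derivative must cancel the non-tangential part of the variation (`fderiv_pullbackForm`).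

A similar endpoint perturbation shows that `φ` is absolutely continuous, so Grönwall's inequality
applies and gives `φ(t) ≤ e^{-2λ(t-t₀)} φ(t₀) + (μ/2λ) w̄² (1 - e^{-2λ(t-t₀)})`
(`ClosedLoopPair.minEnergy_le`).

The first block of `R₂` or `R₂'` bounds the squared speed of the image of a curve under the output
map by `2λα vᵀℳv`. By Cauchy–Schwarz `d(z, z*)² ≤ β := 2λα φ`. The decay estimate then has limiting
level `αμ w̄²`, and the second block gives `αμ ≤ α²` as soon as disturbances exist. -/

/-! ### Retractions onto the embedded group -/

/-- A map that is injective on a compact set, at whose points it is a local `C²` diffeomorphism, has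
a `C²` inverse near the image. -/
theorem exists_inverse_near_compact {E F : Type*} [NormedAddCommGroup E] [NormedSpace ℝ E]
    [CompleteSpace E] [NormedAddCommGroup F] [NormedSpace ℝ F] {H : E → F} {C : Set E}
    (hC : IsCompact C) (hinj : InjOn H C) (hH : ∀ p ∈ C, ContDiffAt ℝ 2 H p)
    (hH' : ∀ p ∈ C, ∃ e : E ≃L[ℝ] F, HasFDerivAt H (e : E →L[ℝ] F) p) :
    ∃ (G : F → E) (N : Set E), N ∈ 𝓝ˢ C ∧ (∀ p ∈ N, G (H p) = p) ∧
      ∀ p ∈ C, ∀ᶠ y in 𝓝 (H p), ContDiffAt ℝ 2 G y ∧ H (G y) = y := by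
  classical
  obtain ⟨N, hN, hNinj⟩ := hinj.exists_mem_nhdsSet hC (fun p hp => (hH p hp).continuousAt) (by
    intro p hp
    obtain ⟨e, he⟩ := hH' p hp
    have hs := (hH p hp).hasStrictFDerivAt' he two_ne_zero
    exact ⟨_, (hs.toOpenPartialHomeomorph H).open_source.mem_nhds
      hs.mem_toOpenPartialHomeomorph_source, (hs.toOpenPartialHomeomorph H).injOn⟩)
  refine ⟨Function.invFunOn H N, N, hN, fun p hp => hNinj.leftInvOn_invFunOn hp, fun p hp => ?_⟩
  obtain ⟨e, he⟩ := hH' p hp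
  have hs := (hH p hp).hasStrictFDerivAt' he two_ne_zero
  have hg2 : ContDiffAt ℝ 2 ((hH p hp).localInverse he two_ne_zero) (H p) :=
    (hH p hp).to_localInverse he two_ne_zero
  -- Near `H p` the local inverse takes values in `N`, where `H` is injective. Hence the global
  -- choice `invFunOn` coincides with it there and inherits its smoothness.
  have hgN : ∀ᶠ y in 𝓝 (H p), (hH p hp).localInverse he two_ne_zero y ∈ N := by
    refine hg2.continuousAt.eventually ?_
    rw [(hH p hp).localInverse_apply_image he two_ne_zero]
    exact mem_nhdsSet_iff_forall.1 hN p hp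
  have hgr : ∀ᶠ y in 𝓝 (H p), H ((hH p hp).localInverse he two_ne_zero y) = y :=
    hs.eventually_right_inverse
  have heq : ∀ᶠ y in 𝓝 (H p),
      Function.invFunOn H N y = (hH p hp).localInverse he two_ne_zero y := by
    filter_upwards [hgN, hgr] with y hy1 hy2
    conv_lhs => rw [← hy2]
    exact hNinj.leftInvOn_invFunOn hy1
  have hev : ContDiffAt ℝ 2 (Function.invFunOn H N) (H p) := hg2.congr_of_eventuallyEq heq
  filter_upwards [hev.eventually (by simp), hgr, heq] with y h1 h2 h3
  exact ⟨h1, by rw [h3]; exact h2⟩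

/-- The transpose of a continuous linear map between coordinate spaces. -/
def transposeCLM (n k : ℕ) : (Vec n →L[ℝ] Vec k) →L[ℝ] (Vec k →L[ℝ] Vec n) :=
  LinearMap.toContinuousLinearMap
    { toFun := fun A => LinearMap.toContinuousLinearMap
        (Matrix.toLin' (LinearMap.toMatrix' (A : Vec n →ₗ[ℝ] Vec k))ᵀ)
      map_add' := fun A B => by simp [Matrix.transpose_add]
      map_smul' := fun c A => by simp [Matrix.transpose_smul] }

theorem transposeCLM_apply {n k : ℕ} (A : Vec n →L[ℝ] Vec k) (v : Vec k) :
    transposeCLM n k A v = (LinearMap.toMatrix' (A : Vec n →ₗ[ℝ] Vec k))ᵀ *ᵥ v := rfl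

/-- `A Aᵀ v = 0` forces `|Aᵀ v|² = 0`, and then `v` is orthogonal to the range of `A`, which is
everything. -/
theorem apply_transposeCLM_injective {n k : ℕ} {A : Vec n →L[ℝ] Vec k}
    (hA : Function.Surjective A) {v : Vec k} (hv : A (transposeCLM n k A v) = 0) : v = 0 := by
  have hA' : ∀ y, A y = LinearMap.toMatrix' (A : Vec n →ₗ[ℝ] Vec k) *ᵥ y := fun y => by
    rw [LinearMap.toMatrix'_mulVec]; rfl
  set T := LinearMap.toMatrix' (A : Vec n →ₗ[ℝ] Vec k)
  rw [hA', transposeCLM_apply] at hv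
  have h0 : Tᵀ *ᵥ v = 0 := by
    have : (Tᵀ *ᵥ v) ⬝ᵥ (Tᵀ *ᵥ v) = 0 := by
      rw [Matrix.dotProduct_mulVec, Matrix.vecMul_transpose]
      change (T *ᵥ (Tᵀ *ᵥ v)) ⬝ᵥ v = 0
      rw [hv, zero_dotProduct]
    exact dotProduct_self_eq_zero.1 this
  obtain ⟨y, hy⟩ := hA v
  have : v ⬝ᵥ v = 0 := by
    nth_rw 2 [← hy]
    rw [hA']
    rw [Matrix.dotProduct_mulVec, ← Matrix.mulVec_transpose, h0, zero_dotProduct]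
  exact dotProduct_self_eq_zero.1 this

namespace EmbeddedLieGroup

variable {n q : ℕ} (X : EmbeddedLieGroup n q)

theorem mem_dom {x : Vec n} (hx : x ∈ X.carrier) : x ∈ X.dom := by
  rw [X.carrier_eq] at hx; exact hx.1

theorem h_eq_zero {x : Vec n} (hx : x ∈ X.carrier) : X.h x = 0 := by
  rw [X.carrier_eq] at hx; exact hx.2

theorem contDiffAt_h {x : Vec n} (hx : x ∈ X.dom) : ContDiffAt ℝ ∞ X.h x :=
  X.smooth_h.contDiffAt (X.isOpen_dom.mem_nhds hx)

theorem mem_tangent {x v : Vec n} : v ∈ X.tangent x ↔ fderiv ℝ X.h x v = 0 := Iff.rfl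

/-- `ρ` is a `C²` retraction of the open set `O` onto `𝒳 ∩ O` which is infinitesimally the identity
on tangent vectors. -/
structure IsRetraction (O : Set (Vec n)) (ρ : Vec n → Vec n) : Prop where
  isOpen : IsOpen O
  subset_dom : O ⊆ X.dom
  contDiffAt : ∀ y ∈ O, ContDiffAt ℝ 2 ρ y
  mem : ∀ y ∈ O, ρ y ∈ X.carrier
  eq_self : ∀ y ∈ O, y ∈ X.carrier → ρ y = y
  fderiv_eq_self : ∀ y ∈ O, y ∈ X.carrier → ∀ v ∈ X.tangent y, fderiv ℝ ρ y v = v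

/-- A point `y` near `K` is moved in a normal direction until it meets `𝒳`: one solves `h(y + Dh(y)ᵀ
v) = 0` for small `v`. The map `H(y, v) = (y, h(y + Dh(y)ᵀ v))` is the identity on `K × {0}`, and
its derivative there is invertible because `Dh Dhᵀ` is. A single inverse near the compact set `K ×
{0}` then provides `v` as a `C²` function `lam` of `y`. -/
theorem exists_isRetraction {K : Set (Vec n)} (hK : IsCompact K) (hKX : K ⊆ X.carrier) :
    ∃ O ρ, K ⊆ O ∧ X.IsRetraction O ρ := by
  set N : Vec n → Vec (n - q) →L[ℝ] Vec n := fun y => transposeCLM n (n - q) (fderiv ℝ X.h y)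
    with hNdef
  have hN : ∀ y ∈ X.dom, ContDiffAt ℝ 2 N y := fun y hy =>
    (transposeCLM n (n - q)).contDiff.contDiffAt.comp y
      ((X.contDiffAt_h hy).fderiv_right (m := 2) (by norm_cast))
  have hh : ∀ y ∈ X.dom, ContDiffAt ℝ 2 X.h y := fun y hy => (X.contDiffAt_h hy).of_le (by norm_cast)
  set Φ : Vec n × Vec (n - q) → Vec n := fun p => p.1 + N p.1 p.2 with hΦ
  set H : Vec n × Vec (n - q) → Vec n × Vec (n - q) := fun p => (p.1, X.h (Φ p)) with hH
  have hΦ2 : ∀ p : Vec n × Vec (n - q), p.1 ∈ X.dom → ContDiffAt ℝ 2 Φ p := fun p hp =>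
    contDiffAt_fst.add (((hN p.1 hp).comp p contDiffAt_fst).clm_apply contDiffAt_snd)
  have hΦ0 : ∀ y, Φ (y, 0) = y := fun y => by simp [hΦ]
  have hH2 : ∀ p : Vec n × Vec (n - q), p.1 ∈ X.dom → Φ p ∈ X.dom → ContDiffAt ℝ 2 H p :=
    fun p hp hp' => contDiffAt_fst.prodMk ((hh _ hp').comp p (hΦ2 p hp))
  have hH0 : ∀ y ∈ X.carrier, H (y, 0) = (y, 0) := fun y hy => by
    simp only [hH, hΦ0, X.h_eq_zero hy]
  -- derivative of `Φ` along `𝒳 × {0}`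
  have hΦ' : ∀ y ∈ X.carrier, HasFDerivAt Φ
      (ContinuousLinearMap.fst ℝ _ _ + (N y).comp (ContinuousLinearMap.snd ℝ _ _))
      ((y, 0) : Vec n × Vec (n - q)) := fun y hy => by
    have h1 : HasFDerivAt (fun p : Vec n × Vec (n - q) => N p.1)
        ((fderiv ℝ N y).comp (ContinuousLinearMap.fst ℝ _ _)) ((y, 0) : Vec n × Vec (n - q)) :=
      HasFDerivAt.comp (g := N) (f := Prod.fst) ((y, 0) : Vec n × Vec (n - q))
        ((hN y (X.mem_dom hy)).differentiableAt two_ne_zero).hasFDerivAt hasFDerivAt_fst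
    have h2 := hasFDerivAt_fst (𝕜 := ℝ) (p := ((y, 0) : Vec n × Vec (n - q)))
    have h3 := h2.add (h1.clm_apply hasFDerivAt_snd)
    refine h3.congr_fderiv ?_
    ext p <;> simp
  have hHinv : ∀ p ∈ K ×ˢ ({0} : Set (Vec (n - q))), ∃ e : (Vec n × Vec (n - q)) ≃L[ℝ]
      (Vec n × Vec (n - q)), HasFDerivAt H (e : _ →L[ℝ] Vec n × Vec (n - q)) p := by
    rintro ⟨y, v⟩ ⟨hy, hv⟩
    obtain rfl : v = 0 := hv
    have hyX := hKX hy
    have hd : HasFDerivAt H ((ContinuousLinearMap.fst ℝ _ _).prod ((fderiv ℝ X.h y).comp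
        (ContinuousLinearMap.fst ℝ _ _ + (N y).comp (ContinuousLinearMap.snd ℝ _ _))))
        ((y, 0) : Vec n × Vec (n - q)) := by
      refine hasFDerivAt_fst.prodMk ?_
      refine HasFDerivAt.comp (f := Φ) _ ?_ (hΦ' y hyX)
      rw [hΦ0]
      exact ((hh y (X.mem_dom hyX)).differentiableAt two_ne_zero).hasFDerivAt
    set A := ((ContinuousLinearMap.fst ℝ _ _).prod ((fderiv ℝ X.h y).comp
        (ContinuousLinearMap.fst ℝ (Vec n) (Vec (n - q))
          + (N y).comp (ContinuousLinearMap.snd ℝ _ _)))) with hA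
    have hinj : Function.Injective A.toLinearMap := by
      rw [← LinearMap.ker_eq_bot, LinearMap.ker_eq_bot']
      rintro ⟨a, b⟩ hab
      have h1 : a = 0 := congrArg Prod.fst hab
      have h2 : fderiv ℝ X.h y (a + N y b) = 0 := congrArg Prod.snd hab
      subst h1
      rw [zero_add] at h2
      rw [apply_transposeCLM_injective (X.regular y hyX) h2]; rfl
    refine ⟨(LinearEquiv.ofInjectiveEndo A.toLinearMap hinj).toContinuousLinearEquiv, ?_⟩
    convert hd using 1
    ext p <;> rfl
  obtain ⟨G, W, hW, hGH, hG⟩ := exists_inverse_near_compact (H := H)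
    (C := K ×ˢ ({0} : Set (Vec (n - q)))) (hK.prod isCompact_singleton)
    (by
      rintro ⟨y, v⟩ ⟨hy, hv⟩ ⟨y', v'⟩ ⟨hy', hv'⟩ he
      obtain rfl : v = 0 := hv
      obtain rfl : v' = 0 := hv'
      have h1 : y = y' := congrArg Prod.fst he
      rw [h1])
    (by
      rintro ⟨y, v⟩ ⟨hy, hv⟩
      obtain rfl : v = 0 := hv
      exact hH2 _ (X.mem_dom (hKX hy)) (by rw [hΦ0]; exact X.mem_dom (hKX hy)))
    hHinv
  set ι : Vec n → Vec n × Vec (n - q) := fun y => (y, 0) with hι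
  have hι2 : ContDiff ℝ 2 ι := contDiff_id.prodMk contDiff_const
  -- The points where the inverse is defined and smooth and where the corrected point lies in the
  -- domain of `h`. These are neighbourhood conditions at points of `K`, and the interior of this
  -- set serves as `O`.
  set good : Set (Vec n) := {y | (ContDiffAt ℝ 2 G (ι y) ∧ H (G (ι y)) = ι y) ∧
    Φ (G (ι y)) ∈ X.dom ∧ y ∈ X.dom ∧ ι y ∈ W} with hgood
  have hgood_nhds : ∀ y ∈ K, good ∈ 𝓝 y := by
    intro y hy
    have hyX := hKX hy
    have hp : ι y ∈ K ×ˢ ({0} : Set (Vec (n - q))) := ⟨hy, rfl⟩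
    have hWy : W ∈ 𝓝 (ι y) := mem_nhdsSet_iff_forall.1 hW _ hp
    have hGy : G (ι y) = ι y := by
      have := hGH _ (mem_of_mem_nhds hWy)
      rwa [show H (ι y) = ι y from hH0 y hyX] at this
    have e1 := hG _ hp
    rw [show H (ι y) = ι y from hH0 y hyX] at e1
    have hιc : Tendsto ι (𝓝 y) (𝓝 (ι y)) := hι2.continuous.continuousAt
    have hGc : ContinuousAt (fun y => Φ (G (ι y))) y := by
      refine ContinuousAt.comp (g := Φ) (f := fun y => G (ι y)) ?_
        (ContinuousAt.comp (g := G) e1.self_of_nhds.1.continuousAt hιc)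
      rw [hGy]
      exact (hΦ2 _ (X.mem_dom hyX)).continuousAt
    filter_upwards [hιc.eventually e1, hιc.eventually hWy,
      X.isOpen_dom.mem_nhds (X.mem_dom hyX), hGc.eventually (X.isOpen_dom.mem_nhds (by
        change Φ (G (ι y)) ∈ X.dom
        rw [hGy, hΦ0]; exact X.mem_dom hyX))] with z h1 h2 h3 h4
    exact ⟨h1, h4, h3, h2⟩
  set lam : Vec n → Vec (n - q) := fun y => (G (ι y)).2 with hlam
  have hfst : ∀ y ∈ good, (G (ι y)).1 = y := fun y hy => congrArg Prod.fst hy.1.2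
  have hself : ∀ y ∈ good, y ∈ X.carrier → lam y = 0 := fun y hy hyX => by
    have h1 : G (ι y) = ι y := by
      have := hGH _ hy.2.2.2
      rwa [show H (ι y) = ι y from hH0 y hyX] at this
    exact congrArg Prod.snd h1
  have hlam2 : ∀ y ∈ good, ContDiffAt ℝ 2 lam y := fun y hy =>
    (hy.1.1.comp y hι2.contDiffAt).snd
  have hΦG : ∀ y ∈ good, y + N y (lam y) = Φ (G (ι y)) := fun y hy => by
    simp only [hΦ, hfst y hy, hlam]
  have hmem : ∀ y ∈ good, y + N y (lam y) ∈ X.carrier := fun y hy => by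
    rw [X.carrier_eq, hΦG y hy]
    exact ⟨hy.2.1, congrArg Prod.snd hy.1.2⟩
  refine ⟨interior good, fun y => y + N y (lam y), fun y hy => mem_interior_iff_mem_nhds.2
    (hgood_nhds y hy), isOpen_interior, fun y hy => (interior_subset hy).2.2.1, ?_, ?_, ?_, ?_⟩
  · intro y hy
    have hy := interior_subset hy
    exact contDiffAt_id.add ((hN y hy.2.2.1).clm_apply (hlam2 y hy))
  · exact fun y hy => hmem y (interior_subset hy)
  · intro y hy hyX
    simp only [hself y (interior_subset hy) hyX, map_zero, add_zero]
  · intro y hyO hyX v hv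
    have hy := interior_subset hyO
    have hd : HasFDerivAt (fun y => y + N y (lam y))
        (ContinuousLinearMap.id ℝ _ + (N y).comp (fderiv ℝ lam y)) y := by
      have h1 := ((hN y hy.2.2.1).differentiableAt two_ne_zero).hasFDerivAt.clm_apply
        ((hlam2 y hy).differentiableAt two_ne_zero).hasFDerivAt
      refine ((hasFDerivAt_id y).add h1).congr_fderiv ?_
      ext w
      simp [hself y hy hyX]
    have hz : HasFDerivAt (fun z => X.h (z + N z (lam z))) ((fderiv ℝ X.h y).comp
        (ContinuousLinearMap.id ℝ _ + (N y).comp (fderiv ℝ lam y))) y := by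
      refine HasFDerivAt.comp (f := fun z => z + N z (lam z)) y ?_ hd
      rw [hself y hy hyX, map_zero, add_zero]
      exact ((hh y hy.2.2.1).differentiableAt two_ne_zero).hasFDerivAt
    -- `h` vanishes on the image of the retraction. For tangent `v` this gives `Dh Dhᵀ (Dlam v) =
    -- -Dh v = 0`, hence `Dlam v = 0`, so the correction is stationary in tangential directions.
    have hz0 : HasFDerivAt (fun z => X.h (z + N z (lam z)))
        (0 : Vec n →L[ℝ] Vec (n - q)) y := by
      refine (hasFDerivAt_const (0 : Vec (n - q)) y).congr_of_eventuallyEq ?_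
      filter_upwards [isOpen_interior.mem_nhds hyO] with z hz
      exact X.h_eq_zero (hmem z (interior_subset hz))
    have h0 := congrArg (fun T : Vec n →L[ℝ] Vec (n - q) => T v) (hz.unique hz0)
    have h1 : fderiv ℝ X.h y v = 0 := hv
    have h2 : fderiv ℝ lam y v = 0 := by
      refine apply_transposeCLM_injective (X.regular y hyX) ?_
      simpa [h1] using h0
    rw [hd.fderiv]
    simp [h2]

end EmbeddedLieGroup

/-! ### Calculus of matrix-valued functions, entry by entry -/

section EntrywiseCalculus

variable {E : Type*} [NormedAddCommGroup E] [NormedSpace ℝ E] {r : WithTop ℕ∞}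
  {a b c : ℕ} {x : E}

theorem contDiffAt_matrix_mul {Q : E → Matrix (Fin a) (Fin b) ℝ} {R : E → Matrix (Fin b) (Fin c) ℝ}
    (hQ : ∀ i j, ContDiffAt ℝ r (fun y => Q y i j) x)
    (hR : ∀ i j, ContDiffAt ℝ r (fun y => R y i j) x) (i : Fin a) (j : Fin c) :
    ContDiffAt ℝ r (fun y => (Q y * R y) i j) x := by
  simp only [Matrix.mul_apply]
  exact ContDiffAt.sum fun l _ => (hQ i l).mul (hR l j)

theorem contDiffAt_mulVec {Q : E → Matrix (Fin a) (Fin b) ℝ} {v : E → Fin b → ℝ}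
    (hQ : ∀ i j, ContDiffAt ℝ r (fun y => Q y i j) x) (hv : ContDiffAt ℝ r v x) :
    ContDiffAt ℝ r (fun y => Q y *ᵥ v y) x := by
  refine contDiffAt_pi.2 fun i => ?_
  simp only [Matrix.mulVec, dotProduct]
  exact ContDiffAt.sum fun l _ => (hQ i l).mul (contDiffAt_pi.1 hv l)

theorem contDiffAt_dotProduct {v w : E → Fin b → ℝ} (hv : ContDiffAt ℝ r v x)
    (hw : ContDiffAt ℝ r w x) : ContDiffAt ℝ r (fun y => v y ⬝ᵥ w y) x := by
  simp only [dotProduct]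
  exact ContDiffAt.sum fun l _ => (contDiffAt_pi.1 hv l).mul (contDiffAt_pi.1 hw l)

theorem contDiffAt_det {Q : E → Matrix (Fin a) (Fin a) ℝ}
    (hQ : ∀ i j, ContDiffAt ℝ r (fun y => Q y i j) x) :
    ContDiffAt ℝ r (fun y => (Q y).det) x := by
  simp only [Matrix.det_apply']
  exact ContDiffAt.sum fun σ _ => contDiffAt_const.mul (contDiffAt_prod fun l _ => hQ _ _)

/-- Cramer's rule: the entries of the adjugate are determinants of matrices with one row replaced by
a constant row. -/
theorem contDiffAt_matrix_inv {Q : E → Matrix (Fin a) (Fin a) ℝ}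
    (hQ : ∀ i j, ContDiffAt ℝ r (fun y => Q y i j) x) (hdet : (Q x).det ≠ 0) (i j : Fin a) :
    ContDiffAt ℝ r (fun y => (Q y)⁻¹ i j) x := by
  simp only [Matrix.inv_def, Ring.inverse_eq_inv', Matrix.smul_apply, Matrix.adjugate_apply,
    smul_eq_mul]
  refine ((contDiffAt_det hQ).inv hdet).mul (contDiffAt_det fun k l => ?_)
  by_cases hk : k = j
  · subst hk
    simpa only [Matrix.updateRow_self] using contDiffAt_const
  · simpa only [Matrix.updateRow_ne hk] using hQ k l

end EntrywiseCalculus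

theorem matDeriv_hasDerivAt {n a b : ℕ} {Q : Vec n → Matrix (Fin a) (Fin b) ℝ} {y : ℝ → Vec n}
    {y' : Vec n} {t : ℝ} (hQ : ∀ i j, DifferentiableAt ℝ (fun x => Q x i j) (y t))
    (hy : HasDerivAt y y' t) (i : Fin a) (j : Fin b) :
    HasDerivAt (fun s => Q (y s) i j) (matDeriv Q (y t) y' i j) t :=
  (hQ i j).hasFDerivAt.comp_hasDerivAt t hy

theorem hasDerivAt_dotProduct {b : ℕ} {v w : ℝ → Vec b} {v' w' : Vec b} {t : ℝ}
    (hv : HasDerivAt v v' t) (hw : HasDerivAt w w' t) :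
    HasDerivAt (fun s => v s ⬝ᵥ w s) (v' ⬝ᵥ w t + v t ⬝ᵥ w') t := by
  simp only [dotProduct, ← Finset.sum_add_distrib]
  exact HasDerivAt.fun_sum fun l _ => (hasDerivAt_pi.1 hv l).mul (hasDerivAt_pi.1 hw l)

theorem hasDerivAt_mulVec {n a b : ℕ} {Q : Vec n → Matrix (Fin a) (Fin b) ℝ} {y : ℝ → Vec n}
    {y' : Vec n} {v : ℝ → Vec b} {v' : Vec b} {t : ℝ}
    (hQ : ∀ i j, DifferentiableAt ℝ (fun x => Q x i j) (y t))
    (hy : HasDerivAt y y' t) (hv : HasDerivAt v v' t) :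
    HasDerivAt (fun s => Q (y s) *ᵥ v s) (matDeriv Q (y t) y' *ᵥ v t + Q (y t) *ᵥ v') t :=
  hasDerivAt_pi.2 fun i => hasDerivAt_dotProduct
    (hasDerivAt_pi.2 fun j => matDeriv_hasDerivAt hQ hy i j) hv

theorem jac_mulVec {n k : ℕ} (F : Vec n → Vec k) (x v : Vec n) :
    jac F x *ᵥ v = fderiv ℝ F x v := by
  rw [jac, LinearMap.toMatrix'_mulVec]; rfl

theorem MatContDiffOn.contDiffAt {n a b : ℕ} {r : WithTop ℕ∞}
    {Q : Vec n → Matrix (Fin a) (Fin b) ℝ} {U : Set (Vec n)} (hQ : MatContDiffOn r Q U)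
    (hU : IsOpen U) {x : Vec n} (hx : x ∈ U) (i : Fin a) (j : Fin b) :
    ContDiffAt ℝ r (fun y => Q y i j) x :=
  (hQ i j).contDiffAt (hU.mem_nhds hx)

namespace EmbeddedLieGroup.IsFrame

variable {n q : ℕ} {X : EmbeddedLieGroup n q} {S : Vec n → Matrix (Fin n) (Fin q) ℝ}

theorem contDiffAt_proj (hS : X.IsFrame S) {x : Vec n} (hx : x ∈ X.carrier) (i : Fin n)
    (j : Fin q) : ContDiffAt ℝ 1 (fun y => proj S y i j) x := by
  have h0 : ∀ i j, ContDiffAt ℝ 1 (fun y => S y i j) x := fun i j =>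
    (hS.smooth.contDiffAt X.isOpen_dom (X.mem_dom hx) i j).of_le (by norm_cast)
  have h1 : ∀ i j, ContDiffAt ℝ 1 (fun y => ((S y)ᵀ * S y) i j) x := fun i j =>
    contDiffAt_matrix_mul (Q := fun y => (S y)ᵀ) (fun i j => h0 j i) h0 i j
  refine contDiffAt_matrix_mul h0 (contDiffAt_matrix_inv h1 ?_) i j
  have hpd : ((S x)ᵀ * S x).PosDef := by
    have h := Matrix.PosDef.conjTranspose_mul_self (S x) (hS.injective x hx)
    simpa [Matrix.conjTranspose_eq_transpose_of_trivial] using h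
  exact hpd.det_pos.ne'

theorem mulVec_proj (hS : X.IsFrame S) {x v : Vec n} (hx : x ∈ X.carrier)
    (hv : v ∈ X.tangent x) : S x *ᵥ ((proj S x)ᵀ *ᵥ v) = v := by
  have hv' : v ∈ Set.range (S x).mulVec := by rw [hS.range_eq x hx]; exact hv
  obtain ⟨y, rfl⟩ := hv'
  rw [Matrix.mulVec_mulVec y, proj_transpose_mul S x (hS.injective x hx), Matrix.one_mulVec]

end EmbeddedLieGroup.IsFrame

/-! ### The metric on tangent vectors -/

/-- The square `vᵀ ℳ v` of the norm of `δx = S v` for the metric `ℳ`. -/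
def metricForm {n q : ℕ} (S : Vec n → Matrix (Fin n) (Fin q) ℝ)
    (M : Vec n → Matrix (Fin q) (Fin q) ℝ) (y d : Vec n) : ℝ :=
  ((proj S y)ᵀ *ᵥ d) ⬝ᵥ (M y *ᵥ ((proj S y)ᵀ *ᵥ d))

section MetricForm

variable {n q : ℕ} {X : EmbeddedLieGroup n q} {S : Vec n → Matrix (Fin n) (Fin q) ℝ}
  {M : Vec n → Matrix (Fin q) (Fin q) ℝ}

theorem contDiffAt_metricForm (hS : X.IsFrame S) (hM : IsUniformMetric X M)
    {p : Vec n × Vec n} (hp : p.1 ∈ X.carrier) :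
    ContDiffAt ℝ 1 (fun p : Vec n × Vec n => metricForm S M p.1 p.2) p := by
  have h1 : ContDiffAt ℝ 1 (fun p : Vec n × Vec n => (proj S p.1)ᵀ *ᵥ p.2) p :=
    contDiffAt_mulVec (Q := fun p : Vec n × Vec n => (proj S p.1)ᵀ)
      (fun i j => (hS.contDiffAt_proj hp j i).comp p contDiffAt_fst) contDiffAt_snd
  exact contDiffAt_dotProduct h1 (contDiffAt_mulVec (fun i j =>
    (hM.contDiff.contDiffAt X.isOpen_dom (X.mem_dom hp) i j).comp p contDiffAt_fst) h1)

theorem metricForm_smul (c : ℝ) (y d : Vec n) :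
    metricForm S M y (c • d) = c ^ 2 * metricForm S M y d := by
  simp only [metricForm, Matrix.mulVec_smul, dotProduct_smul, smul_dotProduct, smul_eq_mul]
  ring

theorem hasDerivAt_metricForm (hS : X.IsFrame S) (hM : IsUniformMetric X M) {y d : ℝ → Vec n}
    {y' d' : Vec n} {t : ℝ} (hyt : y t ∈ X.carrier) (hy : HasDerivAt y y' t)
    (hd : HasDerivAt d d' t) :
    HasDerivAt (fun s => metricForm S M (y s) (d s))
      (2 * (((proj S (y t))ᵀ *ᵥ d t) ⬝ᵥ (M (y t) *ᵥ
          (matDeriv (fun x => (proj S x)ᵀ) (y t) y' *ᵥ d t + (proj S (y t))ᵀ *ᵥ d')))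
        + ((proj S (y t))ᵀ *ᵥ d t) ⬝ᵥ (matDeriv M (y t) y' *ᵥ ((proj S (y t))ᵀ *ᵥ d t))) t := by
  have h1 := hasDerivAt_mulVec (Q := fun x => (proj S x)ᵀ)
    (fun i j => (hS.contDiffAt_proj hyt j i).differentiableAt one_ne_zero) hy hd
  have h2 := hasDerivAt_mulVec (Q := M) (fun i j => (hM.contDiff.contDiffAt X.isOpen_dom
    (X.mem_dom hyt) i j).differentiableAt one_ne_zero) hy h1
  refine (hasDerivAt_dotProduct h1 h2).congr_deriv ?_
  set p := (proj S (y t))ᵀ *ᵥ d t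
  set p' := matDeriv (fun x => (proj S x)ᵀ) (y t) y' *ᵥ d t + (proj S (y t))ᵀ *ᵥ d'
  -- Symmetry of `ℳ` merges the two cross terms of the product rule.
  have h3 : p' ⬝ᵥ (M (y t) *ᵥ p) = p ⬝ᵥ (M (y t) *ᵥ p') := by
    rw [Matrix.dotProduct_mulVec, ← Matrix.mulVec_transpose, hM.symm _ hyt, dotProduct_comm]
  rw [h3, dotProduct_add]
  ring

/-- The metric dominates the squared Euclidean norm on tangent vectors. -/
theorem exists_metricForm_ge (hS : X.IsFrame S) (hM : IsUniformMetric X M)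
    (hSbdd : ∃ σ : ℝ, ∀ x ∈ X.carrier,
      (σ • (1 : Matrix (Fin q) (Fin q) ℝ) - (S x)ᵀ * S x).PosSemidef) :
    ∃ κ : ℝ, 0 < κ ∧ ∀ x ∈ X.carrier, ∀ d ∈ X.tangent x,
      κ * ‖d‖ ^ 2 ≤ metricForm S M x d := by
  obtain ⟨a, b, ha, -, hab⟩ := hM.bounds
  obtain ⟨σ, hσ⟩ := hSbdd
  -- For `d = S p` one has `vᵀℳv ≥ a|p|²` at `v = p` and `|d|² ≤ σ|p|²`. The maximum with `1` keeps
  -- the denominator positive whatever `σ` is. The norm `‖d‖` is the sup norm, which the Euclidean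
  -- one dominates.
  refine ⟨a / max σ 1, by positivity, fun x hx d hd => ?_⟩
  have hd' := hS.mulVec_proj hx hd
  set p := (proj S x)ᵀ *ᵥ d with hp
  have h1 : a * (p ⬝ᵥ p) ≤ metricForm S M x d := by
    have := (hab x hx).1.dotProduct_mulVec_nonneg p
    simp only [star_trivial, Matrix.sub_mulVec, Matrix.smul_mulVec, Matrix.one_mulVec,
      dotProduct_sub, dotProduct_smul, smul_eq_mul] at this
    simpa [metricForm, ← hp] using this
  have h2 : d ⬝ᵥ d ≤ σ * (p ⬝ᵥ p) := by
    have := (hσ x hx).dotProduct_mulVec_nonneg p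
    simp only [star_trivial, Matrix.sub_mulVec, Matrix.smul_mulVec, Matrix.one_mulVec,
      dotProduct_sub, dotProduct_smul, smul_eq_mul] at this
    rw [← Matrix.mulVec_mulVec, hd', Matrix.dotProduct_mulVec p (S x)ᵀ d, Matrix.vecMul_transpose,
      hd'] at this
    linarith
  have h3 : ‖d‖ ^ 2 ≤ d ⬝ᵥ d := by
    have h0 : (0 : ℝ) ≤ d ⬝ᵥ d := Finset.sum_nonneg fun i _ => mul_self_nonneg _
    have : ‖d‖ ≤ Real.sqrt (d ⬝ᵥ d) := by
      refine (pi_norm_le_iff_of_nonneg (Real.sqrt_nonneg _)).2 fun i => ?_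
      rw [Real.norm_eq_abs]
      refine Real.abs_le_sqrt ?_
      rw [pow_two]
      exact Finset.single_le_sum (f := fun i => d i * d i) (fun i _ => mul_self_nonneg _)
        (Finset.mem_univ i)
    calc ‖d‖ ^ 2 ≤ Real.sqrt (d ⬝ᵥ d) ^ 2 := by gcongr
      _ = _ := Real.sq_sqrt h0
  have h4 : σ * (p ⬝ᵥ p) ≤ max σ 1 * (p ⬝ᵥ p) :=
    mul_le_mul_of_nonneg_right (le_max_left _ _) (Finset.sum_nonneg fun i _ => mul_self_nonneg _)
  rw [div_mul_eq_mul_div, div_le_iff₀ (by positivity)]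
  calc a * ‖d‖ ^ 2 ≤ a * (max σ 1 * (p ⬝ᵥ p)) := by gcongr; linarith
    _ = (a * (p ⬝ᵥ p)) * max σ 1 := by ring
    _ ≤ _ := by gcongr

end MetricForm

theorem sum_smul_jac_mulVec {n k : ℕ} {B : Vec n → Matrix (Fin n) (Fin k) ℝ} (u : Vec k)
    (x : Vec n) (hB : ∀ i j, DifferentiableAt ℝ (fun y => B y i j) x) (v : Vec n) :
    (∑ i, u i • jac (fun y a => B y a i) x) *ᵥ v = matDeriv B x v *ᵥ u := by
  rw [Matrix.sum_mulVec]
  ext a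
  simp only [Finset.sum_apply, Matrix.smul_mulVec, Pi.smul_apply, smul_eq_mul, jac_mulVec,
    Matrix.mulVec, dotProduct, matDeriv, Matrix.of_apply]
  refine Finset.sum_congr rfl fun i _ => ?_
  rw [fderiv_pi fun j => hB j i, ContinuousLinearMap.coe_pi']
  ring

/-! ### The linearised closed loop and the inequality `R₁ ⪯ 0` -/

namespace ControlSystem

variable {n q m p l : ℕ} {X : EmbeddedLieGroup n q} (sys : ControlSystem X m p l)
  {k : Vec n → Vec n → Vec m} {S : Vec n → Matrix (Fin n) (Fin q) ℝ}
  {M : Vec n → Matrix (Fin q) (Fin q) ℝ}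

theorem contDiffAt_feedback (hk : IsFeedback X k) {x xs : Vec n} (hx : x ∈ X.dom)
    (hxs : xs ∈ X.carrier) : ContDiffAt ℝ 1 (fun y => k y xs) x :=
  (hk.contDiff xs hxs).contDiffAt (X.isOpen_dom.mem_nhds hx)

theorem contDiffAt_rhs (hk : IsFeedback X k) {x xs : Vec n} (hx : x ∈ X.dom)
    (hxs : xs ∈ X.carrier) (us : Vec m) (w : Vec p) :
    ContDiffAt ℝ 1 (fun y => sys.rhs y (k y xs + us) w) x :=
  ((sys.contDiff_f.contDiffAt (X.isOpen_dom.mem_nhds hx)).add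
    (contDiffAt_mulVec (sys.contDiff_B.contDiffAt X.isOpen_dom hx)
      ((contDiffAt_feedback hk hx hxs).add contDiffAt_const))).add
    (contDiffAt_mulVec (sys.contDiff_Bw.contDiffAt X.isOpen_dom hx) contDiffAt_const)

theorem contDiffAt_Bw_mulVec {x : Vec n} (hx : x ∈ X.dom) (w : Vec p) :
    ContDiffAt ℝ 1 (fun y => sys.Bw y *ᵥ w) x :=
  contDiffAt_mulVec (sys.contDiff_Bw.contDiffAt X.isOpen_dom hx) contDiffAt_const

theorem Bw_mulVec_mem_tangent {x : Vec n} (hx : x ∈ X.carrier) (w : Vec p) :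
    sys.Bw x *ᵥ w ∈ X.tangent x := by
  rw [X.mem_tangent, ← jac_mulVec, Matrix.mulVec_mulVec, sys.transversal_Bw x hx,
    Matrix.zero_mulVec]

theorem rhs_mem_tangent {x : Vec n} (hx : x ∈ X.carrier) (u : Vec m) (w : Vec p) :
    sys.rhs x u w ∈ X.tangent x := by
  refine Submodule.add_mem _ (Submodule.add_mem _ ?_ ?_) (sys.Bw_mulVec_mem_tangent hx w)
  · rw [X.mem_tangent, ← jac_mulVec, sys.transversal_f x hx]
  · rw [X.mem_tangent, ← jac_mulVec, Matrix.mulVec_mulVec, sys.transversal_B x hx,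
      Matrix.zero_mulVec]

/-- The product rule for `B(y) u(y)` splits into the terms `uᵢ ∂bᵢ`, absorbed in `A`, and `B K d`
from the feedback. It is applied along the line `x + t d`, and uniqueness of derivatives identifies
the result. -/
theorem fderiv_rhs_apply (hk : IsFeedback X k) {x xs : Vec n} (hx : x ∈ X.dom)
    (hxs : xs ∈ X.carrier) (us : Vec m) (w : Vec p) (d : Vec n) :
    fderiv ℝ (fun y => sys.rhs y (k y xs + us) w) x d
      = sys.A x (k x xs + us) w *ᵥ d + sys.B x *ᵥ (jac (fun y => k y xs) x *ᵥ d) := by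
  have hl : HasDerivAt (fun t : ℝ => x + t • d) d 0 := by
    simpa using ((hasDerivAt_id (0 : ℝ)).smul_const d).const_add x
  have h0 : x + (0 : ℝ) • d = x := by simp
  have h1 : HasDerivAt (fun t : ℝ => sys.rhs (x + t • d) (k (x + t • d) xs + us) w)
      (fderiv ℝ (fun y => sys.rhs y (k y xs + us) w) x d) 0 := by
    refine HasFDerivAt.comp_hasDerivAt (f := fun t : ℝ => x + t • d)
      (l := fun y => sys.rhs y (k y xs + us) w) 0 ?_ hl
    rw [h0]
    exact ((sys.contDiffAt_rhs hk hx hxs us w).differentiableAt one_ne_zero).hasFDerivAt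
  have hf : HasDerivAt (fun t : ℝ => sys.f (x + t • d)) (fderiv ℝ sys.f x d) 0 := by
    refine HasFDerivAt.comp_hasDerivAt (f := fun t : ℝ => x + t • d) 0 ?_ hl
    rw [h0]
    exact ((sys.contDiff_f.contDiffAt (X.isOpen_dom.mem_nhds hx)).differentiableAt
      one_ne_zero).hasFDerivAt
  have hkd : HasDerivAt (fun t : ℝ => k (x + t • d) xs + us) (fderiv ℝ (fun y => k y xs) x d) 0 := by
    refine HasDerivAt.add_const _ (HasFDerivAt.comp_hasDerivAt (f := fun t : ℝ => x + t • d)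
      (l := fun y => k y xs) 0 ?_ hl)
    rw [h0]
    exact ((contDiffAt_feedback hk hx hxs).differentiableAt one_ne_zero).hasFDerivAt
  have hBd : ∀ i j, DifferentiableAt ℝ (fun y => sys.B y i j) x := fun i j =>
    (sys.contDiff_B.contDiffAt X.isOpen_dom hx i j).differentiableAt one_ne_zero
  have hBwd : ∀ i j, DifferentiableAt ℝ (fun y => sys.Bw y i j) x := fun i j =>
    (sys.contDiff_Bw.contDiffAt X.isOpen_dom hx i j).differentiableAt one_ne_zero
  have hB := hasDerivAt_mulVec (Q := sys.B) (by rw [h0]; exact hBd) hl hkd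
  have hBw := hasDerivAt_mulVec (Q := sys.Bw) (by rw [h0]; exact hBwd) hl
    (hasDerivAt_const (0 : ℝ) w)
  rw [h1.unique ((hf.add hB).add hBw)]
  simp only [h0, A, Matrix.add_mulVec, jac_mulVec, Matrix.mulVec_zero, add_zero,
    sum_smul_jac_mulVec _ _ hBd, sum_smul_jac_mulVec _ _ hBwd]
  abel

/-- The differential dissipation inequality expressed by `R₁ ⪯ 0`. -/
theorem metricForm_dissipation (hS : X.IsFrame S) (hk : IsFeedback X k)
    (hM : IsUniformMetric X M) {lam mu : ℝ} {x xs : Vec n} (hx : x ∈ X.carrier)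
    (hxs : xs ∈ X.carrier) {us : Vec m} {w : Vec p}
    (hR1 : (-(sys.R1 S k M lam mu x xs us w)).PosSemidef) {d : Vec n} (hd : d ∈ X.tangent x)
    (e : Vec p) {F : Vec n} (hF : F = sys.rhs x (k x xs + us) w) {F' : Vec n}
    (hF' : F' = fderiv ℝ (fun y => sys.rhs y (k y xs + us) w) x d + sys.Bw x *ᵥ e) :
    2 * (((proj S x)ᵀ *ᵥ d) ⬝ᵥ (M x *ᵥ
        (matDeriv (fun x => (proj S x)ᵀ) x F *ᵥ d + (proj S x)ᵀ *ᵥ F')))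
      + ((proj S x)ᵀ *ᵥ d) ⬝ᵥ (matDeriv M x F *ᵥ ((proj S x)ᵀ *ᵥ d))
      ≤ -2 * lam * metricForm S M x d + mu * (e ⬝ᵥ e) := by
  have hd' := hS.mulVec_proj hx hd
  rw [metricForm]
  set v := (proj S x)ᵀ *ᵥ d with hv
  -- This is where `𝒜` comes from: for `d = S v` the coordinates of a variation satisfy `v˙ = 𝒜 v +
  -- E_w e`.
  have h1 : matDeriv (fun x => (proj S x)ᵀ) x F *ᵥ d + (proj S x)ᵀ *ᵥ F'
      = sys.calA S k x xs us w *ᵥ v + sys.Ew S x *ᵥ e := by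
    rw [calA, ← Matrix.mulVec_mulVec, hd', hF', fderiv_rhs_apply sys hk (X.mem_dom hx) hxs, ← hF,
      E, Ew]
    simp only [Matrix.add_mulVec, Matrix.mulVec_add, Matrix.mulVec_mulVec, Matrix.mul_assoc]
    abel
  -- The quadratic form of `R₁` is tested on the coordinates `v` of `d` and the disturbance
  -- variation `e`.
  have h2 := hR1.dotProduct_mulVec_nonneg (Sum.elim v e)
  simp only [R1, star_trivial, Matrix.neg_mulVec, dotProduct_neg, Matrix.fromBlocks_mulVec,
    Function.comp_def, Sum.elim_inl, Sum.elim_inr, sumElim_dotProduct_sumElim,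
    Matrix.add_mulVec, dotProduct_add, Matrix.smul_mulVec, Matrix.one_mulVec, dotProduct_smul,
    smul_eq_mul, ← hF] at h2
  have h3 : v ⬝ᵥ ((M x * sys.calA S k x xs us w)ᵀ *ᵥ v)
      = v ⬝ᵥ ((M x * sys.calA S k x xs us w) *ᵥ v) := by
    rw [Matrix.mulVec_transpose, dotProduct_comm, ← Matrix.dotProduct_mulVec]
  have h4 : e ⬝ᵥ (((sys.Ew S x)ᵀ * M x) *ᵥ v) = v ⬝ᵥ ((M x * sys.Ew S x) *ᵥ e) := by
    have : ((sys.Ew S x)ᵀ * M x) = (M x * sys.Ew S x)ᵀ := by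
      rw [Matrix.transpose_mul, hM.symm x hx]
    rw [this, Matrix.mulVec_transpose, dotProduct_comm, Matrix.dotProduct_mulVec]
  rw [h3, h4] at h2
  rw [h1]
  simp only [Matrix.mulVec_add, dotProduct_add, Matrix.mulVec_mulVec]
  linarith

end ControlSystem

/-! ### Uniform first-order estimates for forms homogeneous in the velocity -/

section UniformExpansion

variable {E : Type*} [NormedAddCommGroup E] [NormedSpace ℝ E]

/-- The first-order expansion of a `C¹` function is uniform on compact sets. -/
theorem exists_uniform_first_order {Ψ : E → ℝ} {C : Set E} (hC : IsCompact C)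
    (hΨ : ∀ p ∈ C, ContDiffAt ℝ 1 Ψ p) {ε : ℝ} (hε : 0 < ε) :
    ∃ r > 0, ∀ p ∈ C, ∀ v : E, ‖v‖ ≤ r → |Ψ (p + v) - Ψ p - fderiv ℝ Ψ p v| ≤ ε * ‖v‖ := by
  have key : ∀ᶠ v in 𝓝 (0 : E), ∀ p ∈ C, |Ψ (p + v) - Ψ p - fderiv ℝ Ψ p v| ≤ ε * ‖v‖ := by
    -- Strict differentiability at `p` gives the expansion at all nearby base points with the
    -- derivative taken at `p`. Continuity of the derivative replaces it by the one at the base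
    -- point, and compactness makes the radius uniform.
    refine hC.eventually_forall_of_forall_eventually fun p hp => ?_
    have hs : HasStrictFDerivAt Ψ (fderiv ℝ Ψ p) p := (hΨ p hp).hasStrictFDerivAt one_ne_zero
    have h1 := (hs.isLittleO.def (half_pos hε))
    have hT : Tendsto (fun z : E × E => (z.2 + z.1, z.2)) (𝓝 ((0 : E), p)) (𝓝 (p, p)) := by
      have : Continuous fun z : E × E => (z.2 + z.1, z.2) := by fun_prop
      simpa using this.tendsto ((0 : E), p)
    have hcd : ContinuousAt (fderiv ℝ Ψ) p := (hΨ p hp).continuousAt_fderiv one_ne_zero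
    have h2 : ∀ᶠ z in 𝓝 ((0 : E), p), ‖fderiv ℝ Ψ z.2 - fderiv ℝ Ψ p‖ ≤ ε / 2 := by
      have : Tendsto (fun z : E × E => fderiv ℝ Ψ z.2) (𝓝 ((0 : E), p)) (𝓝 (fderiv ℝ Ψ p)) :=
        hcd.tendsto.comp continuous_snd.continuousAt
      filter_upwards [this.eventually (Metric.closedBall_mem_nhds _ (half_pos hε))] with z hz
      simpa [dist_eq_norm] using hz
    filter_upwards [hT.eventually h1, h2] with z hz1 hz2
    have e1 : ‖Ψ (z.2 + z.1) - Ψ z.2 - fderiv ℝ Ψ p z.1‖ ≤ ε / 2 * ‖z.1‖ := by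
      simpa using hz1
    have e2 : ‖(fderiv ℝ Ψ z.2 - fderiv ℝ Ψ p) z.1‖ ≤ ε / 2 * ‖z.1‖ :=
      (ContinuousLinearMap.le_opNorm _ _).trans (by gcongr)
    rw [Real.norm_eq_abs] at e1 e2
    have e3 : (fderiv ℝ Ψ z.2 - fderiv ℝ Ψ p) z.1 = fderiv ℝ Ψ z.2 z.1 - fderiv ℝ Ψ p z.1 := rfl
    rw [e3] at e2
    rw [abs_le] at *
    constructor <;> linarith [e1.1, e1.2, e2.1, e2.2]
  obtain ⟨r, hr, hr'⟩ := Metric.eventually_nhds_iff_ball.1 key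
  refine ⟨r / 2, half_pos hr, fun p hp v hv => hr' v ?_ p hp⟩
  rw [mem_ball_zero_iff]; linarith

theorem exists_bound_fderiv {F : Type*} [NormedAddCommGroup F] [NormedSpace ℝ F] {Ψ : E → F}
    {C : Set E} (hC : IsCompact C) (hΨ : ∀ p ∈ C, ContDiffAt ℝ 1 Ψ p) :
    ∃ L > 0, ∀ p ∈ C, ‖fderiv ℝ Ψ p‖ ≤ L := by
  obtain ⟨L, hL⟩ := hC.exists_bound_of_continuousOn (f := fderiv ℝ Ψ)
    fun p hp => ((hΨ p hp).continuousAt_fderiv one_ne_zero).continuousWithinAt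
  exact ⟨max L 1, by positivity, fun p hp => (hL p hp).trans (le_max_left _ _)⟩

variable [ProperSpace E]

/-- A Lipschitz bound for a `C¹` function that is homogeneous of degree two in the velocity. -/
theorem exists_lipschitz_perturbation {Ψ : E × E → ℝ} {K : Set E} (hK : IsCompact K)
    (hΨ : ∀ p : E × E, p.1 ∈ K → ContDiffAt ℝ 1 Ψ p)
    (hhom : ∀ (c : ℝ) (y d : E), Ψ (y, c • d) = c ^ 2 * Ψ (y, d)) :
    ∃ L > 0, ∃ r > 0, ∀ y ∈ K, ∀ d ζ ξ : E, ‖ζ‖ ≤ r → ‖ξ‖ ≤ r →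
      Ψ (y + ζ, d + ξ) ≤ Ψ (y, d) + L * (‖ζ‖ + ‖ξ‖) * (1 + ‖d‖ ^ 2) := by
  have hC : IsCompact (K ×ˢ Metric.closedBall (0 : E) 1) := hK.prod (isCompact_closedBall _ _)
  obtain ⟨L, hL, hL'⟩ := exists_bound_fderiv hC fun p hp => hΨ p hp.1
  obtain ⟨r, hr, hr'⟩ := exists_uniform_first_order hC (fun p hp => hΨ p hp.1) one_pos
  refine ⟨L + 1, by positivity, r, hr, fun y hy d ζ ξ hζ hξ => ?_⟩
  -- Dividing velocities by `N` brings `(y, d)` into a fixed compact set, where the first-order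
  -- bounds are uniform. Homogeneity scales the result back by `N² ≤ 1 + ‖d‖²`.
  set N := max 1 ‖d‖ with hN
  have hN1 : 1 ≤ N := le_max_left _ _
  have hN0 : 0 < N := by positivity
  have hNd : ‖d‖ ≤ N := le_max_right _ _
  have hNinv : N⁻¹ ≤ 1 := inv_le_one_of_one_le₀ hN1
  have hN2 : N ^ 2 ≤ 1 + ‖d‖ ^ 2 := by
    rcases max_choice 1 ‖d‖ with h | h <;> rw [hN, h] <;> nlinarith [norm_nonneg d]
  have hd1 : ‖N⁻¹ • d‖ ≤ 1 := by
    rw [norm_smul, norm_inv, Real.norm_of_nonneg hN0.le, inv_mul_le_iff₀ hN0]; simpa using hNd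
  have hξ1 : ‖N⁻¹ • ξ‖ ≤ ‖ξ‖ := by
    rw [norm_smul, norm_inv, Real.norm_of_nonneg hN0.le]
    exact mul_le_of_le_one_left (norm_nonneg _) hNinv
  have hv : ‖((ζ, N⁻¹ • ξ) : E × E)‖ ≤ ‖ζ‖ + ‖ξ‖ := by
    rw [Prod.norm_mk]
    exact max_le (le_add_of_nonneg_right (norm_nonneg _))
      (hξ1.trans (le_add_of_nonneg_left (norm_nonneg _)))
  have hvr : ‖((ζ, N⁻¹ • ξ) : E × E)‖ ≤ r := by
    rw [Prod.norm_mk]; exact max_le hζ (hξ1.trans hξ)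
  have hp : ((y, N⁻¹ • d) : E × E) ∈ K ×ˢ Metric.closedBall (0 : E) 1 :=
    ⟨hy, mem_closedBall_zero_iff.2 hd1⟩
  have h1 := (abs_le.1 (hr' _ hp _ hvr)).2
  have h2 : fderiv ℝ Ψ (y, N⁻¹ • d) (ζ, N⁻¹ • ξ) ≤ L * ‖((ζ, N⁻¹ • ξ) : E × E)‖ :=
    (le_abs_self _).trans (ContinuousLinearMap.le_of_opNorm_le _ (hL' _ hp) _)
  rw [Prod.mk_add_mk, ← smul_add, hhom, hhom] at h1
  have h3 : (N⁻¹) ^ 2 * Ψ (y + ζ, d + ξ) ≤ (N⁻¹) ^ 2 * Ψ (y, d) + (L + 1) * (‖ζ‖ + ‖ξ‖) := by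
    have : (L + 1) * ‖((ζ, N⁻¹ • ξ) : E × E)‖ ≤ (L + 1) * (‖ζ‖ + ‖ξ‖) := by gcongr
    linarith
  have h4 := mul_le_mul_of_nonneg_left h3 (sq_nonneg N)
  have h5 : N ^ 2 * (N⁻¹) ^ 2 = 1 := by rw [← mul_pow, mul_inv_cancel₀ hN0.ne', one_pow]
  rw [mul_add, ← mul_assoc, h5, one_mul, ← mul_assoc, h5, one_mul] at h4
  refine h4.trans ?_
  have : N ^ 2 * ((L + 1) * (‖ζ‖ + ‖ξ‖)) ≤ (1 + ‖d‖ ^ 2) * ((L + 1) * (‖ζ‖ + ‖ξ‖)) := by gcongr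
  linarith

/-- Uniform first-order dissipation along the Euler step of the fields `F₀ + s F₁`, up to an
endpoint correction `(1 - s) R₀ + s R₁`. -/
theorem exists_euler_step_dissipation {Ψ : E × E → ℝ} {K : Set E} (hK : IsCompact K)
    (hΨ : ∀ p : E × E, p.1 ∈ K → ContDiffAt ℝ 1 Ψ p)
    (hhom : ∀ (c : ℝ) (y d : E), Ψ (y, c • d) = c ^ 2 * Ψ (y, d)) (T : E → Submodule ℝ E)
    {F₀ F₁ : E → E} (hF₀ : ∀ y ∈ K, ContDiffAt ℝ 1 F₀ y) (hF₁ : ∀ y ∈ K, ContDiffAt ℝ 1 F₁ y)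
    {a c : ℝ}
    (hdiss : ∀ y ∈ K, ∀ s ∈ Icc (0 : ℝ) 1, ∀ d ∈ T y, ∀ σ : ℝ,
      fderiv ℝ Ψ (y, d) (F₀ y + s • F₁ y, fderiv ℝ F₀ y d + s • fderiv ℝ F₁ y d + σ • F₁ y)
        ≤ -a * Ψ (y, d) + c * σ ^ 2) {ε : ℝ} (hε : 0 < ε) :
    ∃ r > 0, ∀ h : ℝ, 0 < h → h ≤ r → ∀ R₀ R₁ : E, ‖R₀‖ ≤ r * h → ‖R₁‖ ≤ r * h →
      ∀ y ∈ K, ∀ s ∈ Icc (0 : ℝ) 1, ∀ d ∈ T y,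
        Ψ (y + (h • (F₀ y + s • F₁ y) + ((1 - s) • R₀ + s • R₁)),
          d + (h • (fderiv ℝ F₀ y d + s • fderiv ℝ F₁ y d + F₁ y) + (R₁ - R₀)))
        ≤ (1 - a * h) * Ψ (y, d) + c * h + ε * h * (1 + ‖d‖ ^ 2) := by
  have hC : IsCompact (K ×ˢ Metric.closedBall (0 : E) 1) := hK.prod (isCompact_closedBall _ _)
  obtain ⟨L, hL, hL'⟩ := exists_bound_fderiv hC fun p hp => hΨ p hp.1
  obtain ⟨C₀, hC₀, hC₀'⟩ := exists_bound_fderiv hK hF₀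
  obtain ⟨C₁, hC₁, hC₁'⟩ := exists_bound_fderiv hK hF₁
  obtain ⟨B₀, hB₀⟩ := hK.exists_bound_of_continuousOn (f := F₀)
    fun y hy => (hF₀ y hy).continuousAt.continuousWithinAt
  obtain ⟨B₁, hB₁⟩ := hK.exists_bound_of_continuousOn (f := F₁)
    fun y hy => (hF₁ y hy).continuousAt.continuousWithinAt
  set A := C₀ + C₁ + |B₀| + |B₁| with hA
  have hA0 : 0 < A := by positivity
  obtain ⟨r₁, hr₁, hr₁'⟩ := exists_uniform_first_order hC (fun p hp => hΨ p hp.1)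
    (ε := ε / 2 / (A + 2)) (by positivity)
  -- The bound `1` keeps the total displacement below `h(A + 2)`. The second bound places it within
  -- the range of the uniform expansion, and the third makes the contribution of `R₀`, `R₁` at most
  -- `εh/2`. The expansion error takes the other half.
  refine ⟨min 1 (min (r₁ / (A + 2)) (ε / (4 * L))), by positivity, ?_⟩
  intro h hh hhr R₀ R₁ hR₀ hR₁ y hy s hs d hd
  set r := min 1 (min (r₁ / (A + 2)) (ε / (4 * L))) with hr
  have hr1 : r ≤ 1 := min_le_left _ _
  have hr0 : 0 < r := by positivity
  have hr2 : r * (A + 2) ≤ r₁ := by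
    rw [← le_div_iff₀ (by positivity)]; exact (min_le_right _ _).trans (min_le_left _ _)
  have hr3 : L * (2 * r) ≤ ε / 2 := by
    have : r ≤ ε / (4 * L) := (min_le_right _ _).trans (min_le_right _ _)
    rw [le_div_iff₀ (by positivity)] at this
    linarith
  set N := max 1 ‖d‖ with hN
  have hN1 : 1 ≤ N := le_max_left _ _
  have hN0 : 0 < N := by positivity
  have hNd : ‖d‖ ≤ N := le_max_right _ _
  have hNinv : N⁻¹ ≤ 1 := inv_le_one_of_one_le₀ hN1
  have hNinv0 : 0 < N⁻¹ := by positivity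
  have hN2 : N ^ 2 ≤ 1 + ‖d‖ ^ 2 := by
    rcases max_choice 1 ‖d‖ with h | h <;> rw [hN, h] <;> nlinarith [norm_nonneg d]
  have hd1 : ‖N⁻¹ • d‖ ≤ 1 := by
    rw [norm_smul, norm_inv, Real.norm_of_nonneg hN0.le, inv_mul_le_iff₀ hN0]; simpa using hNd
  set d₁ := N⁻¹ • d with hd₁
  have hs0 : ‖s‖ ≤ 1 := by rw [Real.norm_of_nonneg hs.1]; exact hs.2
  have hs1 : ‖1 - s‖ ≤ 1 := by rw [Real.norm_of_nonneg (by linarith [hs.2])]; linarith [hs.1]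
  have hp : ((y, d₁) : E × E) ∈ K ×ˢ Metric.closedBall (0 : E) 1 :=
    ⟨hy, mem_closedBall_zero_iff.2 hd1⟩
  set v₁ : E × E := (F₀ y + s • F₁ y, fderiv ℝ F₀ y d₁ + s • fderiv ℝ F₁ y d₁ + N⁻¹ • F₁ y)
    with hv₁
  set v₂ : E × E := ((1 - s) • R₀ + s • R₁, N⁻¹ • (R₁ - R₀)) with hv₂
  have hsm : ∀ (t : ℝ) (w : E) (b : ℝ), ‖t‖ ≤ 1 → ‖w‖ ≤ b → ‖t • w‖ ≤ b := fun t w b ht hw => by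
    rw [norm_smul]
    exact (mul_le_of_le_one_left (norm_nonneg _) ht).trans hw
  have hNn : ‖N⁻¹‖ ≤ 1 := by rwa [Real.norm_of_nonneg hNinv0.le]
  have n1 : ‖v₁‖ ≤ A := by
    have f0 : ‖F₀ y‖ ≤ |B₀| := (hB₀ y hy).trans (le_abs_self _)
    have f1 : ‖F₁ y‖ ≤ |B₁| := (hB₁ y hy).trans (le_abs_self _)
    have f2 : ‖fderiv ℝ F₀ y d₁‖ ≤ C₀ := by
      have := ContinuousLinearMap.le_of_opNorm_le_of_le _ (hC₀' y hy) hd1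
      simpa using this
    have f3 : ‖fderiv ℝ F₁ y d₁‖ ≤ C₁ := by
      have := ContinuousLinearMap.le_of_opNorm_le_of_le _ (hC₁' y hy) hd1
      simpa using this
    have := abs_nonneg B₀
    rw [hv₁, Prod.norm_mk]
    refine max_le ?_ ?_
    · refine (norm_add_le _ _).trans ?_
      have := hsm s _ _ hs0 f1
      linarith
    · refine (norm_add_le _ _).trans ?_
      have g1 := norm_add_le (fderiv ℝ F₀ y d₁) (s • fderiv ℝ F₁ y d₁)
      have g2 := hsm s _ _ hs0 f3
      have g3 := hsm N⁻¹ _ _ hNn f1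
      linarith
  have n2 : ‖v₂‖ ≤ 2 * r * h := by
    rw [hv₂, Prod.norm_mk]
    refine max_le ?_ (hsm _ _ _ hNn ?_)
    · refine (norm_add_le _ _).trans ?_
      have := hsm _ _ _ hs0 hR₁
      have := hsm _ _ _ hs1 hR₀
      linarith
    · refine (norm_sub_le _ _).trans ?_
      linarith
  have n3 : ‖h • v₁ + v₂‖ ≤ h * (A + 2) := by
    refine (norm_add_le _ _).trans ?_
    rw [norm_smul, Real.norm_of_nonneg hh.le]
    have : h * ‖v₁‖ ≤ h * A := by gcongr
    have : r * h ≤ 1 * h := by gcongr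
    linarith
  have n4 : ‖h • v₁ + v₂‖ ≤ r₁ := by
    refine n3.trans (le_trans ?_ hr2)
    gcongr
  have h1 := (abs_le.1 (hr₁' _ hp _ n4)).2
  have h2 : ε / 2 / (A + 2) * ‖h • v₁ + v₂‖ ≤ ε / 2 * h := by
    calc _ ≤ ε / 2 / (A + 2) * (h * (A + 2)) := by gcongr
      _ = _ := by field_simp
  have h3 : fderiv ℝ Ψ (y, d₁) v₂ ≤ ε / 2 * h := by
    have : fderiv ℝ Ψ (y, d₁) v₂ ≤ L * (2 * r * h) :=
      (le_abs_self _).trans (ContinuousLinearMap.le_of_opNorm_le_of_le _ (hL' _ hp) n2)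
    have : L * (2 * r) * h ≤ ε / 2 * h := by gcongr
    linarith
  -- Scaling `d` by `N⁻¹` also scales the term `F₁ y`, which does not depend on `d`. This is why the
  -- dissipation hypothesis carries a free factor `σ`, used here with `σ = N⁻¹`.
  have h4 := mul_le_mul_of_nonneg_left (hdiss y hy s hs d₁ ((T y).smul_mem _ hd) N⁻¹) hh.le
  rw [map_add, map_smul, smul_eq_mul] at h1
  have hsplit : ((y, d₁) : E × E) + (h • v₁ + v₂)
      = (y + (h • (F₀ y + s • F₁ y) + ((1 - s) • R₀ + s • R₁)),
        N⁻¹ • (d + (h • (fderiv ℝ F₀ y d + s • fderiv ℝ F₁ y d + F₁ y) + (R₁ - R₀)))) := by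
    rw [hv₁, hv₂, hd₁]
    ext1
    · rfl
    · simp only [Prod.snd_add, Prod.smul_snd, map_smul, smul_add, smul_comm N⁻¹]
  rw [hsplit, hhom] at h1
  have hΨd : Ψ (y, d₁) = (N⁻¹) ^ 2 * Ψ (y, d) := hhom _ _ _
  rw [hΨd] at h1 h4
  set Z := Ψ (y + (h • (F₀ y + s • F₁ y) + ((1 - s) • R₀ + s • R₁)),
        (d + (h • (fderiv ℝ F₀ y d + s • fderiv ℝ F₁ y d + F₁ y) + (R₁ - R₀))))
  have h5 : (N⁻¹) ^ 2 * Z ≤ (N⁻¹) ^ 2 * ((1 - a * h) * Ψ (y, d) + c * h) + ε * h := by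
    have : h * (-a * (N⁻¹ ^ 2 * Ψ (y, d)) + c * N⁻¹ ^ 2)
      = (N⁻¹) ^ 2 * ((1 - a * h) * Ψ (y, d) + c * h) - N⁻¹ ^ 2 * Ψ (y, d) := by ring
    linarith
  have h6 := mul_le_mul_of_nonneg_left h5 (sq_nonneg N)
  have h7 : N ^ 2 * (N⁻¹) ^ 2 = 1 := by rw [← mul_pow, mul_inv_cancel₀ hN0.ne', one_pow]
  rw [mul_add, ← mul_assoc, h7, one_mul, ← mul_assoc, h7, one_mul] at h6
  have h8 : N ^ 2 * (ε * h) ≤ (1 + ‖d‖ ^ 2) * (ε * h) := by gcongr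
  linarith

end UniformExpansion

/-! ### The metric pulled back along a retraction -/

theorem hasDerivAt_fderiv_apply {E F : Type*} [NormedAddCommGroup E] [NormedSpace ℝ E]
    [NormedAddCommGroup F] [NormedSpace ℝ F] {ρ : E → F} {c v : ℝ → E} {c' v' : E} {t : ℝ}
    {y d : E} (hct : c t = y) (hvt : v t = d) (hρ : ContDiffAt ℝ 2 ρ y) (hc : HasDerivAt c c' t)
    (hv : HasDerivAt v v' t) :
    HasDerivAt (fun s => fderiv ℝ ρ (c s) (v s))
      (fderiv ℝ (fderiv ℝ ρ) y c' d + fderiv ℝ ρ y v') t := by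
  subst hct hvt
  have h1 : HasFDerivAt (fderiv ℝ ρ) (fderiv ℝ (fderiv ℝ ρ) (c t)) (c t) :=
    ((hρ.fderiv_right (m := 1) (by norm_cast)).differentiableAt one_ne_zero).hasFDerivAt
  exact (h1.comp_hasDerivAt t hc).clm_apply hv

/-- The tangent map costs one derivative. A `C²` retraction therefore makes the pulled-back form
`C¹`, as the first-order expansions require. -/
theorem contDiffAt_tangentMap {E F : Type*} [NormedAddCommGroup E] [NormedSpace ℝ E]
    [NormedAddCommGroup F] [NormedSpace ℝ F] {ρ : E → F} {p : E × E}
    (hρ : ContDiffAt ℝ 2 ρ p.1) :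
    ContDiffAt ℝ 1 (fun p : E × E => (ρ p.1, fderiv ℝ ρ p.1 p.2)) p :=
  ((hρ.of_le (by norm_cast)).comp p contDiffAt_fst).prodMk
    (((hρ.fderiv_right (m := 1) (by norm_cast)).comp p contDiffAt_fst).clm_apply contDiffAt_snd)

theorem hasDerivAt_comp_of_eq {E F : Type*} [NormedAddCommGroup E] [NormedSpace ℝ E]
    [NormedAddCommGroup F] [NormedSpace ℝ F] {ρ : E → F} {c : ℝ → E} {c' : E} {t : ℝ} {y : E}
    (hct : c t = y) (hρ : DifferentiableAt ℝ ρ y) (hc : HasDerivAt c c' t) :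
    HasDerivAt (fun s => ρ (c s)) (fderiv ℝ ρ y c') t := by
  subst hct
  exact hρ.hasFDerivAt.comp_hasDerivAt t hc

theorem hasDerivAt_add_smul {E : Type*} [NormedAddCommGroup E] [NormedSpace ℝ E] (v w : E) (t : ℝ) :
    HasDerivAt (fun s : ℝ => v + s • w) w t := by
  simpa using ((hasDerivAt_id t).smul_const w).const_add v

/-- The metric, pulled back along a map `ρ`. -/
def pullbackForm {n q : ℕ} (S : Vec n → Matrix (Fin n) (Fin q) ℝ)
    (M : Vec n → Matrix (Fin q) (Fin q) ℝ) (ρ : Vec n → Vec n) (p : Vec n × Vec n) : ℝ :=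
  metricForm S M (ρ p.1) (fderiv ℝ ρ p.1 p.2)

section PullbackForm

variable {n q : ℕ} {X : EmbeddedLieGroup n q} {S : Vec n → Matrix (Fin n) (Fin q) ℝ}
  {M : Vec n → Matrix (Fin q) (Fin q) ℝ} {O : Set (Vec n)} {ρ : Vec n → Vec n}

theorem pullbackForm_smul (c : ℝ) (y d : Vec n) :
    pullbackForm S M ρ (y, c • d) = c ^ 2 * pullbackForm S M ρ (y, d) := by
  simp only [pullbackForm, map_smul, metricForm_smul]

theorem pullbackForm_eq (hρ : X.IsRetraction O ρ) {y d : Vec n} (hyO : y ∈ O)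
    (hy : y ∈ X.carrier) (hd : d ∈ X.tangent y) :
    pullbackForm S M ρ (y, d) = metricForm S M y d := by
  simp only [pullbackForm, hρ.eq_self y hyO hy, hρ.fderiv_eq_self y hyO hy d hd]

theorem contDiffAt_pullbackForm (hS : X.IsFrame S) (hM : IsUniformMetric X M)
    (hρ : X.IsRetraction O ρ) {p : Vec n × Vec n} (hp : p.1 ∈ O) :
    ContDiffAt ℝ 1 (pullbackForm S M ρ) p :=
  ContDiffAt.comp (g := fun p : Vec n × Vec n => metricForm S M p.1 p.2)
    (f := fun p : Vec n × Vec n => (ρ p.1, fderiv ℝ ρ p.1 p.2)) p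
    (contDiffAt_metricForm (p := (ρ p.1, fderiv ℝ ρ p.1 p.2)) hS hM (hρ.mem _ hp))
    (contDiffAt_tangentMap (hρ.contDiffAt _ hp))

/-- Along tangent fields the differential of a retraction commutes with differentiation. -/
theorem EmbeddedLieGroup.IsRetraction.fderiv_fderiv_add (hρ : X.IsRetraction O ρ)
    {F : Vec n → Vec n} (hFt : ∀ y ∈ X.carrier, F y ∈ X.tangent y) {y d : Vec n} (hyO : y ∈ O)
    (hy : y ∈ X.carrier) (hF : DifferentiableAt ℝ F y) (hd : d ∈ X.tangent y) :
    fderiv ℝ (fderiv ℝ ρ) y (F y) d + fderiv ℝ ρ y (fderiv ℝ F y d) = fderiv ℝ F y d := by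
  have hρ2 := hρ.contDiffAt y hyO
  have hl := hasDerivAt_add_smul y d 0
  have h0 : y + (0 : ℝ) • d = y := by simp
  have hc : HasDerivAt (fun t : ℝ => ρ (y + t • d)) d 0 := by
    have := hasDerivAt_comp_of_eq h0 (hρ2.differentiableAt two_ne_zero) hl
    rwa [hρ.fderiv_eq_self y hyO hy d hd] at this
  have hc0 : ρ (y + (0 : ℝ) • d) = y := by rw [h0, hρ.eq_self y hyO hy]
  have hev : ∀ᶠ t : ℝ in 𝓝 0, ρ (y + t • d) ∈ X.carrier ∧ ρ (y + t • d) ∈ O := by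
    have e1 : ∀ᶠ t : ℝ in 𝓝 0, y + t • d ∈ O :=
      hl.continuousAt.eventually (hρ.isOpen.mem_nhds (by change y + (0 : ℝ) • d ∈ O; rwa [h0]))
    have e2 : ∀ᶠ t : ℝ in 𝓝 0, ρ (y + t • d) ∈ O :=
      hc.continuousAt.eventually
        (hρ.isOpen.mem_nhds (by change ρ (y + (0 : ℝ) • d) ∈ O; rwa [hc0]))
    filter_upwards [e1, e2] with t h1 h2
    exact ⟨hρ.mem _ h1, h2⟩
  have hFd : HasDerivAt (fun t : ℝ => F (ρ (y + t • d))) (fderiv ℝ F y d) 0 :=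
    hasDerivAt_comp_of_eq hc0 hF hc
  have h1 := hasDerivAt_fderiv_apply (v := fun t : ℝ => F (ρ (y + t • d))) hc0
    (congrArg F hc0) hρ2 hc hFd
  -- Along the curve `ρ(y + t d)`, which stays in `𝒳`, the tangent vector `F` is fixed by `Dρ`.
  -- Differentiating this identity gives the claim with the arguments of `D²ρ` exchanged, and
  -- symmetry of the second derivative restores their order.
  have h2 : HasDerivAt (fun t : ℝ => fderiv ℝ ρ (ρ (y + t • d)) (F (ρ (y + t • d))))
      (fderiv ℝ F y d) 0 := by
    refine hFd.congr_of_eventuallyEq ?_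
    filter_upwards [hev] with t ht
    exact hρ.fderiv_eq_self _ ht.2 ht.1 _ (hFt _ ht.1)
  have hsymm : IsSymmSndFDerivAt ℝ ρ y := hρ2.isSymmSndFDerivAt (by simp)
  rw [hsymm.eq]
  exact h1.unique h2

/-- The ambient variation `DF d` need not be tangent, so `Dρ` may change it. The term `D²ρ(F, d)`
compensates exactly for that, while `b` is tangent and stays fixed. The derivative is thus the
intrinsic one, independent of `ρ`. -/
theorem fderiv_pullbackForm (hS : X.IsFrame S) (hM : IsUniformMetric X M)
    (hρ : X.IsRetraction O ρ) {F : Vec n → Vec n} (hFt : ∀ y ∈ X.carrier, F y ∈ X.tangent y)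
    {y d b : Vec n} (hyO : y ∈ O) (hy : y ∈ X.carrier) (hF : DifferentiableAt ℝ F y)
    (hd : d ∈ X.tangent y) (hb : b ∈ X.tangent y) :
    fderiv ℝ (pullbackForm S M ρ) (y, d) (F y, fderiv ℝ F y d + b)
      = 2 * (((proj S y)ᵀ *ᵥ d) ⬝ᵥ (M y *ᵥ (matDeriv (fun x => (proj S x)ᵀ) y (F y) *ᵥ d
          + (proj S y)ᵀ *ᵥ (fderiv ℝ F y d + b))))
        + ((proj S y)ᵀ *ᵥ d) ⬝ᵥ (matDeriv M y (F y) *ᵥ ((proj S y)ᵀ *ᵥ d)) := by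
  have hρ2 := hρ.contDiffAt y hyO
  have key := hρ.fderiv_fderiv_add hFt hyO hy hF hd
  have haT := hFt y hy
  generalize F y = a at *
  generalize fderiv ℝ F y d = F' at *
  have h0 : ∀ v w : Vec n, v + (0 : ℝ) • w = v := fun v w => by simp
  have h1 : HasDerivAt (fun t : ℝ => pullbackForm S M ρ ((y, d) + t • (a, F' + b)))
      (fderiv ℝ (pullbackForm S M ρ) (y, d) (a, F' + b)) 0 :=
    hasDerivAt_comp_of_eq (by simp)
      ((contDiffAt_pullbackForm hS hM hρ hyO).differentiableAt one_ne_zero)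
      (hasDerivAt_add_smul _ _ 0)
  have hc : HasDerivAt (fun t : ℝ => ρ (y + t • a)) a 0 := by
    have := hasDerivAt_comp_of_eq (h0 y a) (hρ2.differentiableAt two_ne_zero)
      (hasDerivAt_add_smul y a 0)
    rwa [hρ.fderiv_eq_self y hyO hy a haT] at this
  have hD : HasDerivAt (fun t : ℝ => fderiv ℝ ρ (y + t • a) (d + t • (F' + b))) (F' + b) 0 := by
    have := hasDerivAt_fderiv_apply (h0 y a) (h0 d (F' + b)) hρ2
      (hasDerivAt_add_smul y a 0) (hasDerivAt_add_smul d (F' + b) 0)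
    rwa [map_add, hρ.fderiv_eq_self y hyO hy b hb, ← add_assoc, key] at this
  have hρ0 : ρ (y + (0 : ℝ) • a) = y := by rw [h0, hρ.eq_self y hyO hy]
  have h2 := hasDerivAt_metricForm (M := M) hS hM (y := fun t : ℝ => ρ (y + t • a))
    (by simp only [hρ0, hy]) hc hD
  simp only [h0, hρ.eq_self y hyO hy, hρ.fderiv_eq_self y hyO hy d hd] at h2
  exact h1.unique h2

end PullbackForm

/-! ### Curves and their energy -/

section UnitIntervalCurves

variable {E : Type*} [NormedAddCommGroup E] [NormedSpace ℝ E] {γ : ℝ → E}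

theorem continuousOn_derivWithin_unitInterval (hγ : ContDiffOn ℝ 1 γ (Icc 0 1)) :
    ContinuousOn (derivWithin γ (Icc 0 1)) (Icc 0 1) :=
  hγ.continuousOn_derivWithin (uniqueDiffOn_Icc zero_lt_one) le_rfl

theorem intervalIntegrable_of_continuousOn_unitInterval {F : Type*} [NormedAddCommGroup F]
    {f : ℝ → F} (hf : ContinuousOn f (Icc 0 1)) : IntervalIntegrable f volume 0 1 :=
  ContinuousOn.intervalIntegrable (by rwa [uIcc_of_le zero_le_one])

theorem intervalIntegrable_norm_sq_derivWithin (hγ : ContDiffOn ℝ 1 γ (Icc 0 1)) :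
    IntervalIntegrable (fun s => ‖derivWithin γ (Icc 0 1) s‖ ^ 2) volume 0 1 :=
  intervalIntegrable_of_continuousOn_unitInterval
    ((continuousOn_derivWithin_unitInterval hγ).norm.pow 2)

theorem integral_derivWithin_eq_sub [CompleteSpace E] (hγ : ContDiffOn ℝ 1 γ (Icc 0 1)) {b : ℝ}
    (hb : b ∈ Icc (0 : ℝ) 1) : ∫ s in (0 : ℝ)..b, derivWithin γ (Icc 0 1) s = γ b - γ 0 := by
  have hsub : Icc 0 b ⊆ Icc (0 : ℝ) 1 := Icc_subset_Icc_right hb.2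
  refine intervalIntegral.integral_eq_sub_of_hasDerivAt_of_le hb.1 (hγ.continuousOn.mono hsub)
    (fun s hs => ?_) ?_
  · have hs' : s ∈ Ioo (0 : ℝ) 1 := ⟨hs.1, hs.2.trans_le hb.2⟩
    exact ((hγ.differentiableOn one_ne_zero) s (Ioo_subset_Icc_self hs')).hasDerivWithinAt.hasDerivAt
      (Icc_mem_nhds hs'.1 hs'.2)
  · refine ContinuousOn.intervalIntegrable ?_
    rw [uIcc_of_le hb.1]
    exact (continuousOn_derivWithin_unitInterval hγ).mono hsub

end UnitIntervalCurves

/-- `γ` restricts to a `C¹` curve `[0, 1] → Z` from `x` to `y`. -/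
structure IsCurve {n : ℕ} (Z : Set (Vec n)) (γ : ℝ → Vec n) (x y : Vec n) : Prop where
  contDiffOn : ContDiffOn ℝ 1 γ (Icc 0 1)
  mem : ∀ s ∈ Icc (0 : ℝ) 1, γ s ∈ Z
  source : γ 0 = x
  target : γ 1 = y

/-- The energy of a curve. -/
def energy {n q : ℕ} (S : Vec n → Matrix (Fin n) (Fin q) ℝ)
    (M : Vec n → Matrix (Fin q) (Fin q) ℝ) (γ : ℝ → Vec n) : ℝ :=
  ∫ s in (0 : ℝ)..1, metricForm S M (γ s) (derivWithin γ (Icc 0 1) s)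

/-- The infimum of the energies of the curves from `x` to `y`, the squared Riemannian distance. -/
def minEnergy {n q : ℕ} (Z : Set (Vec n)) (S : Vec n → Matrix (Fin n) (Fin q) ℝ)
    (M : Vec n → Matrix (Fin q) (Fin q) ℝ) (x y : Vec n) : ℝ :=
  sInf (energy S M '' {γ | IsCurve Z γ x y})

section Curves

variable {n q : ℕ} {X : EmbeddedLieGroup n q} {S : Vec n → Matrix (Fin n) (Fin q) ℝ}
  {M : Vec n → Matrix (Fin q) (Fin q) ℝ} {γ : ℝ → Vec n} {x y : Vec n}

theorem IsCurve.derivWithin_mem_tangent (hγ : IsCurve X.carrier γ x y) {s : ℝ}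
    (hs : s ∈ Icc (0 : ℝ) 1) : derivWithin γ (Icc 0 1) s ∈ X.tangent (γ s) := by
  have h1 := (hγ.contDiffOn.differentiableOn one_ne_zero s hs).hasDerivWithinAt
  have h2 : HasFDerivAt X.h (fderiv ℝ X.h (γ s)) (γ s) :=
    ((X.contDiffAt_h (X.mem_dom (hγ.mem s hs))).differentiableAt (by simp)).hasFDerivAt
  have h3 := h2.comp_hasDerivWithinAt s h1
  have h4 : HasDerivWithinAt (X.h ∘ γ) 0 (Icc 0 1) s :=
    (hasDerivWithinAt_const s (Icc 0 1) (0 : Vec (n - q))).congr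
      (fun t ht => X.h_eq_zero (hγ.mem t ht)) (X.h_eq_zero (hγ.mem s hs))
  rw [X.mem_tangent]
  exact (uniqueDiffOn_Icc zero_lt_one s hs).eq_deriv _ h3 h4

theorem IsCurve.continuousOn_metricForm (hS : X.IsFrame S) (hM : IsUniformMetric X M)
    (hγ : IsCurve X.carrier γ x y) :
    ContinuousOn (fun s => metricForm S M (γ s) (derivWithin γ (Icc 0 1) s)) (Icc 0 1) :=
  fun s hs => ContinuousAt.comp_continuousWithinAt
    (g := fun p : Vec n × Vec n => metricForm S M p.1 p.2)
    (f := fun s => (γ s, derivWithin γ (Icc 0 1) s))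
    (contDiffAt_metricForm (p := (γ s, derivWithin γ (Icc 0 1) s)) hS hM
      (hγ.mem s hs)).continuousAt
    ((hγ.contDiffOn.continuousOn s hs).prodMk
      (continuousOn_derivWithin_unitInterval hγ.contDiffOn s hs))

section Energy

variable {κ : ℝ}

theorem IsCurve.metricForm_nonneg (hκ : 0 < κ)
    (hκV : ∀ x ∈ X.carrier, ∀ d ∈ X.tangent x, κ * ‖d‖ ^ 2 ≤ metricForm S M x d)
    (hγ : IsCurve X.carrier γ x y) {s : ℝ}
    (hs : s ∈ Icc (0 : ℝ) 1) : 0 ≤ metricForm S M (γ s) (derivWithin γ (Icc 0 1) s) :=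
  (by positivity : 0 ≤ κ * ‖derivWithin γ (Icc 0 1) s‖ ^ 2).trans
    (hκV _ (hγ.mem s hs) _ (hγ.derivWithin_mem_tangent hs))

theorem IsCurve.energy_nonneg (hκ : 0 < κ)
    (hκV : ∀ x ∈ X.carrier, ∀ d ∈ X.tangent x, κ * ‖d‖ ^ 2 ≤ metricForm S M x d)
    (hγ : IsCurve X.carrier γ x y) : 0 ≤ energy S M γ :=
  intervalIntegral.integral_nonneg zero_le_one fun _ hs => hγ.metricForm_nonneg hκ hκV hs

theorem IsCurve.integral_norm_sq_le (hS : X.IsFrame S) (hM : IsUniformMetric X M) (hκ : 0 < κ)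
    (hκV : ∀ x ∈ X.carrier, ∀ d ∈ X.tangent x, κ * ‖d‖ ^ 2 ≤ metricForm S M x d)
    (hγ : IsCurve X.carrier γ x y) :
    ∫ s in (0 : ℝ)..1, ‖derivWithin γ (Icc 0 1) s‖ ^ 2 ≤ energy S M γ / κ := by
  rw [le_div_iff₀ hκ, mul_comm, ← intervalIntegral.integral_const_mul]
  refine intervalIntegral.integral_mono_on zero_le_one
    (intervalIntegrable_of_continuousOn_unitInterval ?_)
    (intervalIntegrable_of_continuousOn_unitInterval (hγ.continuousOn_metricForm hS hM))
    fun s hs => hκV _ (hγ.mem s hs) _ (hγ.derivWithin_mem_tangent hs)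
  exact continuousOn_const.mul
    ((continuousOn_derivWithin_unitInterval hγ.contDiffOn).norm.pow 2)

/-- The crude bound `‖γ'‖ ≤ 1 + ‖γ'‖²` suffices, since the estimate only serves to confine curves of
bounded energy to a ball. -/
theorem IsCurve.norm_sub_source_le (hS : X.IsFrame S) (hM : IsUniformMetric X M) (hκ : 0 < κ)
    (hκV : ∀ x ∈ X.carrier, ∀ d ∈ X.tangent x, κ * ‖d‖ ^ 2 ≤ metricForm S M x d)
    (hγ : IsCurve X.carrier γ x y) {s : ℝ}
    (hs : s ∈ Icc (0 : ℝ) 1) : ‖γ s - x‖ ≤ 1 + energy S M γ / κ := by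
  have hc := continuousOn_derivWithin_unitInterval hγ.contDiffOn
  have hi : IntervalIntegrable (fun s => 1 + ‖derivWithin γ (Icc 0 1) s‖ ^ 2) volume 0 1 :=
    intervalIntegrable_of_continuousOn_unitInterval (continuousOn_const.add (hc.norm.pow 2))
  rw [← hγ.source, ← integral_derivWithin_eq_sub hγ.contDiffOn hs]
  calc ‖∫ s in (0 : ℝ)..s, derivWithin γ (Icc 0 1) s‖
      ≤ ∫ s in (0 : ℝ)..s, (1 + ‖derivWithin γ (Icc 0 1) s‖ ^ 2) := by
        refine intervalIntegral.norm_integral_le_of_norm_le hs.1 ?_ ?_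
        · refine ae_of_all _ fun t _ => ?_
          nlinarith [sq_nonneg (‖derivWithin γ (Icc 0 1) t‖ - 1),
            sq_nonneg ‖derivWithin γ (Icc 0 1) t‖]
        · exact hi.mono_set (by
            rw [uIcc_of_le hs.1, uIcc_of_le zero_le_one]; exact Icc_subset_Icc_right hs.2)
    _ ≤ ∫ s in (0 : ℝ)..1, (1 + ‖derivWithin γ (Icc 0 1) s‖ ^ 2) := by
        refine intervalIntegral.integral_mono_interval le_rfl hs.1 hs.2 ?_ hi
        exact ae_of_all _ fun t => by positivity
    _ = 1 + ∫ s in (0 : ℝ)..1, ‖derivWithin γ (Icc 0 1) s‖ ^ 2 := by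
        rw [intervalIntegral.integral_add intervalIntegrable_const
          (intervalIntegrable_norm_sq_derivWithin hγ.contDiffOn)]
        simp
    _ ≤ _ := by gcongr; exact hγ.integral_norm_sq_le hS hM hκ hκV

theorem bddBelow_energy (hκ : 0 < κ)
    (hκV : ∀ x ∈ X.carrier, ∀ d ∈ X.tangent x, κ * ‖d‖ ^ 2 ≤ metricForm S M x d)
    : BddBelow (energy S M '' {γ | IsCurve X.carrier γ x y}) :=
  ⟨0, by rintro _ ⟨γ, hγ, rfl⟩; exact IsCurve.energy_nonneg hκ hκV hγ⟩

theorem minEnergy_nonneg (hκ : 0 < κ)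
    (hκV : ∀ x ∈ X.carrier, ∀ d ∈ X.tangent x, κ * ‖d‖ ^ 2 ≤ metricForm S M x d)
    : 0 ≤ minEnergy X.carrier S M x y :=
  Real.sInf_nonneg (by rintro _ ⟨γ, hγ, rfl⟩; exact IsCurve.energy_nonneg hκ hκV hγ)

theorem minEnergy_le (hκ : 0 < κ)
    (hκV : ∀ x ∈ X.carrier, ∀ d ∈ X.tangent x, κ * ‖d‖ ^ 2 ≤ metricForm S M x d)
    (hγ : IsCurve X.carrier γ x y) : minEnergy X.carrier S M x y ≤ energy S M γ :=
  csInf_le (bddBelow_energy hκ hκV) ⟨γ, hγ, rfl⟩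

theorem minEnergy_self (hκ : 0 < κ)
    (hκV : ∀ x ∈ X.carrier, ∀ d ∈ X.tangent x, κ * ‖d‖ ^ 2 ≤ metricForm S M x d)
    (hx : x ∈ X.carrier) : minEnergy X.carrier S M x x = 0 := by
  refine le_antisymm ?_ (minEnergy_nonneg hκ hκV)
  have hγ : IsCurve X.carrier (fun _ => x) x x := ⟨contDiffOn_const, fun _ _ => hx, rfl, rfl⟩
  refine (minEnergy_le hκ hκV hγ).trans_eq ?_
  simp [energy, metricForm]

end Energy

/-- The energy of the retraction of a curve. -/
theorem isCurve_retraction {O : Set (Vec n)} {ρ : Vec n → Vec n} (hρ : X.IsRetraction O ρ)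
    {c : ℝ → Vec n} (hc : ContDiffOn ℝ 1 c (Icc 0 1)) (hcO : ∀ s ∈ Icc (0 : ℝ) 1, c s ∈ O)
    (h0 : c 0 ∈ X.carrier) (h1 : c 1 ∈ X.carrier) :
    IsCurve X.carrier (fun s => ρ (c s)) (c 0) (c 1) where
  contDiffOn := fun s hs =>
    ((hρ.contDiffAt _ (hcO s hs)).of_le (by norm_cast)).comp_contDiffWithinAt s (hc s hs)
  mem := fun s hs => hρ.mem _ (hcO s hs)
  source := hρ.eq_self _ (hcO 0 ⟨le_rfl, zero_le_one⟩) h0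
  target := hρ.eq_self _ (hcO 1 ⟨zero_le_one, le_rfl⟩) h1

theorem energy_retraction {O : Set (Vec n)} {ρ : Vec n → Vec n} (hρ : X.IsRetraction O ρ)
    {c : ℝ → Vec n} (hc : ContDiffOn ℝ 1 c (Icc 0 1)) (hcO : ∀ s ∈ Icc (0 : ℝ) 1, c s ∈ O) :
    energy S M (fun s => ρ (c s))
      = ∫ s in (0 : ℝ)..1, pullbackForm S M ρ (c s, derivWithin c (Icc 0 1) s) := by
  refine intervalIntegral.integral_congr fun s hs => ?_
  rw [uIcc_of_le zero_le_one] at hs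
  have h1 := (((hρ.contDiffAt _ (hcO s hs)).differentiableAt
    two_ne_zero).hasFDerivAt.comp_hasDerivWithinAt s
      (hc.differentiableOn one_ne_zero s hs).hasDerivWithinAt).derivWithin
      (uniqueDiffOn_Icc zero_lt_one s hs)
  simp only [pullbackForm]
  rw [← h1]; rfl

/-- Integrated form of a pointwise bound on the perturbation of a curve. -/
theorem energy_perturbation_le (hS : X.IsFrame S) (hM : IsUniformMetric X M) {κ : ℝ} (hκ : 0 < κ)
    (hκV : ∀ x ∈ X.carrier, ∀ d ∈ X.tangent x, κ * ‖d‖ ^ 2 ≤ metricForm S M x d)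
    {O : Set (Vec n)} {ρ : Vec n → Vec n} (hρ : X.IsRetraction O ρ)
    (hγ : IsCurve X.carrier γ x y) {c : ℝ → Vec n} (hc : ContDiffOn ℝ 1 c (Icc 0 1))
    (hcO : ∀ s ∈ Icc (0 : ℝ) 1, c s ∈ O) (h0 : c 0 ∈ X.carrier) (h1 : c 1 ∈ X.carrier)
    {A B D : ℝ} (hD : 0 ≤ D)
    (hbound : ∀ s ∈ Icc (0 : ℝ) 1, pullbackForm S M ρ (c s, derivWithin c (Icc 0 1) s)
      ≤ A * metricForm S M (γ s) (derivWithin γ (Icc 0 1) s) + B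
        + D * (1 + ‖derivWithin γ (Icc 0 1) s‖ ^ 2)) :
    minEnergy X.carrier S M (c 0) (c 1)
      ≤ A * energy S M γ + B + D * (1 + energy S M γ / κ) := by
  have hγ' := isCurve_retraction hρ hc hcO h0 h1
  refine (minEnergy_le hκ hκV hγ').trans ?_
  have i1 := intervalIntegrable_of_continuousOn_unitInterval (hγ.continuousOn_metricForm hS hM)
  have i2 := intervalIntegrable_norm_sq_derivWithin hγ.contDiffOn
  have i3 : IntervalIntegrable (fun s => A * metricForm S M (γ s) (derivWithin γ (Icc 0 1) s) + B
      + D * (1 + ‖derivWithin γ (Icc 0 1) s‖ ^ 2)) volume 0 1 :=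
    ((i1.const_mul A).add intervalIntegrable_const).add
      ((intervalIntegrable_const.add i2).const_mul D)
  have i4 : IntervalIntegrable (fun s => pullbackForm S M ρ (c s, derivWithin c (Icc 0 1) s))
      volume 0 1 := by
    refine intervalIntegrable_of_continuousOn_unitInterval fun s hs => ?_
    exact ContinuousAt.comp_continuousWithinAt (g := pullbackForm S M ρ)
      (f := fun s => (c s, derivWithin c (Icc 0 1) s))
      (contDiffAt_pullbackForm (p := (c s, derivWithin c (Icc 0 1) s)) hS hM hρ
        (hcO s hs)).continuousAt
      ((hc.continuousOn s hs).prodMk (continuousOn_derivWithin_unitInterval hc s hs))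
  rw [energy_retraction hρ hc hcO]
  refine (intervalIntegral.integral_mono_on zero_le_one i4 i3 hbound).trans ?_
  rw [intervalIntegral.integral_add ((i1.const_mul A).add intervalIntegrable_const)
      ((intervalIntegrable_const.add i2).const_mul D),
    intervalIntegral.integral_add (i1.const_mul A) intervalIntegrable_const,
    intervalIntegral.integral_const_mul, intervalIntegral.integral_const_mul,
    intervalIntegral.integral_add intervalIntegrable_const i2]
  simp only [intervalIntegral.integral_const, sub_zero, one_smul]
  have := hγ.integral_norm_sq_le hS hM hκ hκV
  rw [energy]
  have := mul_le_mul_of_nonneg_left this hD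
  rw [energy] at this
  linarith

end Curves

/-! ### Joining points of the connected group by `C¹` curves -/

section Connectedness

variable {n q : ℕ} {X : EmbeddedLieGroup n q}

/-- `x` and `y` are joined by a `C¹` curve in `Z` which is constant outside `(0, 1)`. -/
def SmoothlyJoined (Z : Set (Vec n)) (x y : Vec n) : Prop :=
  ∃ γ : ℝ → Vec n, ContDiff ℝ 1 γ ∧ (∀ t, γ t ∈ Z) ∧ (∀ t ≤ 0, γ t = x) ∧ ∀ t ≥ 1, γ t = y

theorem SmoothlyJoined.symm {Z : Set (Vec n)} {x y : Vec n} (h : SmoothlyJoined Z x y) :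
    SmoothlyJoined Z y x := by
  obtain ⟨γ, h1, h2, h3, h4⟩ := h
  exact ⟨fun t => γ (1 - t), h1.comp (contDiff_const.sub contDiff_id), fun t => h2 _,
    fun t ht => h4 _ (by linarith), fun t ht => h3 _ (by linarith)⟩

/-- On each half of the unit interval one of the two summands is the constant `y`, so the sum minus
`y` concatenates the curves without any gluing argument. -/
theorem SmoothlyJoined.trans {Z : Set (Vec n)} {x y z : Vec n} (h : SmoothlyJoined Z x y)
    (h' : SmoothlyJoined Z y z) : SmoothlyJoined Z x z := by
  obtain ⟨γ, h1, h2, h3, h4⟩ := h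
  obtain ⟨δ, k1, k2, k3, k4⟩ := h'
  refine ⟨fun t => γ (2 * t) + δ (2 * t - 1) - y, ?_, fun t => ?_, fun t ht => ?_, fun t ht => ?_⟩
  · exact ((h1.comp (contDiff_const.mul contDiff_id)).add
      (k1.comp ((contDiff_const.mul contDiff_id).sub contDiff_const))).sub contDiff_const
  · rcases le_total t (1 / 2) with ht | ht
    · beta_reduce
      rw [k3 (2 * t - 1) (by linarith), add_sub_cancel_right]; exact h2 _
    · beta_reduce
      rw [h4 (2 * t) (by linarith), add_sub_cancel_left]; exact k2 _
  · beta_reduce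
    rw [k3 (2 * t - 1) (by linarith), add_sub_cancel_right]; exact h3 _ (by linarith)
  · beta_reduce
    rw [h4 (2 * t) (by linarith), add_sub_cancel_left]; exact k4 _ (by linarith)

/-- A straight segment in a small ball, traversed with a smooth transition in time, is retracted
onto `𝒳`. -/
theorem eventually_smoothlyJoined {x : Vec n} (hx : x ∈ X.carrier) :
    ∀ᶠ y in 𝓝[X.carrier] x, SmoothlyJoined X.carrier x y := by
  obtain ⟨O, ρ, hxO, hρ⟩ := X.exists_isRetraction (isCompact_singleton (x := x))
    (singleton_subset_iff.2 hx)
  obtain ⟨r, hr, hrO⟩ := Metric.isOpen_iff.1 hρ.isOpen x (hxO rfl)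
  filter_upwards [mem_nhdsWithin_of_mem_nhds (Metric.ball_mem_nhds x hr), self_mem_nhdsWithin]
    with y hy hyX
  have hxr := Metric.mem_ball_self (x := x) hr
  have hO : ∀ t : ℝ, x + t.smoothTransition • (y - x) ∈ O := fun t =>
    hrO ((convex_ball x r).add_smul_sub_mem hxr hy
      ⟨Real.smoothTransition.nonneg t, Real.smoothTransition.le_one t⟩)
  refine ⟨fun t => ρ (x + t.smoothTransition • (y - x)), ?_, fun t => hρ.mem _ (hO t),
    fun t ht => ?_, fun t ht => ?_⟩
  · refine contDiff_iff_contDiffAt.2 fun t => ?_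
    exact ContDiffAt.comp (g := ρ) t ((hρ.contDiffAt _ (hO t)).of_le (by norm_cast))
      (contDiffAt_const.add (Real.smoothTransition.contDiffAt.smul contDiffAt_const))
  · simp only [Real.smoothTransition.zero_of_nonpos ht, zero_smul, add_zero]
    exact hρ.eq_self _ (hxO rfl) hx
  · simp only [Real.smoothTransition.one_of_one_le ht, one_smul, add_sub_cancel]
    exact hρ.eq_self _ (hrO hy) hyX

theorem exists_isCurve (hX : IsConnected X.carrier) {x y : Vec n} (hx : x ∈ X.carrier)
    (hy : y ∈ X.carrier) : ∃ γ, IsCurve X.carrier γ x y := by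
  have h : SmoothlyJoined X.carrier x y := by
    refine hX.isPreconnected.induction₂ (SmoothlyJoined X.carrier)
      (fun z hz => eventually_smoothlyJoined hz) ?_ ?_ hx hy
    · exact fun a b c _ _ _ h h' => h.trans h'
    · exact fun a b _ _ h => h.symm
  obtain ⟨γ, h1, h2, h3, h4⟩ := h
  exact ⟨γ, h1.contDiffOn, fun s _ => h2 s, h3 0 le_rfl, h4 1 le_rfl⟩

end Connectedness

/-! ### Perturbation of the minimal energy -/

section MinEnergy

variable {n q : ℕ} {X : EmbeddedLieGroup n q} {S : Vec n → Matrix (Fin n) (Fin q) ℝ}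
  {M : Vec n → Matrix (Fin q) (Fin q) ℝ} {κ : ℝ}

theorem isCompact_carrier_inter_closedBall (X : EmbeddedLieGroup n q) (r : ℝ) :
    IsCompact (X.carrier ∩ Metric.closedBall 0 r) :=
  (isCompact_closedBall _ _).inter_left X.isClosed_carrier

/-- The compact set depends only on the bounds for the source and the energy. This makes the later
estimates uniform over curves. -/
theorem IsCurve.mem_inter_closedBall (hS : X.IsFrame S) (hM : IsUniformMetric X M) (hκ : 0 < κ)
    (hκV : ∀ x ∈ X.carrier, ∀ d ∈ X.tangent x, κ * ‖d‖ ^ 2 ≤ metricForm S M x d) {b R : ℝ}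
    {γ : ℝ → Vec n} {x y : Vec n} (hγ : IsCurve X.carrier γ x y) (hx : ‖x‖ ≤ b)
    (hR : energy S M γ ≤ R) {s : ℝ} (hs : s ∈ Icc (0 : ℝ) 1) :
    γ s ∈ X.carrier ∩ Metric.closedBall 0 (b + (1 + R / κ)) := by
  refine ⟨hγ.mem s hs, mem_closedBall_zero_iff.2 ?_⟩
  have h1 := hγ.norm_sub_source_le hS hM hκ hκV hs
  have h2 : energy S M γ / κ ≤ R / κ := by gcongr
  have h3 : ‖γ s‖ ≤ ‖x‖ + ‖γ s - x‖ := by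
    simpa using norm_add_le x (γ s - x)
  linarith

theorem hasDerivWithinAt_derivWithin_unitInterval {γ : ℝ → Vec n}
    (hγ : ContDiffOn ℝ 1 γ (Icc 0 1)) {s : ℝ} (hs : s ∈ Icc (0 : ℝ) 1) :
    HasDerivWithinAt γ (derivWithin γ (Icc 0 1) s) (Icc 0 1) s :=
  (hγ.differentiableOn one_ne_zero s hs).hasDerivWithinAt

theorem norm_convex_combination_le {E : Type*} [NormedAddCommGroup E] [NormedSpace ℝ E] (a b : E)
    {s : ℝ} (hs : s ∈ Icc (0 : ℝ) 1) : ‖(1 - s) • a + s • b‖ ≤ ‖a‖ + ‖b‖ := by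
  refine (norm_add_le _ _).trans ?_
  rw [norm_smul, norm_smul, Real.norm_of_nonneg hs.1, Real.norm_of_nonneg (by linarith [hs.2])]
  exact add_le_add (mul_le_of_le_one_left (norm_nonneg _) (by linarith [hs.1]))
    (mul_le_of_le_one_left (norm_nonneg _) hs.2)

theorem hasDerivAt_convex_combination {E : Type*} [NormedAddCommGroup E] [NormedSpace ℝ E]
    (a b : E) (s : ℝ) : HasDerivAt (fun s : ℝ => (1 - s) • a + s • b) (b - a) s := by
  have h1 : HasDerivAt (fun s : ℝ => (1 - s) • a) ((-1 : ℝ) • a) s :=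
    ((hasDerivAt_id s).const_sub 1).smul_const a
  have h2 : HasDerivAt (fun s : ℝ => s • b) ((1 : ℝ) • b) s := (hasDerivAt_id s).smul_const b
  refine (h1.add h2).congr_deriv ?_
  simp [sub_eq_neg_add]

theorem contDiff_convex_combination {E : Type*} [NormedAddCommGroup E] [NormedSpace ℝ E]
    (a b : E) : ContDiff ℝ 1 (fun s : ℝ => (1 - s) • a + s • b) := by
  fun_prop

/-- Moving the endpoints of a curve changes the minimal energy at most in proportion. -/
theorem minEnergy_le_energy_add (hS : X.IsFrame S) (hM : IsUniformMetric X M) (hκ : 0 < κ)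
    (hκV : ∀ x ∈ X.carrier, ∀ d ∈ X.tangent x, κ * ‖d‖ ^ 2 ≤ metricForm S M x d) (b : ℝ) {R : ℝ}
    (hR : 0 ≤ R) :
    ∃ L > 0, ∃ r > 0, ∀ (γ : ℝ → Vec n) (x y x' y' : Vec n), IsCurve X.carrier γ x y →
      energy S M γ ≤ R → ‖x‖ ≤ b → x' ∈ X.carrier → y' ∈ X.carrier → ‖x' - x‖ ≤ r →
      ‖y' - y‖ ≤ r →
      minEnergy X.carrier S M x' y' ≤ energy S M γ + L * (‖x' - x‖ + ‖y' - y‖) := by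
  set K := X.carrier ∩ Metric.closedBall 0 (b + (1 + R / κ)) with hKdef
  have hK : IsCompact K := isCompact_carrier_inter_closedBall X _
  obtain ⟨O, ρ, hKO, hρ⟩ := X.exists_isRetraction hK inter_subset_left
  obtain ⟨δ, hδ, hδO⟩ := hK.exists_cthickening_subset_open hρ.isOpen hKO
  obtain ⟨L, hL, r, hr, hLr⟩ := exists_lipschitz_perturbation (Ψ := pullbackForm S M ρ) hK
    (fun p hp => contDiffAt_pullbackForm hS hM hρ (hKO hp)) pullbackForm_smul
  -- The factor `2` accounts for the shifts of position and velocity, each at most `‖a‖ + ‖e‖`; `1 +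
  -- R/κ` bounds `∫ (1 + ‖γ'‖²)`. Halving `r` and `δ` leaves room for both endpoint displacements.
  refine ⟨2 * L * (1 + R / κ), by positivity, min (r / 2) (δ / 2), by positivity, ?_⟩
  intro γ x y x' y' hγ hE hx hx' hy' hxr hyr
  set a := x' - x with ha
  set e := y' - y with he
  have hsmall : ‖a‖ + ‖e‖ ≤ r ∧ ‖a‖ + ‖e‖ ≤ δ := by
    have h1 := le_min_iff.1 hxr
    have h2 := le_min_iff.1 hyr
    constructor <;> linarith [h1.1, h1.2, h2.1, h2.2]
  set c : ℝ → Vec n := fun s => γ s + ((1 - s) • a + s • e) with hc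
  have hK' : ∀ s ∈ Icc (0 : ℝ) 1, γ s ∈ K := fun s hs =>
    hγ.mem_inter_closedBall hS hM hκ hκV hx hE hs
  have hcC : ContDiffOn ℝ 1 c (Icc 0 1) := by
    exact hγ.contDiffOn.add (contDiff_convex_combination a e).contDiffOn
  have hcO : ∀ s ∈ Icc (0 : ℝ) 1, c s ∈ O := fun s hs => by
    refine hδO (Metric.mem_cthickening_of_dist_le _ (γ s) _ _ (hK' s hs) ?_)
    rw [dist_eq_norm, hc]
    simpa using (norm_convex_combination_le a e hs).trans hsmall.2
  have hc' : ∀ s ∈ Icc (0 : ℝ) 1, derivWithin c (Icc 0 1) s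
      = derivWithin γ (Icc 0 1) s + (e - a) := fun s hs => by
    refine HasDerivWithinAt.derivWithin ?_ (uniqueDiffOn_Icc zero_lt_one s hs)
    exact (hasDerivWithinAt_derivWithin_unitInterval hγ.contDiffOn hs).add
      (hasDerivAt_convex_combination a e s).hasDerivWithinAt
  have hc0 : c 0 = x' := by simp [hc, hγ.source, ha]
  have hc1 : c 1 = y' := by simp [hc, hγ.target, he]
  have hmain := energy_perturbation_le hS hM hκ hκV hρ hγ hcC hcO (by rwa [hc0]) (by rwa [hc1])
    (A := 1) (B := 0) (D := L * (2 * (‖a‖ + ‖e‖))) (by positivity) fun s hs => by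
      have h1 := norm_convex_combination_le a e hs
      have h2 : ‖e - a‖ ≤ ‖a‖ + ‖e‖ := (norm_sub_le _ _).trans_eq (add_comm _ _)
      have h3 := hLr (γ s) (hK' s hs) (derivWithin γ (Icc 0 1) s) ((1 - s) • a + s • e) (e - a)
        (h1.trans hsmall.1) (h2.trans hsmall.1)
      rw [pullbackForm_eq hρ (hKO (hK' s hs)) (hγ.mem s hs) (hγ.derivWithin_mem_tangent hs)] at h3
      rw [hc' s hs, one_mul, add_zero]
      refine h3.trans ?_
      gcongr
      linarith
  rw [hc0, hc1] at hmain
  refine hmain.trans ?_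
  have h4 : energy S M γ / κ ≤ R / κ := by gcongr
  have h5 : L * (2 * (‖a‖ + ‖e‖)) * (1 + energy S M γ / κ)
      ≤ L * (2 * (‖a‖ + ‖e‖)) * (1 + R / κ) := by gcongr
  linarith

/-- One Euler step along the fields `F₀ + s F₁`, where `F₀` acts at the source and `F₀ + F₁` at the
target, dissipates energy up to first order, uniformly over curves of bounded energy. -/
theorem minEnergy_euler_step (hS : X.IsFrame S) (hM : IsUniformMetric X M) (hκ : 0 < κ)
    (hκV : ∀ x ∈ X.carrier, ∀ d ∈ X.tangent x, κ * ‖d‖ ^ 2 ≤ metricForm S M x d) (b : ℝ) {R : ℝ}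
    (hR : 0 ≤ R) {F₀ F₁ : Vec n → Vec n} (hF₀ : ∀ y ∈ X.carrier, ContDiffAt ℝ 1 F₀ y)
    (hF₁ : ∀ y ∈ X.carrier, ContDiffAt ℝ 1 F₁ y) (hF₀t : ∀ y ∈ X.carrier, F₀ y ∈ X.tangent y)
    (hF₁t : ∀ y ∈ X.carrier, F₁ y ∈ X.tangent y) {a c : ℝ}
    (hdiss : ∀ y ∈ X.carrier, ∀ s : ℝ, ∀ d ∈ X.tangent y, ∀ σ : ℝ,
      2 * (((proj S y)ᵀ *ᵥ d) ⬝ᵥ (M y *ᵥ (matDeriv (fun x => (proj S x)ᵀ) y (F₀ y + s • F₁ y) *ᵥ d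
          + (proj S y)ᵀ *ᵥ (fderiv ℝ (fun y => F₀ y + s • F₁ y) y d + σ • F₁ y))))
        + ((proj S y)ᵀ *ᵥ d) ⬝ᵥ (matDeriv M y (F₀ y + s • F₁ y) *ᵥ ((proj S y)ᵀ *ᵥ d))
      ≤ -a * metricForm S M y d + c * σ ^ 2) {ε : ℝ} (hε : 0 < ε) :
    ∃ r > 0, ∀ h : ℝ, 0 < h → h ≤ r → ∀ (γ : ℝ → Vec n) (x y x' y' : Vec n),
      IsCurve X.carrier γ x y → energy S M γ ≤ R → ‖x‖ ≤ b → x' ∈ X.carrier → y' ∈ X.carrier →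
      ‖x' - x - h • F₀ x‖ ≤ r * h → ‖y' - y - h • (F₀ y + F₁ y)‖ ≤ r * h →
      minEnergy X.carrier S M x' y' ≤ (1 - a * h) * energy S M γ + c * h + ε * h := by
  set K := X.carrier ∩ Metric.closedBall 0 (b + (1 + R / κ)) with hKdef
  have hK : IsCompact K := isCompact_carrier_inter_closedBall X _
  obtain ⟨O, ρ, hKO, hρ⟩ := X.exists_isRetraction hK inter_subset_left
  obtain ⟨δ, hδ, hδO⟩ := hK.exists_cthickening_subset_open hρ.isOpen hKO
  have hfd : ∀ y ∈ X.carrier, ∀ (s : ℝ) (d : Vec n), fderiv ℝ (fun y => F₀ y + s • F₁ y) y d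
      = fderiv ℝ F₀ y d + s • fderiv ℝ F₁ y d := fun y hy s d => by
    have h := ((hF₀ y hy).differentiableAt one_ne_zero).hasFDerivAt.add
      (((hF₁ y hy).differentiableAt one_ne_zero).hasFDerivAt.const_smul s)
    have h' : HasFDerivAt (fun y => F₀ y + s • F₁ y) (fderiv ℝ F₀ y + s • fderiv ℝ F₁ y) y := h
    rw [h'.fderiv]; rfl
  obtain ⟨r, hr, hstep⟩ := exists_euler_step_dissipation (Ψ := pullbackForm S M ρ) hK
    (fun p hp => contDiffAt_pullbackForm hS hM hρ (hKO hp)) pullbackForm_smul X.tangent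
    (F₀ := F₀) (F₁ := F₁) (fun y hy => hF₀ y hy.1) (fun y hy => hF₁ y hy.1) (a := a) (c := c)
    (fun y hy s hs d hd σ => by
      have hyX := hy.1
      have h1 := fderiv_pullbackForm hS hM hρ (F := fun y => F₀ y + s • F₁ y) (b := σ • F₁ y)
        (fun z hz => Submodule.add_mem _ (hF₀t z hz) (Submodule.smul_mem _ s (hF₁t z hz)))
        (hKO hy) hyX (((hF₀ y hyX).add ((hF₁ y hyX).const_smul s)).differentiableAt
          one_ne_zero) hd (Submodule.smul_mem _ σ (hF₁t y hyX))
      have h2 := hdiss y hyX s d hd σ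
      rw [← h1, hfd y hyX] at h2
      rwa [pullbackForm_eq hρ (hKO hy) hyX hd])
    -- Integrating the factor `1 + ‖γ'‖²` over a curve of energy at most `R` turns this pointwise
    -- tolerance into `ε h`.
    (ε := ε / (1 + R / κ)) (by positivity)
  obtain ⟨B₀, hB₀⟩ := hK.exists_bound_of_continuousOn (f := F₀)
    fun y hy => (hF₀ y hy.1).continuousAt.continuousWithinAt
  obtain ⟨B₁, hB₁⟩ := hK.exists_bound_of_continuousOn (f := F₁)
    fun y hy => (hF₁ y hy.1).continuousAt.continuousWithinAt
  -- The last bound keeps the moved curve within `δ` of `K`: the Euler step contributes at most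
  -- `r'(|B₀| + |B₁|)`, the two remainders at most `2r'`.
  refine ⟨min (min 1 r) (δ / (|B₀| + |B₁| + 2)), by positivity, ?_⟩
  intro h hh hhr γ x y x' y' hγ hE hx hx' hy' hxr hyr
  set r' := min (min 1 r) (δ / (|B₀| + |B₁| + 2)) with hr'
  have hr'0 : 0 < r' := by positivity
  have hr'1 : r' ≤ 1 := (min_le_left _ _).trans (min_le_left _ _)
  have hr'r : r' ≤ r := (min_le_left _ _).trans (min_le_right _ _)
  have hr'δ : r' * (|B₀| + |B₁| + 2) ≤ δ := by
    rw [← le_div_iff₀ (by positivity)]; exact min_le_right _ _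
  set R₀ := x' - x - h • F₀ x with hR₀
  set R₁ := y' - y - h • (F₀ y + F₁ y) with hR₁
  have hR₀r : ‖R₀‖ ≤ r * h := hxr.trans (by gcongr)
  have hR₁r : ‖R₁‖ ≤ r * h := hyr.trans (by gcongr)
  -- Interpolating the remainders linearly makes the endpoints exactly `x'` and `y'`, which lie on
  -- `𝒳` and are therefore fixed by the retraction.
  set c' : ℝ → Vec n := fun s => γ s + (h • (F₀ (γ s) + s • F₁ (γ s)) + ((1 - s) • R₀ + s • R₁))
    with hc
  have hK' : ∀ s ∈ Icc (0 : ℝ) 1, γ s ∈ K := fun s hs =>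
    hγ.mem_inter_closedBall hS hM hκ hκV hx hE hs
  have hcC : ContDiffOn ℝ 1 c' (Icc 0 1) := by
    intro s hs
    have g := hγ.contDiffOn s hs
    have f0 : ContDiffWithinAt ℝ 1 (fun s => F₀ (γ s)) (Icc 0 1) s :=
      (hF₀ _ (hγ.mem s hs)).comp_contDiffWithinAt s g
    have f1 : ContDiffWithinAt ℝ 1 (fun s => F₁ (γ s)) (Icc 0 1) s :=
      (hF₁ _ (hγ.mem s hs)).comp_contDiffWithinAt s g
    have f2 : ContDiffWithinAt ℝ 1 (fun s => s • F₁ (γ s)) (Icc 0 1) s :=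
      contDiffWithinAt_id.smul f1
    have f3 : ContDiffWithinAt ℝ 1 (fun s => h • (F₀ (γ s) + s • F₁ (γ s))) (Icc 0 1) s :=
      (f0.add f2).const_smul h
    exact g.add (f3.add (contDiff_convex_combination R₀ R₁).contDiffWithinAt)
  have hcO : ∀ s ∈ Icc (0 : ℝ) 1, c' s ∈ O := fun s hs => by
    refine hδO (Metric.mem_cthickening_of_dist_le _ (γ s) _ _ (hK' s hs) ?_)
    have e1 : dist (c' s) (γ s) = ‖h • (F₀ (γ s) + s • F₁ (γ s)) + ((1 - s) • R₀ + s • R₁)‖ := by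
      rw [dist_eq_norm, hc]; simp
    have e2 : ‖F₀ (γ s) + s • F₁ (γ s)‖ ≤ |B₀| + |B₁| := by
      refine (norm_add_le _ _).trans (add_le_add ((hB₀ _ (hK' s hs)).trans (le_abs_self _)) ?_)
      rw [norm_smul, Real.norm_of_nonneg hs.1]
      exact (mul_le_of_le_one_left (norm_nonneg _) hs.2).trans
        ((hB₁ _ (hK' s hs)).trans (le_abs_self _))
    have e3 := norm_convex_combination_le R₀ R₁ hs
    rw [e1]
    refine (norm_add_le _ _).trans ?_
    rw [norm_smul, Real.norm_of_nonneg hh.le]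
    have e4 : h * ‖F₀ (γ s) + s • F₁ (γ s)‖ ≤ r' * (|B₀| + |B₁|) := by gcongr
    have e5 : r' * h ≤ 1 * r' := by gcongr
    linarith
  -- Differentiating the factor `s` produces the extra `F₁`. It is the variation of the disturbance
  -- along the curve and the source of the term `c h`.
  have hc' : ∀ s ∈ Icc (0 : ℝ) 1, derivWithin c' (Icc 0 1) s
      = derivWithin γ (Icc 0 1) s + (h • (fderiv ℝ F₀ (γ s) (derivWithin γ (Icc 0 1) s)
        + s • fderiv ℝ F₁ (γ s) (derivWithin γ (Icc 0 1) s) + F₁ (γ s)) + (R₁ - R₀)) :=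
    fun s hs => by
    refine HasDerivWithinAt.derivWithin ?_ (uniqueDiffOn_Icc zero_lt_one s hs)
    have g := hasDerivWithinAt_derivWithin_unitInterval hγ.contDiffOn hs
    have f0 : HasDerivWithinAt (fun s => F₀ (γ s))
        (fderiv ℝ F₀ (γ s) (derivWithin γ (Icc 0 1) s)) (Icc 0 1) s :=
      ((hF₀ _ (hγ.mem s hs)).differentiableAt one_ne_zero).hasFDerivAt.comp_hasDerivWithinAt s g
    have f1 : HasDerivWithinAt (fun s => F₁ (γ s))
        (fderiv ℝ F₁ (γ s) (derivWithin γ (Icc 0 1) s)) (Icc 0 1) s :=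
      ((hF₁ _ (hγ.mem s hs)).differentiableAt one_ne_zero).hasFDerivAt.comp_hasDerivWithinAt s g
    have f2 : HasDerivWithinAt (fun s => s • F₁ (γ s))
        (s • fderiv ℝ F₁ (γ s) (derivWithin γ (Icc 0 1) s) + (1 : ℝ) • F₁ (γ s)) (Icc 0 1) s :=
      (hasDerivWithinAt_id s (Icc 0 1)).smul f1
    have f3 : HasDerivWithinAt (fun s => h • (F₀ (γ s) + s • F₁ (γ s)))
        (h • (fderiv ℝ F₀ (γ s) (derivWithin γ (Icc 0 1) s)
          + (s • fderiv ℝ F₁ (γ s) (derivWithin γ (Icc 0 1) s) + (1 : ℝ) • F₁ (γ s))))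
        (Icc 0 1) s := (f0.add f2).const_smul h
    rw [one_smul, ← add_assoc] at f3
    exact g.add (f3.add (hasDerivAt_convex_combination R₀ R₁ s).hasDerivWithinAt)
  have hc0 : c' 0 = x' := by simp [hc, hγ.source, hR₀]
  have hc1 : c' 1 = y' := by simp [hc, hγ.target, hR₁]
  have hmain := energy_perturbation_le hS hM hκ hκV hρ hγ hcC hcO (by rwa [hc0]) (by rwa [hc1])
    (A := 1 - a * h) (B := c * h) (D := ε / (1 + R / κ) * h) (by positivity) fun s hs => by
      have h3 := hstep h hh (hhr.trans hr'r) R₀ R₁ hR₀r hR₁r (γ s) (hK' s hs) s hs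
        (derivWithin γ (Icc 0 1) s) (hγ.derivWithin_mem_tangent hs)
      rw [pullbackForm_eq hρ (hKO (hK' s hs)) (hγ.mem s hs) (hγ.derivWithin_mem_tangent hs)] at h3
      rw [hc' s hs]
      exact h3
  rw [hc0, hc1] at hmain
  refine hmain.trans ?_
  have h5 : ε / (1 + R / κ) * h * (1 + energy S M γ / κ) ≤ ε / (1 + R / κ) * h * (1 + R / κ) := by
    gcongr
  have h6 : ε / (1 + R / κ) * h * (1 + R / κ) = ε * h := by field_simp
  linarith

/-- Connectedness makes the set of energies nonempty, so the infimum is genuine and not the default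
`sInf ∅ = 0`. Near-minimisers take the place of geodesics. -/
theorem exists_energy_lt (hX : IsConnected X.carrier) {x y : Vec n} (hx : x ∈ X.carrier)
    (hy : y ∈ X.carrier) {η : ℝ} (hη : 0 < η) :
    ∃ γ, IsCurve X.carrier γ x y ∧ energy S M γ < minEnergy X.carrier S M x y + η := by
  obtain ⟨γ₀, hγ₀⟩ := exists_isCurve hX hx hy
  obtain ⟨_, ⟨γ, hγ, rfl⟩, hlt⟩ := exists_lt_of_csInf_lt
    (s := energy S M '' {γ | IsCurve X.carrier γ x y}) ⟨_, ⟨γ₀, hγ₀, rfl⟩⟩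
    (lt_add_of_pos_right _ hη)
  exact ⟨γ, hγ, hlt⟩

end MinEnergy

/-! ### Absolute continuity and Grönwall's inequality -/

section AbsolutelyContinuous

theorem absolutelyContinuousOnInterval_of_dist_le {E F : Type*} [PseudoMetricSpace E]
    [PseudoMetricSpace F] {f : ℝ → E} {g : ℝ → F} {φ : ℝ → ℝ} {a b L : ℝ}
    (hf : AbsolutelyContinuousOnInterval f a b) (hg : AbsolutelyContinuousOnInterval g a b)
    (h : ∀ s ∈ uIcc a b, ∀ t ∈ uIcc a b,
      dist (φ s) (φ t) ≤ L * (dist (f s) (f t) + dist (g s) (g t))) :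
    AbsolutelyContinuousOnInterval φ a b := by
  have hsum := (Filter.Tendsto.add hf hg).const_mul L
  rw [add_zero, mul_zero] at hsum
  refine squeeze_zero' (Eventually.of_forall fun E => Finset.sum_nonneg fun _ _ => dist_nonneg)
    ?_ hsum
  have hmem : ∀ᶠ E in AbsolutelyContinuousOnInterval.totalLengthFilter ⊓
      𝓟 (AbsolutelyContinuousOnInterval.disjWithin a b),
      E ∈ AbsolutelyContinuousOnInterval.disjWithin a b :=
    mem_inf_of_right (mem_principal_self _)
  filter_upwards [hmem] with E hE
  rw [← Finset.sum_add_distrib, Finset.mul_sum]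
  exact Finset.sum_le_sum fun i hi => h _ (hE.1 i hi).1 _ (hE.1 i hi).2

/-- Grönwall's inequality for absolutely continuous functions. -/
theorem gronwall_of_absolutelyContinuous {φ : ℝ → ℝ} {t₀ t a c : ℝ} (ha : 0 < a) (ht : t₀ ≤ t)
    (hφ : AbsolutelyContinuousOnInterval φ t₀ t)
    (hd : ∀ᵐ s : ℝ, s ∈ Ioo t₀ t → DifferentiableAt ℝ φ s → deriv φ s ≤ -a * φ s + c) :
    φ t ≤ Real.exp (-a * (t - t₀)) * φ t₀ + c / a * (1 - Real.exp (-a * (t - t₀))) := by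
  have hexp : AbsolutelyContinuousOnInterval (fun s => Real.exp (a * s)) t₀ t :=
    ContDiffOn.absolutelyContinuousOnInterval (by fun_prop)
  have hconst : AbsolutelyContinuousOnInterval (fun _ : ℝ => c / a) t₀ t :=
    ContDiffOn.absolutelyContinuousOnInterval (by fun_prop)
  -- The integrating factor turns the inequality into a nonpositive derivative almost everywhere;
  -- absolute continuity allows it to be integrated.
  have hψ : AbsolutelyContinuousOnInterval (fun s => Real.exp (a * s) * (φ s - c / a)) t₀ t :=
    hexp.mul (hφ.sub hconst)
  have hle : ∫ s in t₀..t, deriv (fun s => Real.exp (a * s) * (φ s - c / a)) s ≤ 0 := by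
    have h0 : ∫ s in t₀..t, (0 : ℝ) = 0 := by simp
    rw [← h0]
    refine intervalIntegral.integral_mono_ae_restrict ht hψ.intervalIntegrable_deriv
      intervalIntegrable_const ?_
    rw [← restrict_Ioo_eq_restrict_Icc, EventuallyLE, ae_restrict_iff' measurableSet_Ioo]
    filter_upwards [hd, hφ.ae_differentiableAt] with s hs1 hs2 hs
    have hdiff := hs2 (by rw [uIcc_of_le ht]; exact Ioo_subset_Icc_self hs)
    have h1 : HasDerivAt (fun s => Real.exp (a * s)) (Real.exp (a * s) * a) s := by
      simpa using ((hasDerivAt_id s).const_mul a).exp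
    have h2 : HasDerivAt (fun s => Real.exp (a * s) * (φ s - c / a))
        (Real.exp (a * s) * a * (φ s - c / a) + Real.exp (a * s) * deriv φ s) s :=
      h1.mul (hdiff.hasDerivAt.sub_const _)
    rw [h2.deriv]
    have h3 := mul_le_mul_of_nonneg_left (hs1 hs hdiff) (Real.exp_pos (a * s)).le
    have h4 : Real.exp (a * s) * a * (φ s - c / a) + Real.exp (a * s) * (-a * φ s + c) = 0 := by
      field_simp; ring
    linarith
  rw [hψ.integral_deriv_eq_sub] at hle
  have h5 : Real.exp (-a * (t - t₀)) = Real.exp (a * t₀) / Real.exp (a * t) := by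
    rw [← Real.exp_sub]; ring_nf
  rw [h5]
  have hp := Real.exp_pos (a * t)
  have h6 : φ t - c / a ≤ Real.exp (a * t₀) / Real.exp (a * t) * (φ t₀ - c / a) := by
    rw [div_mul_eq_mul_div, le_div_iff₀ hp]; linarith
  linarith

end AbsolutelyContinuous

/-! ### The minimal energy along pairs of solutions -/

section Trajectories

variable {n q m p l : ℕ} {X : EmbeddedLieGroup n q} {sys : ControlSystem X m p l}
  {S : Vec n → Matrix (Fin n) (Fin q) ℝ} {M : Vec n → Matrix (Fin q) (Fin q) ℝ} {κ : ℝ}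
  {k : Vec n → Vec n → Vec m}

/-- The minimal energy along a pair of continuous curves is bounded on compact time intervals. -/
theorem exists_minEnergy_bound (hX : IsConnected X.carrier) (hS : X.IsFrame S)
    (hM : IsUniformMetric X M) (hκ : 0 < κ)
    (hκV : ∀ x ∈ X.carrier, ∀ d ∈ X.tangent x, κ * ‖d‖ ^ 2 ≤ metricForm S M x d)
    {I : Set ℝ} (hI : IsCompact I) {x y : ℝ → Vec n} (hx : ContinuousOn x I)
    (hy : ContinuousOn y I) (hxX : ∀ t ∈ I, x t ∈ X.carrier) (hyX : ∀ t ∈ I, y t ∈ X.carrier) :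
    ∃ R, 0 ≤ R ∧ ∀ t ∈ I, minEnergy X.carrier S M (x t) (y t) ≤ R := by
  -- Near each time, moving the endpoints of one fixed curve gives a local bound; compactness
  -- combines the local bounds without appeal to continuity of the minimal energy.
  refine hI.induction_on (p := fun J => ∃ R, 0 ≤ R ∧ ∀ t ∈ J,
    minEnergy X.carrier S M (x t) (y t) ≤ R) ⟨0, le_rfl, by simp⟩
    (fun J J' hJ ⟨R, h0, h⟩ => ⟨R, h0, fun t ht => h t (hJ ht)⟩)
    (fun J J' ⟨R, h0, h⟩ ⟨R', h0', h'⟩ => ⟨max R R', h0.trans (le_max_left _ _), fun t ht =>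
      ht.elim (fun ht => (h t ht).trans (le_max_left _ _))
        fun ht => (h' t ht).trans (le_max_right _ _)⟩) fun t ht => ?_
  obtain ⟨γ, hγ⟩ := exists_isCurve hX (hxX t ht) (hyX t ht)
  have hE := hγ.energy_nonneg hκ hκV
  obtain ⟨L, hL, r, hr, h⟩ := minEnergy_le_energy_add hS hM hκ hκV ‖x t‖ hE
  refine ⟨_, inter_mem (inter_mem (hx t ht (Metric.closedBall_mem_nhds _ hr))
    (hy t ht (Metric.closedBall_mem_nhds _ hr))) self_mem_nhdsWithin,
    energy S M γ + L * (r + r), by positivity, ?_⟩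
  rintro s ⟨⟨hs1, hs2⟩, hsI⟩
  have hs1 : ‖x s - x t‖ ≤ r := by simpa [dist_eq_norm] using hs1
  have hs2 : ‖y s - y t‖ ≤ r := by simpa [dist_eq_norm] using hs2
  refine (h γ _ _ _ _ hγ le_rfl le_rfl (hxX s hsI) (hyX s hsI) hs1 hs2).trans ?_
  gcongr

/-- The minimal energy along a pair of absolutely continuous curves is absolutely continuous. -/
theorem absolutelyContinuous_minEnergy (hX : IsConnected X.carrier) (hS : X.IsFrame S)
    (hM : IsUniformMetric X M) (hκ : 0 < κ)
    (hκV : ∀ x ∈ X.carrier, ∀ d ∈ X.tangent x, κ * ‖d‖ ^ 2 ≤ metricForm S M x d)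
    {a b : ℝ} {x y : ℝ → Vec n} (hx : AbsolutelyContinuousOnInterval x a b)
    (hy : AbsolutelyContinuousOnInterval y a b) (hxX : ∀ t ∈ uIcc a b, x t ∈ X.carrier)
    (hyX : ∀ t ∈ uIcc a b, y t ∈ X.carrier) :
    AbsolutelyContinuousOnInterval (fun t => minEnergy X.carrier S M (x t) (y t)) a b := by
  obtain ⟨R, hR, hRφ⟩ := exists_minEnergy_bound hX hS hM hκ hκV isCompact_uIcc hx.continuousOn
    hy.continuousOn hxX hyX
  obtain ⟨ρ, hρ⟩ := hx.exists_bound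
  obtain ⟨L, hL, r, hr, h⟩ := minEnergy_le_energy_add hS hM hκ hκV ρ (R := R + 1) (by positivity)
  -- For small displacements `L` comes from moving the endpoints of a near-minimiser, of energy at
  -- most `R + 1`. For displacements beyond `r` the global bound `R` suffices, whence the constant
  -- `R / r`.
  have key : ∀ s ∈ uIcc a b, ∀ t ∈ uIcc a b,
      minEnergy X.carrier S M (x s) (y s) ≤ minEnergy X.carrier S M (x t) (y t)
        + max L (R / r) * (dist (x s) (x t) + dist (y s) (y t)) := by
    intro s hs t ht
    have hnn : 0 ≤ minEnergy X.carrier S M (x t) (y t) := minEnergy_nonneg hκ hκV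
    by_cases hst : dist (x s) (x t) ≤ r ∧ dist (y s) (y t) ≤ r
    · refine le_of_forall_pos_le_add fun η hη => ?_
      obtain ⟨γ, hγ, hlt⟩ := exists_energy_lt (S := S) (M := M) hX (hxX t ht) (hyX t ht)
        (lt_min hη one_pos)
      have h1 := h γ _ _ (x s) (y s) hγ
        (by linarith [hRφ t ht, min_le_right η 1]) (hρ t ht) (hxX s hs) (hyX s hs)
        (by rw [← dist_eq_norm]; exact hst.1) (by rw [← dist_eq_norm]; exact hst.2)
      rw [← dist_eq_norm, ← dist_eq_norm] at h1
      have h2 : L * (dist (x s) (x t) + dist (y s) (y t))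
          ≤ max L (R / r) * (dist (x s) (x t) + dist (y s) (y t)) := by
        gcongr; exact le_max_left _ _
      linarith [min_le_left η 1]
    · have h1 : r ≤ dist (x s) (x t) + dist (y s) (y t) := by
        rw [not_and_or, not_le, not_le] at hst
        have := dist_nonneg (x := x s) (y := x t)
        have := dist_nonneg (x := y s) (y := y t)
        rcases hst with h | h <;> linarith
      have h2 : R ≤ max L (R / r) * (dist (x s) (x t) + dist (y s) (y t)) :=
        calc R = R / r * r := by field_simp
          _ ≤ _ := by gcongr; exact le_max_right _ _
      linarith [hRφ s hs]
  refine absolutelyContinuousOnInterval_of_dist_le hx hy (L := max L (R / r)) fun s hs t ht => ?_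
  have h1 := key s hs t ht
  have h2 := key t ht s hs
  rw [dist_comm (x t), dist_comm (y t)] at h2
  rw [Real.dist_eq, abs_le]
  constructor <;> linarith

/-- An upper bound for the growth of a function bounds its derivative. -/
theorem deriv_le_of_forall_eventually {φ : ℝ → ℝ} {t A : ℝ} (hφ : DifferentiableAt ℝ φ t)
    (h : ∀ ε > 0, ∀ᶠ h in 𝓝[>] (0 : ℝ), φ (t + h) ≤ φ t + h * A + ε * h) : deriv φ t ≤ A := by
  refine le_of_forall_pos_le_add fun ε hε => ?_
  have h1 := hφ.hasDerivAt.tendsto_slope_zero_right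
  refine le_of_tendsto h1 ?_
  filter_upwards [h ε hε, self_mem_nhdsWithin] with s hs hs0
  rw [smul_eq_mul, inv_mul_le_iff₀ hs0]
  linarith

theorem HasDerivAt.eventually_norm_sub_le {E : Type*} [NormedAddCommGroup E] [NormedSpace ℝ E]
    {x : ℝ → E} {x' : E} {t : ℝ} (hx : HasDerivAt x x' t) {r : ℝ} (hr : 0 < r) :
    ∀ᶠ h in 𝓝[>] (0 : ℝ), ‖x (t + h) - x t - h • x'‖ ≤ r * h := by
  have h1 := (hasDerivAt_iff_isLittleO_nhds_zero.1 hx).def hr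
  filter_upwards [nhdsWithin_le_nhds h1, self_mem_nhdsWithin] with s hs hs0
  rwa [Real.norm_of_nonneg (le_of_lt hs0)] at hs

theorem ControlSystem.rhs_add_smul (sys : ControlSystem X m p l) (x : Vec n) (u : Vec m)
    (w e : Vec p) (s : ℝ) :
    sys.rhs x u (w + s • e) = sys.rhs x u w + s • (sys.Bw x *ᵥ e) := by
  simp only [ControlSystem.rhs, Matrix.mulVec_add, Matrix.mulVec_smul]
  abel

namespace ClosedLoopPair

variable {lam mu : ℝ}

/-- The differential inequality for the minimal energy along a pair of solutions. -/
theorem deriv_minEnergy_le (hX : IsConnected X.carrier) (hS : X.IsFrame S) (hk : IsFeedback X k)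
    (hM : IsUniformMetric X M) (hκ : 0 < κ)
    (hκV : ∀ x ∈ X.carrier, ∀ d ∈ X.tangent x, κ * ‖d‖ ^ 2 ≤ metricForm S M x d)
    (hlam : 0 < lam)
    (hR1 : ∀ x ∈ X.carrier, ∀ xs ∈ X.carrier, ∀ (us : Vec m) (w : Vec p),
    (-(sys.R1 S k M lam mu x xs us w)).PosSemidef)
    (c : ClosedLoopPair sys k) {t : ℝ} (ht : 0 < t)
    (hxs : HasDerivAt c.xs (sys.rhs (c.xs t) (c.us t) (c.ws t)) t)
    (hx : HasDerivAt c.x (sys.rhs (c.x t) (k (c.x t) (c.xs t) + c.us t) (c.w t)) t)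
    (hφ : DifferentiableAt ℝ (fun t => minEnergy X.carrier S M (c.x t) (c.xs t)) t) :
    deriv (fun t => minEnergy X.carrier S M (c.x t) (c.xs t)) t
      ≤ -(2 * lam) * minEnergy X.carrier S M (c.x t) (c.xs t)
        + mu * ((c.w t - c.ws t) ⬝ᵥ (c.w t - c.ws t)) := by
  have hxsX := c.nominal.mem t ht.le
  have hxX := c.closedLoop.mem t ht.le
  -- Curves run from `x` at `s = 0` to `x*` at `s = 1`, so `w + s e` interpolates from `w` to `w*`.
  set e := c.ws t - c.w t with he
  have hee : (c.w t - c.ws t) ⬝ᵥ (c.w t - c.ws t) = e ⬝ᵥ e := by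
    rw [← neg_sub (c.ws t), neg_dotProduct_neg]
  rw [hee]
  -- The nominal state and all inputs are frozen at time `t`. At the target `x*` the feedback
  -- vanishes, so `F₀ + F₁` is the nominal velocity there.
  set F₀ : Vec n → Vec n := fun y => sys.rhs y (k y (c.xs t) + c.us t) (c.w t) with hF₀
  set F₁ : Vec n → Vec n := fun y => sys.Bw y *ᵥ e with hF₁
  have hFs : ∀ (y : Vec n) (s : ℝ), F₀ y + s • F₁ y
      = sys.rhs y (k y (c.xs t) + c.us t) (c.w t + s • e) := fun y s =>
    (sys.rhs_add_smul y _ _ e s).symm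
  have htgt : F₀ (c.xs t) + F₁ (c.xs t) = sys.rhs (c.xs t) (c.us t) (c.ws t) := by
    have := hFs (c.xs t) 1
    rw [one_smul, one_smul] at this
    rw [this, he, add_sub_cancel, hk.diag _ hxsX, zero_add]
  set φ₀ := minEnergy X.carrier S M (c.x t) (c.xs t) with hφ₀
  have hφ₀nn : 0 ≤ φ₀ := minEnergy_nonneg hκ hκV
  refine deriv_le_of_forall_eventually hφ fun ε hε => ?_
  obtain ⟨r, hr, hstep⟩ := minEnergy_euler_step (F₀ := F₀) (F₁ := F₁) (a := 2 * lam)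
    (c := mu * (e ⬝ᵥ e)) hS hM hκ hκV ‖c.x t‖ (R := φ₀ + 1) (by positivity)
    (fun y hy => sys.contDiffAt_rhs hk (X.mem_dom hy) hxsX _ _)
    (fun y hy => sys.contDiffAt_Bw_mulVec (X.mem_dom hy) _)
    (fun y hy => sys.rhs_mem_tangent hy _ _) (fun y hy => sys.Bw_mulVec_mem_tangent hy _)
    (fun y hy s d hd σ => by
      have h1 := sys.metricForm_dissipation hS hk hM hy hxsX
        (hR1 y hy _ hxsX (c.us t) (c.w t + s • e)) hd (σ • e) (hFs y s)
        (F' := fderiv ℝ (fun y => F₀ y + s • F₁ y) y d + σ • F₁ y) (by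
          rw [Matrix.mulVec_smul, ← funext fun y => hFs y s])
      refine h1.trans_eq ?_
      rw [smul_dotProduct, dotProduct_smul, smul_eq_mul, smul_eq_mul]
      ring) hε
  -- The bound `h ≤ 1/(2λ)` keeps `1 - 2λh` nonnegative, so an upper bound on the energy of the
  -- curve may be multiplied by it.
  have hsmall : ∀ᶠ h in 𝓝[>] (0 : ℝ), h ≤ min r (1 / (2 * lam)) :=
    nhdsWithin_le_nhds (Iic_mem_nhds (by positivity))
  filter_upwards [HasDerivAt.eventually_norm_sub_le hxs hr,
    HasDerivAt.eventually_norm_sub_le hx hr, hsmall, self_mem_nhdsWithin] with h h1 h2 h3 h4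
  have hh : 0 < h := h4
  have hlh : 2 * lam * h ≤ 1 := by
    have := h3.trans (min_le_right _ _)
    rw [le_div_iff₀ (by positivity)] at this
    linarith
  have hnn : 0 ≤ 2 * lam * h := by positivity
  have hth : 0 ≤ t + h := by positivity
  -- The slack `η` is independent of `h` and removed at fixed `h`. The curve may thus depend on `h`,
  -- as uniformity of the Euler estimate permits.
  refine le_of_forall_pos_le_add fun η hη => ?_
  obtain ⟨γ, hγ, hlt⟩ := exists_energy_lt (S := S) (M := M) hX hxX hxsX (lt_min hη one_pos)
  have h5 := hstep h hh (h3.trans (min_le_left _ _)) γ _ _ _ _ hγ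
    (by linarith [min_le_right η 1]) le_rfl (c.closedLoop.mem _ hth) (c.nominal.mem _ hth)
    h2 (by rw [htgt]; exact h1)
  have h6 : (1 - 2 * lam * h) * energy S M γ ≤ (1 - 2 * lam * h) * (φ₀ + η) :=
    mul_le_mul_of_nonneg_left (by linarith [min_le_left η 1]) (by linarith)
  have h7 : (1 - 2 * lam * h) * η ≤ 1 * η := by gcongr; linarith
  linarith

/-- Input-to-state stability of the minimal energy along a pair of solutions. -/
theorem minEnergy_le (hX : IsConnected X.carrier) (hS : X.IsFrame S) (hk : IsFeedback X k)
    (hM : IsUniformMetric X M) (hκ : 0 < κ)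
    (hκV : ∀ x ∈ X.carrier, ∀ d ∈ X.tangent x, κ * ‖d‖ ^ 2 ≤ metricForm S M x d)
    (hlam : 0 < lam)
    (hR1 : ∀ x ∈ X.carrier, ∀ xs ∈ X.carrier, ∀ (us : Vec m) (w : Vec p),
    (-(sys.R1 S k M lam mu x xs us w)).PosSemidef)
    (c : ClosedLoopPair sys k) {t₀ t b : ℝ} (ht₀ : 0 ≤ t₀) (ht : t₀ ≤ t)
    (hmu : 0 < mu)
    (hb : ∀ s ∈ Icc t₀ t, (c.w s - c.ws s) ⬝ᵥ (c.w s - c.ws s) ≤ b) :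
    minEnergy X.carrier S M (c.x t) (c.xs t)
      ≤ Real.exp (-(2 * lam) * (t - t₀)) * minEnergy X.carrier S M (c.x t₀) (c.xs t₀)
        + mu * b / (2 * lam) * (1 - Real.exp (-(2 * lam) * (t - t₀))) := by
  rcases ht.eq_or_lt with rfl | hlt
  · simp
  have hT : 0 < t := ht₀.trans_lt hlt
  have hsub : uIcc t₀ t ⊆ uIcc 0 t := by
    rw [uIcc_of_le ht, uIcc_of_le hT.le]; exact Icc_subset_Icc_left ht₀
  have hpos : ∀ s ∈ uIcc t₀ t, 0 ≤ s := fun s hs => by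
    rw [uIcc_of_le ht] at hs; exact ht₀.trans hs.1
  have hac := absolutelyContinuous_minEnergy (S := S) (M := M) hX hS hM hκ hκV
    ((c.closedLoop.absCont t hT).mono hsub) ((c.nominal.absCont t hT).mono hsub)
    (fun s hs => c.closedLoop.mem s (hpos s hs)) (fun s hs => c.nominal.mem s (hpos s hs))
  refine gronwall_of_absolutelyContinuous (by positivity) ht hac ?_
  filter_upwards [c.nominal.ode, c.closedLoop.ode] with s hs1 hs2 hs hd
  have hs0 : 0 < s := ht₀.trans_lt hs.1
  refine (deriv_minEnergy_le hX hS hk hM hκ hκV hlam hR1 c hs0 (hs1 hs0) (hs2 hs0) hd).trans ?_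
  have := hb s (Ioo_subset_Icc_self hs)
  gcongr

end ClosedLoopPair

end Trajectories

/-! ### Length, energy and output distances -/

section Length

theorem eucl_eq_ofReal_sqrt {n : ℕ} (v : Vec n) : eucl v = ENNReal.ofReal (Real.sqrt (v ⬝ᵥ v)) := by
  rw [eucl, ← ofReal_norm, EuclideanSpace.norm_eq]
  simp [dotProduct, pow_two]

theorem dotProduct_self_le_of_eucl_le {n : ℕ} {v : Vec n} {r : ℝ} (hr : 0 ≤ r)
    (h : eucl v ≤ ENNReal.ofReal r) : v ⬝ᵥ v ≤ r ^ 2 := by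
  rw [eucl_eq_ofReal_sqrt, ENNReal.ofReal_le_ofReal_iff hr] at h
  exact (Real.sqrt_le_left hr).1 h

theorem le_ofReal_sqrt_of_sq_le {a : ℝ≥0∞} {r : ℝ} (h : a ^ 2 ≤ ENNReal.ofReal r) :
    a ≤ ENNReal.ofReal (Real.sqrt r) := by
  rw [← ENNReal.pow_le_pow_left_iff two_ne_zero,
    ← ENNReal.ofReal_pow (Real.sqrt_nonneg r)]
  rcases le_total 0 r with hr | hr
  · rwa [Real.sq_sqrt hr]
  · rw [ENNReal.ofReal_of_nonpos hr] at h
    exact h.trans zero_le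

/-- Cauchy–Schwarz, obtained by integrating `(√f - m)² ≥ 0` with `m` the mean of `√f`. -/
theorem sq_integral_sqrt_le {f : ℝ → ℝ} (hf : ContinuousOn f (Icc 0 1))
    (h0 : ∀ s ∈ Icc (0 : ℝ) 1, 0 ≤ f s) :
    (∫ s in (0 : ℝ)..1, Real.sqrt (f s)) ^ 2 ≤ ∫ s in (0 : ℝ)..1, f s := by
  set m := ∫ s in (0 : ℝ)..1, Real.sqrt (f s) with hm
  have i1 : IntervalIntegrable (fun s => Real.sqrt (f s)) volume 0 1 :=
    intervalIntegrable_of_continuousOn_unitInterval hf.sqrt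
  have i2 := intervalIntegrable_of_continuousOn_unitInterval hf
  have h1 : ∫ s in (0 : ℝ)..1, (2 * m * Real.sqrt (f s) - m ^ 2) ≤ ∫ s in (0 : ℝ)..1, f s := by
    refine intervalIntegral.integral_mono_on zero_le_one
      ((i1.const_mul _).sub intervalIntegrable_const) i2 fun s hs => ?_
    nlinarith [Real.sq_sqrt (h0 s hs), sq_nonneg (Real.sqrt (f s) - m)]
  rw [intervalIntegral.integral_sub (i1.const_mul _) intervalIntegrable_const,
    intervalIntegral.integral_const_mul, ← hm, intervalIntegral.integral_const] at h1
  simp only [sub_zero, one_smul] at h1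
  nlinarith

theorem ofReal_integral_sqrt_sq_le {f : ℝ → ℝ} (hf : ContinuousOn f (Icc 0 1))
    (h0 : ∀ s ∈ Icc (0 : ℝ) 1, 0 ≤ f s) {a : ℝ≥0∞}
    (ha : a ≤ ENNReal.ofReal (∫ s in (0 : ℝ)..1, Real.sqrt (f s))) :
    a ^ 2 ≤ ENNReal.ofReal (∫ s in (0 : ℝ)..1, f s) := by
  calc a ^ 2 ≤ ENNReal.ofReal (∫ s in (0 : ℝ)..1, Real.sqrt (f s)) ^ 2 := by gcongr
    _ = ENNReal.ofReal ((∫ s in (0 : ℝ)..1, Real.sqrt (f s)) ^ 2) :=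
      (ENNReal.ofReal_pow (intervalIntegral.integral_nonneg zero_le_one
        fun _ _ => Real.sqrt_nonneg _) 2).symm
    _ ≤ _ := ENNReal.ofReal_le_ofReal (sq_integral_sqrt_le hf h0)

variable {l : ℕ} {ζ : ℝ → Vec l} {f : ℝ → ℝ}

theorem curveLength_sq_le {G : Vec l → Matrix (Fin l) (Fin l) ℝ} (hf : ContinuousOn f (Icc 0 1))
    (h0 : ∀ s ∈ Icc (0 : ℝ) 1, 0 ≤ f s)
    (h : ∀ s ∈ Icc (0 : ℝ) 1, derivWithin ζ (Icc 0 1) s ⬝ᵥ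
      (G (ζ s) *ᵥ derivWithin ζ (Icc 0 1) s) ≤ f s) :
    curveLength G ζ ^ 2 ≤ ENNReal.ofReal (∫ s in (0 : ℝ)..1, f s) := by
  refine ofReal_integral_sqrt_sq_le hf h0 ?_
  rw [intervalIntegral.integral_of_le zero_le_one, ← integral_Icc_eq_integral_Ioc,
    ofReal_integral_eq_lintegral_ofReal (hf.sqrt.integrableOn_Icc)
      (ae_of_all _ fun _ => Real.sqrt_nonneg _)]
  refine setLIntegral_mono' measurableSet_Icc fun s hs => ?_
  exact ENNReal.ofReal_le_ofReal (Real.sqrt_le_sqrt (h s hs))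

theorem euclDist_sq_le (hζ : ContDiffOn ℝ 1 ζ (Icc 0 1)) (hf : ContinuousOn f (Icc 0 1))
    (h0 : ∀ s ∈ Icc (0 : ℝ) 1, 0 ≤ f s)
    (h : ∀ s ∈ Icc (0 : ℝ) 1,
      derivWithin ζ (Icc 0 1) s ⬝ᵥ derivWithin ζ (Icc 0 1) s ≤ f s) :
    euclDist (ζ 0) (ζ 1) ^ 2 ≤ ENNReal.ofReal (∫ s in (0 : ℝ)..1, f s) := by
  refine ofReal_integral_sqrt_sq_le hf h0 ?_
  -- Coordinate vectors carry the sup norm; the curve is transported to Euclidean space so that the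
  -- norm inequality for integrals concerns the 2-norm.
  set T : Vec l →L[ℝ] EuclideanSpace ℝ (Fin l) :=
    (PiLp.continuousLinearEquiv 2 ℝ (fun _ : Fin l => ℝ)).symm.toContinuousLinearMap with hT
  have hTζ : ContDiffOn ℝ 1 (fun s => T (ζ s)) (Icc 0 1) := T.contDiff.comp_contDiffOn hζ
  have hd : ∀ s ∈ Icc (0 : ℝ) 1, derivWithin (fun s => T (ζ s)) (Icc 0 1) s
      = T (derivWithin ζ (Icc 0 1) s) := fun s hs =>
    (T.hasFDerivAt.comp_hasDerivWithinAt s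
      (hasDerivWithinAt_derivWithin_unitInterval hζ hs)).derivWithin
      (uniqueDiffOn_Icc zero_lt_one s hs)
  have hFTC := integral_derivWithin_eq_sub hTζ (b := 1) ⟨zero_le_one, le_rfl⟩
  have h1 : euclDist (ζ 0) (ζ 1)
      = ENNReal.ofReal ‖∫ s in (0 : ℝ)..1, derivWithin (fun s => T (ζ s)) (Icc 0 1) s‖ := by
    rw [hFTC, norm_sub_rev, ← map_sub, ofReal_norm]; rfl
  rw [h1]
  refine ENNReal.ofReal_le_ofReal (intervalIntegral.norm_integral_le_of_norm_le zero_le_one ?_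
    (intervalIntegrable_of_continuousOn_unitInterval hf.sqrt))
  refine ae_of_all _ fun s hs => ?_
  have hs' := Ioc_subset_Icc_self hs
  rw [hd s hs']
  refine le_trans (le_of_eq ?_) (Real.sqrt_le_sqrt (h s hs'))
  rw [EuclideanSpace.norm_eq]
  congr 1
  simp [dotProduct, hT, pow_two]

end Length

/-! ### The output map and the inequalities `R₂`, `R₂'` -/

section Output

variable {n q m p l : ℕ} {X : EmbeddedLieGroup n q} {sys : ControlSystem X m p l}
  {S : Vec n → Matrix (Fin n) (Fin q) ℝ} {M : Vec n → Matrix (Fin q) (Fin q) ℝ} {κ : ℝ}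
  {k : Vec n → Vec n → Vec m} {α lam mu : ℝ} {G : Vec l → Matrix (Fin l) (Fin l) ℝ}

theorem R2_eq_R2'_one (x xs : Vec n) (us : Vec m) :
    sys.R2 S k M α lam mu x xs us = sys.R2' S k M (fun _ => 1) α lam mu x xs us := by
  simp only [ControlSystem.R2, ControlSystem.R2', Matrix.mul_one]

/-- The form of `R₂'` is tested on `(v, 0)` with `d = S v`, for which `e = 𝒞 v`. -/
theorem output_form_le (hS : X.IsFrame S) (hα : 0 < α) {x xs : Vec n} (hx : x ∈ X.carrier)
    {us : Vec m} (h : (sys.R2' S k M G α lam mu x xs us).PosSemidef) {d : Vec n}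
    (hd : d ∈ X.tangent x) {e : Vec l}
    (he : e = (sys.C x (k x xs + us) + sys.D x (k x xs + us) * jac (fun y => k y xs) x) *ᵥ d) :
    e ⬝ᵥ (G (sys.g x (k x xs + us)) *ᵥ e) ≤ 2 * lam * α * metricForm S M x d := by
  have hd' := hS.mulVec_proj hx hd
  rw [metricForm]
  set v := (proj S x)ᵀ *ᵥ d with hv
  have he' : e = sys.calC S k x xs us *ᵥ v := by
    rw [ControlSystem.calC, ← Matrix.mulVec_mulVec, hd', he]
  have h2 := h.dotProduct_mulVec_nonneg (Sum.elim v 0)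
  simp only [ControlSystem.R2', star_trivial, Matrix.fromBlocks_mulVec, Function.comp_def,
    Sum.elim_inl, Sum.elim_inr, sumElim_dotProduct_sumElim, zero_dotProduct, add_zero,
    Matrix.zero_mulVec, Matrix.sub_mulVec, dotProduct_sub, Matrix.smul_mulVec, dotProduct_smul,
    smul_eq_mul] at h2
  have h3 : e ⬝ᵥ (G (sys.g x (k x xs + us)) *ᵥ e) = v ⬝ᵥ (((sys.calC S k x xs us)ᵀ *
      G (sys.g x (k x xs + us)) * sys.calC S k x xs us) *ᵥ v) := by
    rw [he', ← Matrix.mulVec_mulVec, ← Matrix.mulVec_mulVec, Matrix.dotProduct_mulVec v,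
      Matrix.vecMul_transpose]
  rw [← h3, sub_nonneg, inv_mul_le_iff₀ hα] at h2
  linarith

/-- The form is tested on `(0, e)`. The conclusion is kept as an inequality of forms, since `μ ≤ α`
cannot be inferred when `p = 0`. -/
theorem R2'_mul_sq_le {x xs : Vec n} {us : Vec m}
    (h : (sys.R2' S k M G α lam mu x xs us).PosSemidef) (e : Vec p) :
    mu * (e ⬝ᵥ e) ≤ α * (e ⬝ᵥ e) := by
  have h2 := h.dotProduct_mulVec_nonneg (Sum.elim 0 e)
  simp only [ControlSystem.R2', star_trivial, Matrix.fromBlocks_mulVec, Function.comp_def,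
    Sum.elim_inl, Sum.elim_inr, sumElim_dotProduct_sumElim, zero_dotProduct, zero_add,
    Matrix.zero_mulVec, Matrix.smul_mulVec, Matrix.one_mulVec, dotProduct_smul, smul_eq_mul] at h2
  linarith

/-- The output along a curve of states from `x` to `x*`. -/
theorem outputCurve (hk : IsFeedback X k) {γ : ℝ → Vec n} {x xs : Vec n}
    (hγ : IsCurve X.carrier γ x xs) (hxs : xs ∈ X.carrier) (us : Vec m) :
    ContDiffOn ℝ 1 (fun s => sys.g (γ s) (k (γ s) xs + us)) (Icc 0 1) ∧
    ∀ s ∈ Icc (0 : ℝ) 1, derivWithin (fun s => sys.g (γ s) (k (γ s) xs + us)) (Icc 0 1) s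
      = (sys.C (γ s) (k (γ s) xs + us)
        + sys.D (γ s) (k (γ s) xs + us) * jac (fun y => k y xs) (γ s)) *ᵥ
          derivWithin γ (Icc 0 1) s := by
  have hg : ∀ (y : Vec n) (u : Vec m), y ∈ X.dom →
      ContDiffAt ℝ 1 (fun a : Vec n × Vec m => sys.g a.1 a.2) (y, u) := fun y u hy =>
    sys.contDiff_g.contDiffAt ((X.isOpen_dom.prod isOpen_univ).mem_nhds ⟨hy, mem_univ _⟩)
  have hkγ : ∀ s ∈ Icc (0 : ℝ) 1, ContDiffAt ℝ 1 (fun y => k y xs) (γ s) := fun s hs =>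
    ControlSystem.contDiffAt_feedback hk (X.mem_dom (hγ.mem s hs)) hxs
  constructor
  · intro s hs
    have h1 : ContDiffWithinAt ℝ 1 (fun s => (γ s, k (γ s) xs + us)) (Icc 0 1) s :=
      (hγ.contDiffOn s hs).prodMk
        (((hkγ s hs).comp_contDiffWithinAt s (hγ.contDiffOn s hs)).add contDiffWithinAt_const)
    exact ContDiffAt.comp_contDiffWithinAt (g := fun a : Vec n × Vec m => sys.g a.1 a.2) s
      (hg _ _ (X.mem_dom (hγ.mem s hs))) h1
  · intro s hs
    have hy := X.mem_dom (hγ.mem s hs)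
    set u := k (γ s) xs + us with hu
    set d := derivWithin γ (Icc 0 1) s with hd
    have hG := ((hg (γ s) u hy).differentiableAt one_ne_zero).hasFDerivAt
    have h1 : HasDerivWithinAt γ d (Icc 0 1) s :=
      hasDerivWithinAt_derivWithin_unitInterval hγ.contDiffOn hs
    have h2 : HasDerivWithinAt (fun s => k (γ s) xs + us)
        (fderiv ℝ (fun y => k y xs) (γ s) d) (Icc 0 1) s :=
      (((hkγ s hs).differentiableAt one_ne_zero).hasFDerivAt.comp_hasDerivWithinAt s h1).add_const _
    have h3 := (HasFDerivAt.comp_hasDerivWithinAt (f := fun s => (γ s, k (γ s) xs + us))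
      s hG (h1.prodMk h2)).derivWithin (uniqueDiffOn_Icc zero_lt_one s hs)
    have hC : HasFDerivAt (fun y => sys.g y u)
        ((fderiv ℝ (fun a : Vec n × Vec m => sys.g a.1 a.2) (γ s, u)).comp
          (ContinuousLinearMap.inl ℝ _ _)) (γ s) :=
      HasFDerivAt.comp (g := fun a : Vec n × Vec m => sys.g a.1 a.2) (f := fun y => (y, u)) (γ s)
        hG (hasFDerivAt_prodMk_left (γ s) u)
    have hD : HasFDerivAt (fun v => sys.g (γ s) v)
        ((fderiv ℝ (fun a : Vec n × Vec m => sys.g a.1 a.2) (γ s, u)).comp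
          (ContinuousLinearMap.inr ℝ _ _)) u :=
      HasFDerivAt.comp (g := fun a : Vec n × Vec m => sys.g a.1 a.2) (f := fun v => (γ s, v)) u
        hG (hasFDerivAt_prodMk_right (γ s) u)
    rw [Matrix.add_mulVec, ← Matrix.mulVec_mulVec, ControlSystem.C, ControlSystem.D, jac_mulVec,
      jac_mulVec, jac_mulVec, hC.fderiv, hD.fderiv]
    refine h3.trans ?_
    simp only [ContinuousLinearMap.comp_apply, ContinuousLinearMap.inl_apply,
      ContinuousLinearMap.inr_apply]
    rw [← map_add, Prod.mk_add_mk, add_zero, zero_add]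

end Output

theorem eucl_le_linfNorm {b : ℕ} (v : ℝ → Vec b) {t : ℝ} (ht : 0 ≤ t) :
    eucl (v t) ≤ linfNorm v :=
  le_iSup₂ (f := fun t (_ : t ∈ Ici (0 : ℝ)) => eucl (v t)) t ht

theorem eucl_le_linfNormOn {b : ℕ} (v : ℝ → Vec b) {t T : ℝ} (ht : t ∈ Icc 0 T) :
    eucl (v t) ≤ linfNormOn T v :=
  le_iSup₂ (f := fun t (_ : t ∈ Icc (0 : ℝ) T) => eucl (v t)) t ht

/-- `(α w)² = α² w²` in the extended reals. -/
theorem ofReal_sq_mul_sq {α : ℝ} (hα : 0 ≤ α) (w : ℝ≥0∞) :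
    ENNReal.ofReal (α ^ 2) * w ^ 2 = (ENNReal.ofReal α * w) ^ 2 := by
  rw [mul_pow, ENNReal.ofReal_pow hα]

theorem ofReal_mul_sq_toReal {a : ℝ} (ha : 0 ≤ a) {w : ℝ≥0∞} (hw : w ≠ ⊤) :
    ENNReal.ofReal a * w ^ 2 = ENNReal.ofReal (a * w.toReal ^ 2) := by
  rw [ENNReal.ofReal_mul ha, ENNReal.ofReal_pow ENNReal.toReal_nonneg, ENNReal.ofReal_toReal hw]

/-! ### Gain bound and tube -/

section Conclusion

variable {n q m p l : ℕ} {X : EmbeddedLieGroup n q} {sys : ControlSystem X m p l}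
  {S : Vec n → Matrix (Fin n) (Fin q) ℝ} {M : Vec n → Matrix (Fin q) (Fin q) ℝ} {κ : ℝ}
  {k : Vec n → Vec n → Vec m} {α lam mu : ℝ} {d : Vec l → Vec l → ℝ≥0∞} {Z : Set (Vec l)}

/-- Output distances are dominated by the minimal energy, once they are dominated by the energies. -/
theorem output_sq_le_minEnergy (hX : IsConnected X.carrier) (hk : IsFeedback X k) (hα : 0 < α)
    (hlam : 0 < lam)
    (hd : ∀ x ∈ X.carrier, ∀ xs ∈ X.carrier, ∀ (us : Vec m) (γ : ℝ → Vec n),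
      IsCurve X.carrier γ x xs →
      d (sys.g x (k x xs + us)) (sys.g xs (k xs xs + us)) ^ 2
        ≤ ENNReal.ofReal (2 * lam * α * energy S M γ))
    (c : ClosedLoopPair sys k) {t : ℝ} (ht : 0 ≤ t) :
    d (c.z t) (c.zs t) ^ 2
      ≤ ENNReal.ofReal (2 * lam * α * minEnergy X.carrier S M (c.x t) (c.xs t)) := by
  have hxs := c.nominal.mem t ht
  have hx := c.closedLoop.mem t ht
  have hpos : 0 < 2 * lam * α := by positivity
  refine ENNReal.le_of_forall_pos_le_add fun ε hε _ => ?_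
  obtain ⟨γ, hγ, hlt⟩ := exists_energy_lt (S := S) (M := M) hX hx hxs
    (η := ε / (2 * lam * α)) (by positivity)
  have h1 := hd _ hx _ hxs (c.us t) γ hγ
  rw [hk.diag _ hxs, zero_add] at h1
  refine h1.trans ?_
  rw [← ENNReal.ofReal_coe_nnreal]
  refine le_trans (ENNReal.ofReal_le_ofReal ?_) ENNReal.ofReal_add_le
  calc 2 * lam * α * energy S M γ
      ≤ 2 * lam * α * (minEnergy X.carrier S M (c.x t) (c.xs t) + ε / (2 * lam * α)) := by gcongr
    _ = _ := by field_simp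

/-- The weight `2λα` in `β` makes `β` dominate the squared output distance and turns the level `μ
r²/(2λ)` of the decay estimate into `αμ r²`. The estimate is then a convex combination of the
initial `β` and this level, which gives both properties with the same `β`. -/
theorem gainBound_and_staysInTube (hX : IsConnected X.carrier) (hS : X.IsFrame S)
    (hk : IsFeedback X k) (hM : IsUniformMetric X M) (hκ : 0 < κ)
    (hκV : ∀ x ∈ X.carrier, ∀ d ∈ X.tangent x, κ * ‖d‖ ^ 2 ≤ metricForm S M x d)
    (hα : 0 < α) (hlam : 0 < lam) (hmu : 0 < mu)
    (hR1 : ∀ x ∈ X.carrier, ∀ xs ∈ X.carrier, ∀ (us : Vec m) (w : Vec p),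
      (-(sys.R1 S k M lam mu x xs us w)).PosSemidef)
    (hmuα : ∀ e : Vec p, mu * (e ⬝ᵥ e) ≤ α * (e ⬝ᵥ e))
    (hZ : ∀ x ∈ X.carrier, ∀ u : Vec m, sys.g x u ∈ Z)
    (hd : ∀ x ∈ X.carrier, ∀ xs ∈ X.carrier, ∀ (us : Vec m) (γ : ℝ → Vec n),
      IsCurve X.carrier γ x xs →
      d (sys.g x (k x xs + us)) (sys.g xs (k xs xs + us)) ^ 2
        ≤ ENNReal.ofReal (2 * lam * α * energy S M γ)) :
    HasGainBound sys k d α ∧ StaysInTube sys k Z d α lam mu := by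
  set β : Vec n → Vec n → ℝ := fun x xs => 2 * lam * α * minEnergy X.carrier S M x xs with hβ
  have hβ0 : ∀ x y, 0 ≤ β x y := fun x y =>
    mul_nonneg (by positivity) (minEnergy_nonneg hκ hκV)
  have hβd : ∀ x ∈ X.carrier, β x x = 0 := fun x hx => by
    simp only [hβ, minEnergy_self hκ hκV hx, mul_zero]
  have hout : ∀ (c : ClosedLoopPair sys k) (t : ℝ), 0 ≤ t →
      d (c.z t) (c.zs t) ^ 2 ≤ ENNReal.ofReal (β (c.x t) (c.xs t)) := fun c t ht =>
    output_sq_le_minEnergy hX hk hα hlam hd c ht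
  have hmz : ∀ (c : ClosedLoopPair sys k) (t : ℝ), 0 ≤ t → c.z t ∈ Z := fun c t ht =>
    hZ _ (c.closedLoop.mem t ht) _
  -- the decay estimate for `β`
  have hdecay : ∀ (c : ClosedLoopPair sys k) (t₀ t r : ℝ), 0 ≤ t₀ → t₀ ≤ t →
      (∀ s ∈ Icc t₀ t, eucl (c.w s - c.ws s) ≤ ENNReal.ofReal r) → 0 ≤ r →
      β (c.x t) (c.xs t) ≤ Real.exp (-(2 * lam) * (t - t₀)) * β (c.x t₀) (c.xs t₀)
        + α * mu * r ^ 2 * (1 - Real.exp (-(2 * lam) * (t - t₀))) := by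
    intro c t₀ t r ht₀ ht hr hr0
    have h1 := ClosedLoopPair.minEnergy_le hX hS hk hM hκ hκV hlam hR1 c ht₀ ht hmu
      (fun s hs => dotProduct_self_le_of_eucl_le hr0 (hr s hs))
    have h2 := mul_le_mul_of_nonneg_left h1 (by positivity : 0 ≤ 2 * lam * α)
    refine h2.trans_eq ?_
    simp only [hβ]
    field_simp
  have hexp1 : ∀ t₀ t : ℝ, t₀ ≤ t → Real.exp (-(2 * lam) * (t - t₀)) ≤ 1 := fun t₀ t ht =>
    Real.exp_le_one_iff.2 (by nlinarith)
  -- Without disturbance channels `αμ ≤ α²` may fail, but then the deviation of the disturbances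
  -- vanishes and both sides are needed only at `r = 0`.
  have hmur : ∀ r : ℝ, α * mu * (r ^ 2) ≤ α ^ 2 * r ^ 2 ∨ IsEmpty (Fin p) := by
    intro r
    rcases isEmpty_or_nonempty (Fin p) with hp | ⟨⟨i⟩⟩
    · exact Or.inr hp
    · left
      have h1 := hmuα (Pi.single i 1)
      simp only [dotProduct_single, Pi.single_eq_same, mul_one] at h1
      have : α * mu ≤ α * α := by gcongr
      nlinarith [sq_nonneg r]
  have hempty : IsEmpty (Fin p) → ∀ v : Vec p, eucl v = 0 := fun hp v => by
    rw [eucl_eq_ofReal_sqrt]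
    simp [dotProduct]
  refine ⟨⟨β, fun x _ y _ => hβ0 x y, hβd, fun c T hT => ?_⟩,
    ⟨β, fun x _ y _ => hβ0 x y, hβd, fun c => ?_⟩⟩
  -- An infinite deviation makes the right-hand side infinite, since `α > 0`. Otherwise the estimate
  -- is carried out in the reals.
  · by_cases hN : linfNormOn T (fun t => c.w t - c.ws t) = ⊤
    · rw [hN, ENNReal.top_pow two_ne_zero, ENNReal.mul_top (by simp; positivity), top_add]
      exact le_top
    set r := (linfNormOn T fun t => c.w t - c.ws t).toReal with hr
    have hr0 : 0 ≤ r := ENNReal.toReal_nonneg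
    have hmr : α * mu * r ^ 2 ≤ α ^ 2 * r ^ 2 := by
      rcases hmur r with h | h
      · exact h
      · have : r = 0 := by
          rw [hr, linfNormOn]; simp [hempty h]
        simp [this]
    rw [ofReal_mul_sq_toReal (by positivity) hN, ← ENNReal.ofReal_add (by positivity) (hβ0 _ _)]
    have hle : ⨆ t ∈ Icc (0 : ℝ) T, d (c.z t) (c.zs t)
        ≤ ENNReal.ofReal (Real.sqrt (α ^ 2 * r ^ 2 + β (c.x 0) (c.xs 0))) := by
      refine iSup₂_le fun t ht => le_ofReal_sqrt_of_sq_le ((hout c t ht.1).trans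
        (ENNReal.ofReal_le_ofReal ?_))
      refine (hdecay c 0 t r le_rfl ht.1 (fun s hs => ?_) hr0).trans ?_
      · rw [hr, ENNReal.ofReal_toReal hN]
        exact eucl_le_linfNormOn (fun t => c.w t - c.ws t) ⟨hs.1, hs.2.trans ht.2⟩
      · have e1 := hexp1 0 t ht.1
        have e2 := Real.exp_pos (-(2 * lam) * (t - 0))
        have e3 := hβ0 (c.x 0) (c.xs 0)
        have e4 : 0 ≤ α * mu * r ^ 2 := by positivity
        nlinarith
    calc _ ≤ ENNReal.ofReal (Real.sqrt (α ^ 2 * r ^ 2 + β (c.x 0) (c.xs 0))) ^ 2 := by gcongr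
      _ = _ := by
        rw [← ENNReal.ofReal_pow (Real.sqrt_nonneg _), Real.sq_sqrt]
        have := hβ0 (c.x 0) (c.xs 0)
        positivity
  · by_cases hN : c.wbar = ⊤
    · have htop : ENNReal.ofReal (α ^ 2) * c.wbar ^ 2 = ⊤ := by
        rw [hN, ENNReal.top_pow two_ne_zero, ENNReal.mul_top (by simp; positivity)]
      have htop' : ENNReal.ofReal α * c.wbar = ⊤ := by
        rw [hN, ENNReal.mul_top (by simpa using hα)]
      have htop'' : ENNReal.ofReal (α * mu) * c.wbar ^ 2 = ⊤ := by
        rw [hN, ENNReal.top_pow two_ne_zero, ENNReal.mul_top (by simp; positivity)]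
      refine ⟨fun t _ => ?_, fun ε _ => ?_, fun t₀ ht₀ _ t ht => ⟨?_, hmz c t (ht₀.trans ht), ?_⟩⟩
      · rw [htop, top_add]; exact le_top
      · filter_upwards [eventually_ge_atTop 0] with t ht
        refine ⟨hmz c t ht, ?_⟩
        rw [htop', top_add]; exact le_top
      · rw [htop'']; exact le_top
      · rw [htop']; exact le_top
    set r := c.wbar.toReal with hr
    have hr0 : 0 ≤ r := ENNReal.toReal_nonneg
    have hmr : α * mu * r ^ 2 ≤ α ^ 2 * r ^ 2 := by
      rcases hmur r with h | h
      · exact h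
      · have : r = 0 := by
          rw [hr, ClosedLoopPair.wbar, linfNorm]; simp [hempty h]
        simp [this]
    have hbd : ∀ s : ℝ, 0 ≤ s → eucl (c.w s - c.ws s) ≤ ENNReal.ofReal r := fun s hs => by
      rw [hr, ENNReal.ofReal_toReal hN]
      exact eucl_le_linfNorm (fun t => c.w t - c.ws t) hs
    have hi : ∀ t : ℝ, 0 ≤ t → d (c.z t) (c.zs t) ^ 2 ≤ ENNReal.ofReal (α ^ 2) * c.wbar ^ 2
        + ENNReal.ofReal (Real.exp (-2 * lam * t) * β (c.x 0) (c.xs 0)) := by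
      intro t ht
      have hnn := mul_nonneg (Real.exp_pos (-2 * lam * t)).le (hβ0 (c.x 0) (c.xs 0))
      rw [ofReal_mul_sq_toReal (by positivity) hN, ← ENNReal.ofReal_add (by positivity) hnn]
      refine (hout c t ht).trans (ENNReal.ofReal_le_ofReal ?_)
      refine (hdecay c 0 t r le_rfl ht (fun s hs => hbd s hs.1) hr0).trans ?_
      have e0 : Real.exp (-(2 * lam) * (t - 0)) = Real.exp (-2 * lam * t) := by ring_nf
      rw [e0]
      have e2 := Real.exp_pos (-2 * lam * t)
      have e4 : 0 ≤ α * mu * r ^ 2 := by positivity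
      nlinarith
    refine ⟨hi, fun ε hε => ?_, fun t₀ ht₀ hinit t ht => ?_⟩
    · have hlim : Tendsto (fun t : ℝ => ENNReal.ofReal (Real.exp (-2 * lam * t)
          * β (c.x 0) (c.xs 0))) atTop (𝓝 0) := by
        have h1 : Tendsto (fun t : ℝ => -2 * lam * t) atTop atBot :=
          tendsto_id.const_mul_atTop_of_neg (by linarith)
        have h2 := (Real.tendsto_exp_atBot.comp h1).mul_const (β (c.x 0) (c.xs 0))
        rw [zero_mul] at h2
        simpa using ENNReal.tendsto_ofReal h2
      have hε2 : 0 < ε ^ 2 := ENNReal.pow_pos hε 2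
      filter_upwards [hlim.eventually (ge_mem_nhds hε2), eventually_ge_atTop 0] with t h1 h2
      refine ⟨hmz c t h2, ?_⟩
      rw [← ENNReal.pow_le_pow_left_iff two_ne_zero]
      refine (hi t h2).trans ?_
      -- Once the transient is below `ε²`, the claim follows from `(α w̄)² + ε² ≤ (α w̄ + ε)²`.
      rw [ofReal_sq_mul_sq hα.le, add_sq]
      calc _ ≤ (ENNReal.ofReal α * c.wbar) ^ 2 + ε ^ 2 := by gcongr
        _ ≤ _ := by gcongr; exact le_self_add
    · have h0 : 0 ≤ t := ht₀.trans ht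
      have e4 : 0 ≤ α * mu * r ^ 2 := by positivity
      rw [ofReal_mul_sq_toReal (by positivity) hN] at hinit ⊢
      have hinit' := (ENNReal.ofReal_le_ofReal_iff e4).1 hinit
      -- A convex combination of two numbers that are at most `αμ r²`: the sublevel set is forward
      -- invariant.
      have hle : β (c.x t) (c.xs t) ≤ α * mu * r ^ 2 := by
        refine (hdecay c t₀ t r ht₀ ht (fun s hs => hbd s (ht₀.trans hs.1)) hr0).trans ?_
        have e2 := Real.exp_pos (-(2 * lam) * (t - t₀))
        nlinarith
      refine ⟨ENNReal.ofReal_le_ofReal hle, hmz c t h0, ?_⟩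
      rw [← ENNReal.pow_le_pow_left_iff two_ne_zero, ← ofReal_sq_mul_sq hα.le,
        ofReal_mul_sq_toReal (by positivity) hN]
      exact (hout c t h0).trans (ENNReal.ofReal_le_ofReal (hle.trans hmr))

end Conclusion

end LieRCCM

end

/-! ### The Euclidean and the Riemannian output distance -/

theorem mainTheorem3 {n q m p l : ℕ}
    (X : LieRCCM.EmbeddedLieGroup n q) (hX : IsConnected X.carrier)
    (sys : LieRCCM.ControlSystem X m p l)
    (S : LieRCCM.Vec n → Matrix (Fin n) (Fin q) ℝ) (hS : X.IsFrame S)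
    (hSbdd : ∃ σ : ℝ, ∀ x ∈ X.carrier,
      (σ • (1 : Matrix (Fin q) (Fin q) ℝ) - (S x).transpose * S x).PosSemidef)
    (k : LieRCCM.Vec n → LieRCCM.Vec n → LieRCCM.Vec m) (hk : LieRCCM.IsFeedback X k)
    (M : LieRCCM.Vec n → Matrix (Fin q) (Fin q) ℝ) (hM : LieRCCM.IsUniformMetric X M)
    (α lam mu : ℝ) (hα : 0 < α) (hlam : 0 < lam) (hmu : 0 < mu)
    (hR1 : ∀ x ∈ X.carrier, ∀ xs ∈ X.carrier, ∀ (us : LieRCCM.Vec m) (w : LieRCCM.Vec p),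
      (-(sys.R1 S k M lam mu x xs us w)).PosSemidef) :
    ((∀ x ∈ X.carrier, ∀ xs ∈ X.carrier, ∀ us : LieRCCM.Vec m,
        (sys.R2 S k M α lam mu x xs us).PosSemidef) →
      LieRCCM.HasGainBound sys k LieRCCM.euclDist α ∧
      LieRCCM.StaysInTube sys k Set.univ LieRCCM.euclDist α lam mu) ∧
    (∀ (r : ℕ) (Z : LieRCCM.EmbeddedLieGroup l r)
        (_ : ∀ x ∈ X.carrier, ∀ u : LieRCCM.Vec m, sys.g x u ∈ Z.carrier)
        (Sz : LieRCCM.Vec l → Matrix (Fin l) (Fin r) ℝ) (_ : Z.IsFrame Sz)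
        (Q : Matrix (Fin r) (Fin r) ℝ) (_ : Q.PosDef)
        (_ : ∀ x ∈ X.carrier, ∀ xs ∈ X.carrier, ∀ us : LieRCCM.Vec m,
          (sys.R2' S k M (LieRCCM.weightedMetric Sz Q) α lam mu x xs us).PosSemidef),
      LieRCCM.HasGainBound sys k
        (LieRCCM.riemDist Z.carrier (LieRCCM.weightedMetric Sz Q)) α ∧
      LieRCCM.StaysInTube sys k Z.carrier
        (LieRCCM.riemDist Z.carrier (LieRCCM.weightedMetric Sz Q)) α lam mu) := by
  obtain ⟨κ, hκ, hκV⟩ := LieRCCM.exists_metricForm_ge hS hM hSbdd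
  obtain ⟨x₀, hx₀⟩ := hX.nonempty
  have hform : ∀ (x xs : LieRCCM.Vec n) (γ : ℝ → LieRCCM.Vec n),
      LieRCCM.IsCurve X.carrier γ x xs →
      ContinuousOn (fun s => 2 * lam * α * LieRCCM.metricForm S M (γ s)
        (derivWithin γ (Set.Icc 0 1) s)) (Set.Icc 0 1) ∧
      (∀ s ∈ Set.Icc (0 : ℝ) 1, 0 ≤ 2 * lam * α * LieRCCM.metricForm S M (γ s)
        (derivWithin γ (Set.Icc 0 1) s)) ∧
      2 * lam * α * LieRCCM.energy S M γ = ∫ s in (0 : ℝ)..1, 2 * lam * α *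
        LieRCCM.metricForm S M (γ s) (derivWithin γ (Set.Icc 0 1) s) := fun x xs γ hγ =>
    ⟨continuousOn_const.mul (hγ.continuousOn_metricForm hS hM),
      fun s hs => mul_nonneg (by positivity) (hγ.metricForm_nonneg hκ hκV hs),
      (intervalIntegral.integral_const_mul _ _).symm⟩
  constructor
  · intro hR2
    -- The Euclidean case is the output metric with constant matrix `1`.
    simp only [LieRCCM.R2_eq_R2'_one] at hR2
    refine LieRCCM.gainBound_and_staysInTube hX hS hk hM hκ hκV hα hlam hmu hR1
      (LieRCCM.R2'_mul_sq_le (hR2 x₀ hx₀ x₀ hx₀ 0)) (fun _ _ _ => Set.mem_univ _)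
      fun x hx xs hxs us γ hγ => ?_
    obtain ⟨h1, h2, h3⟩ := hform x xs γ hγ
    obtain ⟨g1, g2⟩ := LieRCCM.outputCurve (sys := sys) hk hγ hxs us
    have h4 := LieRCCM.euclDist_sq_le g1 h1 h2 fun s hs => by
      have := LieRCCM.output_form_le hS hα (hγ.mem s hs) (hR2 _ (hγ.mem s hs) xs hxs us)
        (hγ.derivWithin_mem_tangent hs) (g2 s hs)
      rwa [Matrix.one_mulVec] at this
    rw [h3]
    simpa only [hγ.source, hγ.target] using h4
  · intro r Z hZ Sz _ Q _ hR2
    refine LieRCCM.gainBound_and_staysInTube hX hS hk hM hκ hκV hα hlam hmu hR1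
      (LieRCCM.R2'_mul_sq_le (hR2 x₀ hx₀ x₀ hx₀ 0)) hZ fun x hx xs hxs us γ hγ => ?_
    obtain ⟨h1, h2, h3⟩ := hform x xs γ hγ
    obtain ⟨g1, g2⟩ := LieRCCM.outputCurve (sys := sys) hk hγ hxs us
    have h4 := LieRCCM.curveLength_sq_le (G := LieRCCM.weightedMetric Sz Q)
      (ζ := fun s => sys.g (γ s) (k (γ s) xs + us)) h1 h2 fun s hs =>
        LieRCCM.output_form_le hS hα (hγ.mem s hs) (hR2 _ (hγ.mem s hs) xs hxs us)
          (hγ.derivWithin_mem_tangent hs) (g2 s hs)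
    rw [h3]
    refine le_trans ?_ h4
    gcongr
    -- The image of the state curve under the output map lies in `𝒵`, so it competes in the infimum
    -- defining the Riemannian distance.
    refine iInf₂_le _ ⟨g1, fun s hs => hZ _ (hγ.mem s hs) _, ?_, ?_⟩
    · simp only [hγ.source]
    · simp only [hγ.target]
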